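/- **Setting.** Algorithms are probabilistic and interactive; they get $1^n$ and $1^L$ as input, where $n$ is the security parameter and $L=L(n)$ is a polynomially bounded number of users. PPT means that the number of steps is bounded by a polynomial in $n$ on every input and in every environment; the group operations, the pairing, uniform sampling and the hash functions count as basic steps. A bilinear group generator outputs $(p,\mathbb G,\hat{\mathbb G},\mathbb G_T,e)$ with groups of prime order $p$ and a non-degenerate bilinear map $e:\mathbb G\times\hat{\mathbb G}\to\mathbb G_T$; no isomorphism between the groups is needed. $\mathsf H_1:\hat{\mathbb G}\times\{0,1\}^*\to\mathbb Z_p$ and $\mathsf H_2:\mathbb G_T\to\{0,1\}^n$ are sampled from families of hash functions. $[L]=\{1,\dots,L\}$. **Scheme $\mathrm{DBE}_{SS}$.** *Setup*: choose random generators $g,\hat g$ and random $\alpha,\beta\in\mathbb Z_p$; put $A_k=g^{\alpha^k}$, $\hat A_k=\hat g^{\alpha^k}$, $B=g^\beta$, $B_k=A_k^\beta$. Publish the group, $g$, $\hat g$, $A_k$ ($1\le k\le 2L+2$, $k\ne L+2$), $\hat A_k$ ($1\le k\le L+1$), $B$, $B_k$ ($2\le k\le L+1$), $\Omega=e(A_{L+2},\hat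 g)$, $\mathsf H_1$, $\mathsf H_2$. *GenKey*($i$): for random $\gamma_i\in\mathbb Z_p$ the private key is $K_i=A_{L+2-i}^{\gamma_i}$ and the public key is $V_i=g^{\gamma_i}$, $\hat V_i=\hat g^{\gamma_i}$, $V_{i,k}=A_k^{\gamma_i}$ ($2\le k\le L+1$, $k\ne L+2-i$). *Encaps*($S,AU$): for random $t\in\mathbb Z_p$ and $\omega=\mathsf H_1(\hat g^t\|AU)$ output the header $\hat C_1=\hat g^t$, $C_2=F^t$, where $F=A_{L+1}^{\omega}B\prod_{j\in S}A_jV_j$, and the session key $\mathsf H_2(\Omega^t)$. *Decaps*($S,(\hat C_1,C_2),i,AU$): put $\omega=\mathsf H_1(\hat C_1\|AU)$ and form $F$ as above. Output $\perp$ if $i\notin S$ or $e(C_2,\hat g)\ne e(F,\hat C_1)$. Otherwise choose a random $r\in\mathbb Z_p$, put $D_1=K_iF^r$, $\hat D_2=\hat A_{L+2-i}\hat g^r$, $D_3=A_{2L+3-i}^{\omega}B_{L+2-i}$, $D_4=\prod_{j\in S\setminus\{i\}}A_{L+2-i+j}V_{j,L+2-i}$, and output $\mathsf H_2\big(e(C_2,\hat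 D_2)\,e(D_1D_3D_4,\hat C_1)^{-1}\big)$. **SS-CCA security.** The adversary commits $\tilde S\subseteq[L]$ and gets the public parameters; on request it gets the public keys of all $j\in\tilde S$, and from then on it may ask decryption queries $(S,CH,i,AU)$ with $i\in S\subseteq\tilde S$. Once, it submits $S^*\subseteq\tilde S$ and gets $(CH^*,CK^*_\mu)$ for a random bit $\mu$, where $(CH^*,CK_0^*)$ is output by Encaps on $S^*$ with empty auxiliary input and $CK_1^*=\mathsf H_2(R)$ for a uniformly random $R\in\mathbb G_T$. It may then go on asking decryption queries with $CH\ne CH^*$, and outputs $\mu'$. Its advantage is $\mathrm{Adv}^{SS\text{-}CCA}=|\Pr[\mu=\mu']-\tfrac12|$. The scheme is SS-CCA secure if every PPT adversary has negligible advantage. **Assumptions.** The $\ell$-BDHE challenge consists of the group, of $g$, $g^{a^k}$ ($1\le k\le 2\ell$, $k\neq\ell+1$), $g^c$, $\hat g$, $\hat g^{a^k}$ ($1\le k\le\ell$), $\hat g^c$ for random generators $g,\hat g$ and random $a,c\in\mathbb Z_p$, and of $Z$, which is $Z_0=e(g,\hat g)^{a^{\ell+1}c}$ or $Z_1=e(g,\hat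 g)^w$ with random $w\in\mathbb Z_p$. The advantage $\mathrm{Adv}^{BDHE}$ is $|\Pr[\mathcal B=0\mid Z_0]-\Pr[\mathcal B=0\mid Z_1]|$, and the $\ell$-BDHE assumption says that it is negligible for every PPT $\mathcal B$. $\mathrm{Adv}^{CRHF}$ is the probability of finding, given the group and $\mathsf H_1$, two distinct arguments with the same value of $\mathsf H_1$; $\mathsf H_1$ is collision resistant if it is negligible for every PPT algorithm. **Theorem.** If the $(L+1)$-BDHE assumption holds and $\mathsf H_1$ is collision resistant, then $\mathrm{DBE}_{SS}$ is SS-CCA secure. Quantitatively, for every PPT adversary $\mathcal A$ there are PPT algorithms $\mathcal B_1,\mathcal B_2,\mathcal B_3$ and a polynomial $q$ such that for all $n$ $$\mathrm{Adv}^{SS\text{-}CCA}_{\mathcal A}(n)\le \mathrm{Adv}^{BDHE}_{\mathcal B_1}(n)+\mathrm{Adv}^{CRHF}_{\mathcal B_2}(n)+q(n)\,\mathrm{Adv}^{BDHE}_{\mathcal B_3}(n),$$ where $\mathrm{Adv}^{BDHE}$ is the advantage against $(L+1)$-BDHE. -/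

import Mathlib

noncomputable section

namespace DBE

/-! ## Data -/

/-- The data handled by algorithms: binary trees.  A tree is read as the list of the left
subtrees along its right spine. -/
inductive Val : Type
  | nil : Val
  | node : Val → Val → Val

namespace Val

def hd : Val → Val
  | nil => nil
  | node a _ => a

def tl : Val → Val
  | nil => nil
  | node _ b => b

def toList : Val → List Val
  | nil => []
  | node a b => a :: toList b

def ofList : List Val → Val
  | [] => nil
  | a :: l => node a (ofList l)

def len (v : Val) : ℕ := v.toList.length

/-- `nil` is the bit 0, everything else is the bit 1. -/
def toBool : Val → Bool
  | nil => false
  | node _ _ => true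

def ofBool : Bool → Val
  | false => nil
  | true => node nil nil

/-- Natural numbers in unary, `1^n`. -/
def ofNat (n : ℕ) : Val := ofList (List.replicate n nil)

def ofBits (l : List Bool) : Val := ofList (l.map ofBool)

def toBits (v : Val) : List Bool := v.toList.map toBool

/-- `nil` encodes the failure symbol `⊥`. -/
def ofOption : Option Val → Val
  | none => nil
  | some v => node nil v

/-- A subset of `{1, …, L}`, given by its characteristic vector. -/
def toSet (L : ℕ) (v : Val) : Finset ℕ :=
  (Finset.Icc 1 L).filter fun j => ((v.toList.getD (j - 1) nil).toBool = true)

end Val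

/-! ## Bilinear groups and hash functions -/

/-- Asymmetric bilinear groups `(p, G, Gh, GT, e)` of prime order `p`. -/
structure BilinearGroup where
  p : ℕ
  prime : p.Prime
  G : Type
  Gh : Type
  GT : Type
  [commG : CommGroup G]
  [commGh : CommGroup Gh]
  [commGT : CommGroup GT]
  [fintypeG : Fintype G]
  [fintypeGh : Fintype Gh]
  [fintypeGT : Fintype GT]
  card_G : Fintype.card G = p
  card_Gh : Fintype.card Gh = p
  card_GT : Fintype.card GT = p
  e : G →* Gh →* GT
  nondegenerate : ∃ (g : G) (h : Gh), orderOf (e g h) = p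

attribute [instance] BilinearGroup.commG BilinearGroup.commGh BilinearGroup.commGT
  BilinearGroup.fintypeG BilinearGroup.fintypeGh BilinearGroup.fintypeGT

instance (𝔹 : BilinearGroup) : NeZero 𝔹.p := ⟨𝔹.prime.ne_zero⟩

/-- A bilinear group generator together with the two families of hash functions.
Group descriptions, group elements and hash keys are given to algorithms through injective
encodings.  `n` is the security parameter throughout. -/
structure PairingSystem where
  /-- descriptions of bilinear groups -/
  Desc : Type
  grp : Desc → BilinearGroup
  /-- the group generator -/
  gen : ℕ → PMF Desc
  encDesc : Desc → Val
  encDesc_inj : Function.Injective encDesc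
  encG : ∀ d, (grp d).G → Val
  encG_inj : ∀ d, Function.Injective (encG d)
  encGh : ∀ d, (grp d).Gh → Val
  encGh_inj : ∀ d, Function.Injective (encGh d)
  encGT : ∀ d, (grp d).GT → Val
  encGT_inj : ∀ d, Function.Injective (encGT d)
  /-- the family `H₁` with its key sampler; its argument is an element of `Gh` followed by an
  auxiliary bit string -/
  Key1 : ℕ → Desc → Type
  genKey1 : ∀ n d, PMF (Key1 n d)
  encKey1 : ∀ n d, Key1 n d → Val
  encKey1_inj : ∀ n d, Function.Injective (encKey1 n d)
  H1 : ∀ n d, Key1 n d → (grp d).Gh → List Bool → ZMod (grp d).p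
  /-- the family `H₂` with its key sampler -/
  Key2 : ℕ → Desc → Type
  genKey2 : ∀ n d, PMF (Key2 n d)
  encKey2 : ∀ n d, Key2 n d → Val
  encKey2_inj : ∀ n d, Function.Injective (encKey2 n d)
  H2 : ∀ n d, Key2 n d → (grp d).GT → List.Vector Bool n

namespace BilinearGroup

/-- A uniformly random exponent. -/
def randScalar (𝔹 : BilinearGroup) : PMF (ZMod 𝔹.p) := PMF.uniformOfFintype (ZMod 𝔹.p)

/-- Exponents in binary, least significant bit first. -/
def encScalar (𝔹 : BilinearGroup) (z : ZMod 𝔹.p) : Val := Val.ofBits z.val.bits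

theorem filter_ne_one_nonempty {X : Type} [Group X] [Fintype X] [DecidableEq X]
    (h : 1 < Fintype.card X) : ((Finset.univ : Finset X).filter (· ≠ 1)).Nonempty := by
  have := Fintype.one_lt_card_iff_nontrivial.mp h
  obtain ⟨x, hx⟩ := exists_ne (1 : X)
  exact ⟨x, by simp [hx]⟩

open Classical in
/-- A uniformly random generator (in a group of prime order: a uniformly random element
other than `1`). -/
def randGenerator {X : Type} [Group X] [Fintype X] (h : 1 < Fintype.card X) : PMF X :=
  PMF.uniformOfFinset (Finset.univ.filter (· ≠ 1)) (filter_ne_one_nonempty h)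

def randG (𝔹 : BilinearGroup) : PMF 𝔹.G :=
  randGenerator (by rw [𝔹.card_G]; exact 𝔹.prime.one_lt)

def randGh (𝔹 : BilinearGroup) : PMF 𝔹.Gh :=
  randGenerator (by rw [𝔹.card_Gh]; exact 𝔹.prime.one_lt)

def randGT (𝔹 : BilinearGroup) : PMF 𝔹.GT := PMF.uniformOfFinset Finset.univ ⟨1, by simp⟩

end BilinearGroup

/-- The group description as seen by algorithms: the order `p` in binary and the code of the
description. -/
def PairingSystem.descVal (P : PairingSystem) (d : P.Desc) : Val :=
  Val.node (Val.ofBits (P.grp d).p.bits) (P.encDesc d)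

/-! ## Algorithms -/

/-- The basic algorithms that come with the groups and the hash functions.  Each of them takes
the group description as an input (the hash functions also take `1^n`). -/
inductive Prim : Type
  | scalarAdd | scalarMul | scalarNeg | scalarInv | scalarRand
  | isG | mulG | powG | randG
  | isGh | mulGh | powGh | randGh
  | isGT | mulGT | powGT
  | pair
  | genKey1 | hash1 | genKey2 | hash2

open Function in
/-- Result of a basic algorithm; `none` if the arguments do not encode objects of the right
kind. -/
def Prim.eval? (P : PairingSystem) : Prim → List Val → Option (PMF Val)
  | scalarAdd, [D, x, y] => do
      let d ← partialInv P.descVal D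
      let a ← partialInv (P.grp d).encScalar x
      let b ← partialInv (P.grp d).encScalar y
      some (PMF.pure ((P.grp d).encScalar (a + b)))
  | scalarMul, [D, x, y] => do
      let d ← partialInv P.descVal D
      let a ← partialInv (P.grp d).encScalar x
      let b ← partialInv (P.grp d).encScalar y
      some (PMF.pure ((P.grp d).encScalar (a * b)))
  | scalarNeg, [D, x] => do
      let d ← partialInv P.descVal D
      let a ← partialInv (P.grp d).encScalar x
      some (PMF.pure ((P.grp d).encScalar (-a)))
  | scalarInv, [D, x] => do
      let d ← partialInv P.descVal D
      let a ← partialInv (P.grp d).encScalar x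
      some (PMF.pure ((P.grp d).encScalar a⁻¹))
  | scalarRand, [D] => do
      let d ← partialInv P.descVal D
      some ((P.grp d).randScalar.map (P.grp d).encScalar)
  | isG, [D, x] => do
      let d ← partialInv P.descVal D
      some (PMF.pure (Val.ofBool (partialInv (P.encG d) x).isSome))
  | mulG, [D, x, y] => do
      let d ← partialInv P.descVal D
      let a ← partialInv (P.encG d) x
      let b ← partialInv (P.encG d) y
      some (PMF.pure (P.encG d (a * b)))
  | powG, [D, x, y] => do
      let d ← partialInv P.descVal D
      let a ← partialInv (P.encG d) x
      let z ← partialInv (P.grp d).encScalar y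
      some (PMF.pure (P.encG d (a ^ z.val)))
  | randG, [D] => do
      let d ← partialInv P.descVal D
      some ((P.grp d).randG.map (P.encG d))
  | isGh, [D, x] => do
      let d ← partialInv P.descVal D
      some (PMF.pure (Val.ofBool (partialInv (P.encGh d) x).isSome))
  | mulGh, [D, x, y] => do
      let d ← partialInv P.descVal D
      let a ← partialInv (P.encGh d) x
      let b ← partialInv (P.encGh d) y
      some (PMF.pure (P.encGh d (a * b)))
  | powGh, [D, x, y] => do
      let d ← partialInv P.descVal D
      let a ← partialInv (P.encGh d) x
      let z ← partialInv (P.grp d).encScalar y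
      some (PMF.pure (P.encGh d (a ^ z.val)))
  | randGh, [D] => do
      let d ← partialInv P.descVal D
      some ((P.grp d).randGh.map (P.encGh d))
  | isGT, [D, x] => do
      let d ← partialInv P.descVal D
      some (PMF.pure (Val.ofBool (partialInv (P.encGT d) x).isSome))
  | mulGT, [D, x, y] => do
      let d ← partialInv P.descVal D
      let a ← partialInv (P.encGT d) x
      let b ← partialInv (P.encGT d) y
      some (PMF.pure (P.encGT d (a * b)))
  | powGT, [D, x, y] => do
      let d ← partialInv P.descVal D
      let a ← partialInv (P.encGT d) x
      let z ← partialInv (P.grp d).encScalar y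
      some (PMF.pure (P.encGT d (a ^ z.val)))
  | pair, [D, x, y] => do
      let d ← partialInv P.descVal D
      let a ← partialInv (P.encG d) x
      let b ← partialInv (P.encGh d) y
      some (PMF.pure (P.encGT d ((P.grp d).e a b)))
  | genKey1, [N, D] => do
      let d ← partialInv P.descVal D
      some ((P.genKey1 N.len d).map (P.encKey1 N.len d))
  | hash1, [N, D, k, x, au] => do
      let d ← partialInv P.descVal D
      let κ ← partialInv (P.encKey1 N.len d) k
      let a ← partialInv (P.encGh d) x
      some (PMF.pure ((P.grp d).encScalar (P.H1 N.len d κ a au.toBits)))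
  | genKey2, [N, D] => do
      let d ← partialInv P.descVal D
      some ((P.genKey2 N.len d).map (P.encKey2 N.len d))
  | hash2, [N, D, k, x] => do
      let d ← partialInv P.descVal D
      let κ ← partialInv (P.encKey2 N.len d) k
      let a ← partialInv (P.encGT d) x
      some (PMF.pure (Val.ofBits (P.H2 N.len d κ a).toList))
  | _, _ => none

def Prim.eval (P : PairingSystem) (f : Prim) (args : List Val) : PMF Val :=
  (f.eval? P args).getD (PMF.pure Val.nil)

/-- Probabilistic interactive algorithms: programs over registers `0, 1, 2, …` that hold data.
`loop x c` repeats `c` as often as the list in register `x` is long when the loop is entered.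
(A machine with a polynomial clock is simulated by building the clock with nested loops, so
that the polynomial-time programs are the usual polynomial-time machines.) -/
inductive Prog : Type
  | skip : Prog
  | seq : Prog → Prog → Prog
  /-- `x := nil` -/
  | clear (x : ℕ) : Prog
  /-- `x := y` -/
  | copy (x y : ℕ) : Prog
  /-- `x := node y z` -/
  | cons (x y z : ℕ) : Prog
  /-- `x := hd y` -/
  | hd (x y : ℕ) : Prog
  /-- `x := tl y` -/
  | tl (x y : ℕ) : Prog
  /-- `x :=` the truth value of `y = z` -/
  | eq (x y z : ℕ) : Prog
  /-- `x :=` a fair coin -/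
  | flip (x : ℕ) : Prog
  /-- `x :=` the result of a basic algorithm on the contents of the registers `ys` -/
  | call (x : ℕ) (f : Prim) (ys : List ℕ) : Prog
  /-- `x :=` the answer of the environment to the message in register `y` -/
  | query (x y : ℕ) : Prog
  | ite (x : ℕ) : Prog → Prog → Prog
  | loop (x : ℕ) : Prog → Prog

/-- Register contents, state of the environment, and number of steps made so far. -/
structure Config (σ : Type) where
  mem : ℕ → Val
  env : σ
  time : ℕ

namespace Config

def tick {σ : Type} (s : Config σ) : Config σ := { s with time := s.time + 1 }

def set {σ : Type} (s : Config σ) (x : ℕ) (v : Val) : Config σ :=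
  { s with mem := Function.update s.mem x v, time := s.time + 1 }

/-- At the start the registers `0, 1, 2` hold `1^n`, `1^L` and the input, all others `nil`. -/
def start {σ : Type} (n L : ℕ) (input : Val) (env : σ) : Config σ where
  mem := fun x => if x = 0 then Val.ofNat n else if x = 1 then Val.ofNat L
    else if x = 2 then input else Val.nil
  env := env
  time := 0

end Config

def iterate {α : Type} (f : α → PMF α) : ℕ → α → PMF α
  | 0, a => PMF.pure a
  | k + 1, a => (f a).bind (iterate f k)

open Classical in
/-- Execution of a program in an environment that answers messages by `h`. -/
def Prog.run (P : PairingSystem) {σ : Type} (h : σ → Val → PMF (Val × σ)) :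
    Prog → Config σ → PMF (Config σ)
  | skip => fun s => PMF.pure s.tick
  | seq c₁ c₂ => fun s => (Prog.run P h c₁ s).bind (Prog.run P h c₂)
  | clear x => fun s => PMF.pure (s.set x Val.nil)
  | copy x y => fun s => PMF.pure (s.set x (s.mem y))
  | cons x y z => fun s => PMF.pure (s.set x (Val.node (s.mem y) (s.mem z)))
  | hd x y => fun s => PMF.pure (s.set x (s.mem y).hd)
  | tl x y => fun s => PMF.pure (s.set x (s.mem y).tl)
  | eq x y z => fun s => PMF.pure (s.set x (Val.ofBool (decide (s.mem y = s.mem z))))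
  | flip x => fun s => (PMF.uniformOfFintype Bool).map fun b => s.set x (Val.ofBool b)
  | call x f ys => fun s => (f.eval P (ys.map s.mem)).map fun v => s.set x v
  | query x y => fun s =>
      (h s.env (s.mem y)).map fun r => { s.set x r.1 with env := r.2 }
  | ite x c₁ c₂ => fun s =>
      if (s.mem x).toBool = true then Prog.run P h c₁ s.tick else Prog.run P h c₂ s.tick
  | loop x c => fun s => iterate (Prog.run P h c) (s.mem x).len s.tick

/-- Probabilistic polynomial time: some polynomial in the security parameter bounds the number
of steps of every execution, on every input and in every environment. -/
def PPT (P : PairingSystem) (L : ℕ → ℕ) (c : Prog) : Prop :=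
  ∃ q : Polynomial ℕ, ∀ (n : ℕ) (input : Val) (σ : Type) (h : σ → Val → PMF (Val × σ)) (env : σ),
    ∀ s ∈ (c.run P h (Config.start n (L n) input env)).support, s.time ≤ q.eval n

/-- Output (register `0`) of a program that runs alone. -/
def Prog.output (P : PairingSystem) (c : Prog) (n L : ℕ) (input : Val) : PMF Val :=
  (c.run P (fun (_ : Unit) _ => PMF.pure (Val.nil, ())) (Config.start n L input ())).map
    fun s => s.mem 0

def Negligible (f : ℕ → ℝ) : Prop :=
  Asymptotics.SuperpolynomialDecay Filter.atTop (fun n : ℕ => (n : ℝ)) f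

/-! ## The bilinear Diffie-Hellman exponent assumption -/

/-- The `ℓ`-BDHE challenge: the group description, `g`, `g^(a^k)` for `1 ≤ k ≤ 2ℓ`, `k ≠ ℓ + 1`,
`g^c`, then `ĝ`, `ĝ^(a^k)` for `1 ≤ k ≤ ℓ`, `ĝ^c`, and finally `Z`, which is
`e(g, ĝ)^(a^(ℓ+1) c)` if `b = false` and `e(g, ĝ)^w` with a random `w` if `b = true`. -/
def bdheChallenge (P : PairingSystem) (n ℓ : ℕ) (b : Bool) : PMF Val := do
  let d ← P.gen n
  let 𝔹 := P.grp d
  let g ← 𝔹.randG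
  let gh ← 𝔹.randGh
  let a ← 𝔹.randScalar
  let c ← 𝔹.randScalar
  let w ← 𝔹.randScalar
  let Z : 𝔹.GT := 𝔹.e g gh ^ (if b then w else a ^ (ℓ + 1) * c).val
  PMF.pure (Val.ofList [
    P.descVal d,
    P.encG d g,
    Val.ofList (((List.range' 1 (2 * ℓ)).filter (· ≠ ℓ + 1)).map
      fun k => P.encG d (g ^ (a ^ k).val)),
    P.encG d (g ^ c.val),
    P.encGh d gh,
    Val.ofList ((List.range' 1 ℓ).map fun k => P.encGh d (gh ^ (a ^ k).val)),
    P.encGh d (gh ^ c.val),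
    P.encGT d Z])

/-- Probability that the adversary outputs `0` on the challenge with bit `b`. -/
def bdheProb (P : PairingSystem) (L : ℕ → ℕ) (c : Prog) (n : ℕ) (b : Bool) : ℝ :=
  (((bdheChallenge P n (L n + 1) b).bind fun x => (c.output P n (L n) x).map Val.toBool)
    false).toReal

/-- Advantage against `(L+1)`-BDHE. -/
def bdheAdv (P : PairingSystem) (L : ℕ → ℕ) (c : Prog) (n : ℕ) : ℝ :=
  |bdheProb P L c n false - bdheProb P L c n true|

def BDHEAssumption (P : PairingSystem) (L : ℕ → ℕ) : Prop :=
  ∀ c : Prog, PPT P L c → Negligible (bdheAdv P L c)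

/-! ## Collision resistance -/

/-- `v` encodes a pair of distinct arguments of `H₁` with the same value. -/
def IsCollision (P : PairingSystem) (n : ℕ) (d : P.Desc) (κ : P.Key1 n d) (v : Val) : Prop :=
  ∃ x y : (P.grp d).Gh, ∃ s t : List Bool,
    v.hd.hd = P.encGh d x ∧ v.hd.tl.toBits = s ∧
    v.tl.hd = P.encGh d y ∧ v.tl.tl.toBits = t ∧
    (x, s) ≠ (y, t) ∧ P.H1 n d κ x s = P.H1 n d κ y t

open Classical in
/-- Probability of finding a collision of `H₁`, given the group description and the key. -/
def crAdv (P : PairingSystem) (L : ℕ → ℕ) (c : Prog) (n : ℕ) : ℝ :=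
  ((do
    let d ← P.gen n
    let κ ← P.genKey1 n d
    let v ← c.output P n (L n) (Val.node (P.descVal d) (P.encKey1 n d κ))
    PMF.pure (decide (IsCollision P n d κ v)) : PMF Bool) true).toReal

def CollisionResistant (P : PairingSystem) (L : ℕ → ℕ) : Prop :=
  ∀ c : Prog, PPT P L c → Negligible (crAdv P L c)

/-! ## The scheme -/

/-- Public parameters.  Only the entries listed in `PP.enc` are published, and the algorithms
read no others. -/
structure PP (P : PairingSystem) (n L : ℕ) where
  d : P.Desc
  g : (P.grp d).G
  gh : (P.grp d).Gh
  A : ℕ → (P.grp d).G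
  Ah : ℕ → (P.grp d).Gh
  B : (P.grp d).G
  Bs : ℕ → (P.grp d).G
  Ω : (P.grp d).GT
  κ₁ : P.Key1 n d
  κ₂ : P.Key2 n d

/-- Public keys; `W k` is published for `2 ≤ k ≤ L + 1`, `k ≠ L + 2 - i`. -/
structure UPK (𝔹 : BilinearGroup) where
  V : 𝔹.G
  Vh : 𝔹.Gh
  W : ℕ → 𝔹.G

/-- Private keys. -/
structure USK (𝔹 : BilinearGroup) where
  K : 𝔹.G

/-- Ciphertext headers. -/
structure Header (𝔹 : BilinearGroup) where
  C₁ : 𝔹.Gh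
  C₂ : 𝔹.G

section Scheme

variable {P : PairingSystem} {n L : ℕ}

def PP.enc (pp : PP P n L) : Val := Val.ofList [
  P.descVal pp.d,
  P.encG pp.d pp.g,
  P.encGh pp.d pp.gh,
  Val.ofList (((List.range' 1 (2 * L + 2)).filter (· ≠ L + 2)).map fun k => P.encG pp.d (pp.A k)),
  Val.ofList ((List.range' 1 (L + 1)).map fun k => P.encGh pp.d (pp.Ah k)),
  P.encG pp.d pp.B,
  Val.ofList ((List.range' 2 L).map fun k => P.encG pp.d (pp.Bs k)),
  P.encGT pp.d pp.Ω,
  P.encKey1 n pp.d pp.κ₁,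
  P.encKey2 n pp.d pp.κ₂]

/-- The public key of user `i` together with its index. -/
def PP.encUPK (pp : PP P n L) (i : ℕ) (k : UPK (P.grp pp.d)) : Val := Val.ofList [
  Val.ofNat i,
  P.encG pp.d k.V,
  P.encGh pp.d k.Vh,
  Val.ofList (((List.range' 2 L).filter (· ≠ L + 2 - i)).map fun j => P.encG pp.d (k.W j))]

variable (P n L) in
def setup : PMF (PP P n L) := do
  let d ← P.gen n
  let 𝔹 := P.grp d
  let g ← 𝔹.randG
  let gh ← 𝔹.randGh
  let α ← 𝔹.randScalar
  let β ← 𝔹.randScalar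
  let κ₁ ← P.genKey1 n d
  let κ₂ ← P.genKey2 n d
  PMF.pure {
    d := d
    g := g
    gh := gh
    A := fun k => if k = L + 2 then 1 else g ^ (α ^ k).val
    Ah := fun k => gh ^ (α ^ k).val
    B := g ^ β.val
    Bs := fun k => (g ^ (α ^ k).val) ^ β.val
    Ω := 𝔹.e (g ^ (α ^ (L + 2)).val) gh
    κ₁ := κ₁
    κ₂ := κ₂ }

def genKey (pp : PP P n L) (i : ℕ) : PMF (USK (P.grp pp.d) × UPK (P.grp pp.d)) := do
  let γ ← (P.grp pp.d).randScalar
  PMF.pure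
    ({ K := pp.A (L + 2 - i) ^ γ.val },
     { V := pp.g ^ γ.val
       Vh := pp.gh ^ γ.val
       W := fun k => if k = L + 2 - i then 1 else pp.A k ^ γ.val })

/-- `A_{L+1}^ω · B · ∏_{j ∈ S} A_j V_j`. -/
def base (pp : PP P n L) (upk : ℕ → UPK (P.grp pp.d)) (S : Finset ℕ) (ω : ZMod (P.grp pp.d).p) :
    (P.grp pp.d).G :=
  pp.A (L + 1) ^ ω.val * pp.B * ∏ j ∈ S, pp.A j * (upk j).V

/-- Encapsulation with auxiliary input `au` (`[]` if there is none). -/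
def encaps (pp : PP P n L) (upk : ℕ → UPK (P.grp pp.d)) (S : Finset ℕ) (au : List Bool) :
    PMF (Header (P.grp pp.d) × List.Vector Bool n) := do
  let t ← (P.grp pp.d).randScalar
  let ω := P.H1 n pp.d pp.κ₁ (pp.gh ^ t.val) au
  PMF.pure
    ({ C₁ := pp.gh ^ t.val, C₂ := base pp upk S ω ^ t.val },
     P.H2 n pp.d pp.κ₂ (pp.Ω ^ t.val))

open Classical in
def decaps (pp : PP P n L) (upk : ℕ → UPK (P.grp pp.d)) (S : Finset ℕ)
    (ch : Header (P.grp pp.d)) (i : ℕ) (usk : USK (P.grp pp.d)) (au : List Bool) :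
    PMF (Option (List.Vector Bool n)) :=
  let 𝔹 := P.grp pp.d
  let ω := P.H1 n pp.d pp.κ₁ ch.C₁ au
  if i ∉ S then PMF.pure none
  else if 𝔹.e ch.C₂ pp.gh ≠ 𝔹.e (base pp upk S ω) ch.C₁ then PMF.pure none
  else do
    let r ← 𝔹.randScalar
    let D₁ := usk.K * base pp upk S ω ^ r.val
    let D₂ := pp.Ah (L + 2 - i) * pp.gh ^ r.val
    let D₃ := pp.A (2 * L + 3 - i) ^ ω.val * pp.Bs (L + 2 - i)
    let D₄ := ∏ j ∈ S.erase i, pp.A (L + 2 - i + j) * (upk j).W (L + 2 - i)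
    PMF.pure (some (P.H2 n pp.d pp.κ₂ (𝔹.e ch.C₂ D₂ * (𝔹.e (D₁ * D₃ * D₄) ch.C₁)⁻¹)))

/-! ## The semi-static CCA experiment -/

/-- Independent key pairs for the listed users. -/
def genKeys (pp : PP P n L) : List ℕ → PMF (ℕ → USK (P.grp pp.d) × UPK (P.grp pp.d))
  | [] => PMF.pure fun _ => (⟨1⟩, ⟨1, 1, fun _ => 1⟩)
  | i :: l => do
      let k ← genKey pp i
      let ks ← genKeys pp l
      PMF.pure (Function.update ks i k)

/-- State of the challenger. -/
inductive Challenger (P : PairingSystem) (n L : ℕ) : Type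
  /-- nothing has happened yet -/
  | start
  /-- the initial set is committed and the public parameters are published -/
  | params (S₀ : Finset ℕ) (pp : PP P n L)
  /-- query phase 1, after key generation -/
  | phase1 (S₀ : Finset ℕ) (pp : PP P n L) (keys : ℕ → USK (P.grp pp.d) × UPK (P.grp pp.d))
  /-- query phase 2 -/
  | phase2 (S₀ : Finset ℕ) (pp : PP P n L) (keys : ℕ → USK (P.grp pp.d) × UPK (P.grp pp.d))
      (ch : Header (P.grp pp.d))

open Classical Function in
/-- Answer to a decryption query `(S, C₁, C₂, i, AU)`, with the header in `forbidden` (if any)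
excluded.  Inadmissible queries are answered by `nil`. -/
def decryptionOracle (S₀ : Finset ℕ) (pp : PP P n L)
    (keys : ℕ → USK (P.grp pp.d) × UPK (P.grp pp.d)) (forbidden : Option (Header (P.grp pp.d)))
    (w : Val) : PMF Val :=
  let S := w.hd.toSet L
  let i := w.tl.tl.tl.hd.len
  let au := w.tl.tl.tl.tl.hd.toBits
  match partialInv (P.encGh pp.d) w.tl.hd, partialInv (P.encG pp.d) w.tl.tl.hd with
  | some c₁, some c₂ =>
      if S ⊆ S₀ ∧ i ∈ S ∧ forbidden ≠ some ⟨c₁, c₂⟩ then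
        (decaps pp (fun j => (keys j).2) S ⟨c₁, c₂⟩ i (keys i).1 au).map
          fun ck => Val.ofOption (ck.map fun k => Val.ofBits k.toList)
      else PMF.pure Val.nil
  | _, _ => PMF.pure Val.nil

open Classical in
/-- The challenger with coin `μ`.  The first message commits the initial set and is answered by
the public parameters; the second one is the key generation query.  After that a message
`node nil S` is a request for the challenge on `S` and any other message `node _ w` is the
decryption query `w`. -/
def challenger (μ : Bool) : Challenger P n L → Val → PMF (Val × Challenger P n L)
  | .start, v => do
      let pp ← setup P n L
      PMF.pure (pp.enc, .params (v.toSet L) pp)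
  | .params S₀ pp, _ => do
      let users := (List.range' 1 L).filter (· ∈ S₀)
      let keys ← genKeys pp users
      PMF.pure (Val.ofList (users.map fun j => pp.encUPK j (keys j).2), .phase1 S₀ pp keys)
  | .phase1 S₀ pp keys, v =>
      if v.hd.toBool = true then
        (decryptionOracle S₀ pp keys none v.tl).map fun r => (r, .phase1 S₀ pp keys)
      else if v.tl.toSet L ⊆ S₀ then do
        let c ← encaps pp (fun j => (keys j).2) (v.tl.toSet L) []
        let R ← (P.grp pp.d).randGT
        let ck := if μ then P.H2 n pp.d pp.κ₂ R else c.2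
        PMF.pure
          (Val.ofList [P.encGh pp.d c.1.C₁, P.encG pp.d c.1.C₂, Val.ofBits ck.toList],
           .phase2 S₀ pp keys c.1)
      else PMF.pure (Val.nil, .phase1 S₀ pp keys)
  | .phase2 S₀ pp keys ch, v =>
      if v.hd.toBool = true then
        (decryptionOracle S₀ pp keys (some ch) v.tl).map fun r => (r, .phase2 S₀ pp keys ch)
      else PMF.pure (Val.nil, .phase2 S₀ pp keys ch)

end Scheme

/-- The experiment; the result is `true` if the adversary's guess (register `0`) is correct. -/
def ssExperiment (P : PairingSystem) (L : ℕ → ℕ) (A : Prog) (n : ℕ) : PMF Bool := do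
  let μ ← PMF.uniformOfFintype Bool
  let s ← A.run P (challenger (P := P) (n := n) (L := L n) μ)
    (Config.start n (L n) Val.nil Challenger.start)
  PMF.pure ((s.mem 0).toBool == μ)

/-- Advantage in the semi-static CCA experiment. -/
def ssAdv (P : PairingSystem) (L : ℕ → ℕ) (A : Prog) (n : ℕ) : ℝ :=
  |(ssExperiment P L A n true).toReal - 1 / 2|

def SSCCASecure (P : PairingSystem) (L : ℕ → ℕ) : Prop :=
  ∀ A : Prog, PPT P L A → Negligible (ssAdv P L A)

end DBE

end

/-! Write `ω*` for the hash `H₁(ĝ^t ‖ ∅)` of the challenge and `F(S, ω)` for the base of the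
ciphertexts, whose exponent is `α^(L+1) ω + β + ∑_{j ∈ S} (α^j + γ_j)`. For a valid ciphertext the
value hashed by `decaps` is `e(g, C₁)^(α^(L+2))`, whichever user decrypts and whichever `r` is drawn
(`decaps_eq`). So all answers of the challenger are functions of one table of random choices, and
these may be made before the interaction, including `t` (`run_challenger`).

Hiding the session key. Take a BDHE challenge with `a = α`, `c = t`, draw `β'` and `γ'_j`, and put
`β = β' - ω* α^(L+1)`, `γ_j = γ'_j - α^j`. Then `F(S, ω*)` has the known exponent `β' + ∑ γ'_j`, so
the challenge ciphertext is a known power of `g^t`, and `Z` serves as the session key before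
hashing. The public keys never need `A_{L+2}`: the entry that would need it is the one that is not
published. A ciphertext with `ω ≠ ω*` is decrypted without private keys: for valid ciphertexts
`e(C₂, ĝ^α) = e(F, C₁)^α`, and after division by the part with known exponents `e(g, C₁)^(α^(L+2) (ω
- ω*))` is left, from which the root is taken (`ans_sim₁`). The adversary's bit therefore
distinguishes the two kinds of `Z` (`bind_prep₁`, `bdheProb_sim₁`), unless it makes a query with `ω
= ω*` (`game_sim₁`).

Queries with `ω = ω*`. If the arguments of `H₁` differ from those of the challenge, there is a
collision (`crAdv_ge`). Otherwise `C₁` is that of the challenge and the auxiliary input is empty,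
and a valid query, called a hit, has `C₂ = F(S, ω*)^t` by nondegeneracy (`hit_real`). As the
challenge header is excluded, `S ≠ S*`, so some user lies in exactly one of the two sets
(`game_ev`); before the challenge any member of `S` serves instead. The third algorithm guesses such
a user `j` and the bit `b` saying whether `j ∈ S*`, and embeds `g^a` of a new BDHE challenge by `γ_j
= γ'_j + a` and, if `b` holds, `β = β' - a`. Then `a` cancels in `F(S*, ω*)` but not in `F(S, ω*)`,
so a hit yields `g^(±a t)` (`game_rec₂`), whose pairing with `ĝ^(a^(L+1))` decides the challenge
(`finGuess_eq`). Here `α` is the algorithm's own choice, so decryption is immediate. The index is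
guessed with probability at least `1/(2L)`, the bit with `1/2`, and a random `Z` passes the test
with probability `1/p ≤ 1/2`; this gives the factor `8 L`.

The algorithms are actual programs. Functions on data are written as expressions `Fn` that compile
with a polynomial time bound (`Fn.run_compile`), and `reduction` replaces the queries of the
adversary by such a subroutine. One handler serves the real challenger and both simulations; these
differ only in the table `Tab` (`handlerV_eq`). Games are compared through couplings, which treat
output and running time together and give the argument up to a failure event (`run_until`). -/

noncomputable section
namespace DBE

/-! ## Couplings and probabilities -/

/-- `p` and `q` have a coupling that is concentrated on `R`. -/
def Coupled {α β : Type} (R : α → β → Prop) (p : PMF α) (q : PMF β) : Prop :=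
  ∃ c : PMF (α × β), c.map Prod.fst = p ∧ c.map Prod.snd = q ∧ ∀ x ∈ c.support, R x.1 x.2

namespace Coupled

variable {α β γ δ : Type} {R : α → β → Prop} {p : PMF α} {q : PMF β}

theorem pure {a : α} {b : β} (h : R a b) : Coupled R (PMF.pure a) (PMF.pure b) := by
  refine ⟨PMF.pure (a, b), by simp [PMF.pure_map], by simp [PMF.pure_map], ?_⟩
  intro x hx
  rw [PMF.mem_support_pure_iff] at hx
  subst hx
  exact h

theorem mono {S : α → β → Prop} (h : Coupled R p q) (hRS : ∀ a b, R a b → S a b) :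
    Coupled S p q := by
  obtain ⟨c, h₁, h₂, h₃⟩ := h
  exact ⟨c, h₁, h₂, fun x hx => hRS _ _ (h₃ x hx)⟩

/-- The independent coupling. It serves where nothing but the supports matters, in particular after
a failure event. -/
theorem prod (p : PMF α) (q : PMF β) :
    Coupled (fun a b => a ∈ p.support ∧ b ∈ q.support) p q := by
  refine ⟨p.bind fun a => q.map fun b => (a, b), ?_, ?_, ?_⟩
  · simp only [PMF.map_bind, PMF.map_comp]
    have : ∀ a : α, (Prod.fst ∘ fun b : β => (a, b)) = Function.const β a := fun a => rfl
    simp [this]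
  · simp only [PMF.map_bind, PMF.map_comp]
    have : ∀ a : α, (Prod.snd ∘ fun b : β => (a, b)) = id := fun a => rfl
    simp [this, PMF.map_id]
  · rintro ⟨a, b⟩ hx
    simp only [PMF.mem_support_bind_iff, PMF.mem_support_map_iff, Prod.mk.injEq] at hx
    obtain ⟨a', ha, b', hb, rfl, rfl⟩ := hx
    exact ⟨ha, hb⟩

theorem bind {S : γ → δ → Prop} {f : α → PMF γ} {g : β → PMF δ} (h : Coupled R p q)
    (hfg : ∀ a b, R a b → Coupled S (f a) (g b)) : Coupled S (p.bind f) (q.bind g) := by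
  classical
  obtain ⟨c, rfl, rfl, h₃⟩ := h
  have key : ∀ x : α × β, ∃ d : PMF (γ × δ), d.map Prod.fst = f x.1 ∧ d.map Prod.snd = g x.2 ∧
      (R x.1 x.2 → ∀ y ∈ d.support, S y.1 y.2) := by
    intro x
    by_cases hx : R x.1 x.2
    · obtain ⟨d, e₁, e₂, e₃⟩ := hfg _ _ hx
      exact ⟨d, e₁, e₂, fun _ => e₃⟩
    -- Pairs outside `R` have mass zero under `c`; any coupling with the right marginals makes `d`
    -- total.
    · obtain ⟨d, e₁, e₂, -⟩ := Coupled.prod (f x.1) (g x.2)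
      exact ⟨d, e₁, e₂, fun h => absurd h hx⟩
  choose d e₁ e₂ e₃ using key
  refine ⟨c.bind d, ?_, ?_, ?_⟩
  · simp only [PMF.map_bind, e₁, PMF.bind_map]; rfl
  · simp only [PMF.map_bind, e₂, PMF.bind_map]; rfl
  · intro y hy
    rw [PMF.mem_support_bind_iff] at hy
    obtain ⟨x, hx, hy⟩ := hy
    exact e₃ x (h₃ x hx) y hy

theorem map {S : γ → δ → Prop} {f : α → γ} {g : β → δ} (h : Coupled R p q)
    (hfg : ∀ a b, R a b → S (f a) (g b)) : Coupled S (p.map f) (q.map g) :=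
  h.bind fun a b hab => Coupled.pure (hfg a b hab)

theorem map_left {S : γ → β → Prop} {f : α → γ} (h : Coupled R p q)
    (hfg : ∀ a b, R a b → S (f a) b) : Coupled S (p.map f) q := by
  have := h.map (S := S) (f := f) (g := id) hfg
  rwa [PMF.map_id] at this

theorem refl (p : PMF α) : Coupled (fun a b => a = b ∧ a ∈ p.support) p p := by
  refine ⟨p.map fun a => (a, a), ?_, ?_, ?_⟩
  · rw [PMF.map_comp]; exact PMF.map_id p
  · rw [PMF.map_comp]; exact PMF.map_id p
  · intro x hx
    rw [PMF.mem_support_map_iff] at hx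
    obtain ⟨a, ha, rfl⟩ := hx
    exact ⟨rfl, ha⟩

theorem map_eq_map {f : α → γ} {g : β → γ} (h : Coupled R p q)
    (hfg : ∀ a b, R a b → f a = g b) : p.map f = q.map g := by
  obtain ⟨c, rfl, rfl, h₃⟩ := h
  rw [PMF.map_comp, PMF.map_comp]
  simp only [← PMF.bind_pure_comp]
  ext y
  rw [PMF.bind_apply, PMF.bind_apply]
  refine tsum_congr fun x => ?_
  by_cases hx : x ∈ c.support
  · simp [hfg _ _ (h₃ x hx)]
  · simp [(PMF.apply_eq_zero_iff c x).mpr hx]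

theorem exists_right (h : Coupled R p q) {a : α} (ha : a ∈ p.support) :
    ∃ b ∈ q.support, R a b := by
  obtain ⟨c, rfl, rfl, h₃⟩ := h
  rw [PMF.mem_support_map_iff] at ha
  obtain ⟨x, hx, rfl⟩ := ha
  exact ⟨x.2, (PMF.mem_support_map_iff _ _ _).mpr ⟨x, hx, rfl⟩, h₃ x hx⟩

end Coupled

open scoped ENNReal

/-- Probability of an event. -/
def pr {α : Type} (p : PMF α) (A : α → Prop) : ℝ≥0∞ := p.toOuterMeasure {a | A a}

section pr

variable {α β : Type} (p : PMF α)

theorem pr_pure (a : α) (A : α → Prop) [Decidable (A a)] :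
    pr (PMF.pure a) A = if A a then 1 else 0 := by
  rw [pr, PMF.toOuterMeasure_pure_apply]
  split_ifs <;> simp_all

theorem pr_bind (f : α → PMF β) (A : β → Prop) :
    pr (p.bind f) A = ∑' a, p a * pr (f a) A := PMF.toOuterMeasure_bind_apply _ _ _

theorem pr_map (f : α → β) (A : β → Prop) : pr (p.map f) A = pr p (fun a => A (f a)) := by
  rw [pr, PMF.toOuterMeasure_map_apply]; rfl

theorem pr_singleton (a : α) : pr p (fun x => x = a) = p a := p.toOuterMeasure_apply_singleton a

theorem pr_mono {A B : α → Prop} (h : ∀ a ∈ p.support, A a → B a) : pr p A ≤ pr p B :=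
  PMF.toOuterMeasure_mono p fun a ha => h a ha.2 ha.1

theorem pr_congr {A B : α → Prop} (h : ∀ a ∈ p.support, (A a ↔ B a)) : pr p A = pr p B :=
  le_antisymm (pr_mono p fun a ha => (h a ha).1) (pr_mono p fun a ha => (h a ha).2)

theorem pr_or_le (A B : α → Prop) : pr p (fun a => A a ∨ B a) ≤ pr p A + pr p B :=
  MeasureTheory.measure_union_le {a | A a} {a | B a}

theorem pr_le_one (A : α → Prop) : pr p A ≤ 1 := by
  refine (pr_mono p (B := fun _ => True) fun _ _ _ => trivial).trans ?_
  have : pr p (fun _ => True) = 1 :=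
    (PMF.toOuterMeasure_apply_eq_one_iff p {a : α | True}).mpr fun _ _ => trivial
  rw [this]

theorem pr_ne_top (A : α → Prop) : pr p A ≠ ∞ := ((pr_le_one p A).trans_lt ENNReal.one_lt_top).ne

theorem pr_bind_mono {f : α → PMF β} {γ : Type} {g : α → PMF γ} {A : β → Prop} {B : γ → Prop}
    (h : ∀ a ∈ p.support, pr (f a) A ≤ pr (g a) B) : pr (p.bind f) A ≤ pr (p.bind g) B := by
  rw [pr_bind, pr_bind]
  refine ENNReal.tsum_le_tsum fun a => ?_
  by_cases ha : a ∈ p.support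
  · gcongr; exact h a ha
  · simp [(PMF.apply_eq_zero_iff p a).mpr ha]

theorem pr_bind_le_add {f : α → PMF β} {γ δ : Type} {g : α → PMF γ} {k : α → PMF δ}
    {A : β → Prop} {B : γ → Prop} {C : δ → Prop}
    (h : ∀ a ∈ p.support, pr (f a) A ≤ pr (g a) B + pr (k a) C) :
    pr (p.bind f) A ≤ pr (p.bind g) B + pr (p.bind k) C := by
  rw [pr_bind, pr_bind, pr_bind, ← ENNReal.tsum_add]
  refine ENNReal.tsum_le_tsum fun a => ?_
  rw [← mul_add]
  by_cases ha : a ∈ p.support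
  · gcongr; exact h a ha
  · simp [(PMF.apply_eq_zero_iff p a).mpr ha]

theorem mul_pr_bind_mono {f : α → PMF β} {γ : Type} {g : α → PMF γ} {A : β → Prop}
    {B : γ → Prop} (c : ℝ≥0∞) (h : ∀ a ∈ p.support, c * pr (f a) A ≤ pr (g a) B) :
    c * pr (p.bind f) A ≤ pr (p.bind g) B := by
  rw [pr_bind, pr_bind, ← ENNReal.tsum_mul_left]
  refine ENNReal.tsum_le_tsum fun a => ?_
  rw [mul_left_comm]
  by_cases ha : a ∈ p.support
  · gcongr; exact h a ha
  · simp [(PMF.apply_eq_zero_iff p a).mpr ha]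

theorem bind_congr_support {f g : α → PMF β} (h : ∀ a ∈ p.support, f a = g a) :
    p.bind f = p.bind g := by
  ext b
  rw [PMF.bind_apply, PMF.bind_apply]
  refine tsum_congr fun a => ?_
  by_cases ha : a ∈ p.support
  · rw [h a ha]
  · simp [(PMF.apply_eq_zero_iff p a).mpr ha]

theorem Coupled.pr_le {R : α → β → Prop} {p : PMF α} {q : PMF β} (h : Coupled R p q)
    {A : α → Prop} {B : β → Prop} (hAB : ∀ a b, R a b → A a → B b) : pr p A ≤ pr q B := by
  obtain ⟨c, rfl, rfl, h₃⟩ := h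
  rw [pr_map, pr_map]
  exact pr_mono _ fun x hx => hAB _ _ (h₃ x hx)

end pr

theorem Coupled.iterate {α β : Type} {R : ℕ → α → β → Prop} {f : α → PMF α} {g : β → PMF β}
    (hfg : ∀ i a b, R i a b → Coupled (R (i + 1)) (f a) (g b)) :
    ∀ k i a b, R i a b → Coupled (R (i + k)) (DBE.iterate f k a) (DBE.iterate g k b)
  | 0, _, _, _, h => Coupled.pure h
  | k + 1, i, a, b, h => by
      have := (hfg i a b h).bind (f := DBE.iterate f k) (g := DBE.iterate g k)
        (fun a' b' h' => Coupled.iterate hfg k (i + 1) a' b' h')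
      rwa [show i + 1 + k = i + (k + 1) by ring] at this

end DBE
end

noncomputable section
namespace DBE

/-! ## A point-free language for polynomial-time functions -/

/-- Expressions for randomized functions on data with loops of length `L`. -/
inductive Fn : Type
  | id : Fn
  | comp : Fn → Fn → Fn
  | nil : Fn
  | hd : Fn
  | tl : Fn
  | pair : Fn → Fn → Fn
  | eq : Fn
  | flip : Fn
  | call : Prim → ℕ → Fn
  | secParam : Fn
  | users : Fn
  | ite : Fn → Fn → Fn → Fn
  | iter : Fn → Fn

/-- The first `k` entries of a list. -/
def Val.args (v : Val) (k : ℕ) : List Val := (List.range k).map fun i => (Val.tl^[i] v).hd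

open Classical in
def Fn.den (P : PairingSystem) (n L : ℕ) : Fn → Val → PMF Val
  | .id, v => PMF.pure v
  | .comp f g, v => (g.den P n L v).bind (f.den P n L)
  | .nil, _ => PMF.pure Val.nil
  | .hd, v => PMF.pure v.hd
  | .tl, v => PMF.pure v.tl
  | .pair f g, v => (f.den P n L v).bind fun a => (g.den P n L v).bind fun b =>
      PMF.pure (Val.node a b)
  | .eq, v => PMF.pure (Val.ofBool (decide (v.hd = v.tl)))
  | .flip, _ => (PMF.uniformOfFintype Bool).map Val.ofBool
  | .call f k, v => f.eval P (v.args k)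
  | .secParam, _ => PMF.pure (Val.ofNat n)
  | .users, _ => PMF.pure (Val.ofNat L)
  | .ite c f g, v => (c.den P n L v).bind fun a =>
      if a.toBool = true then f.den P n L v else g.den P n L v
  | .iter f, v => iterate (f.den P n L) L v

/-- Moves the first `k` entries of the list in register `b` to the registers after `b`. -/
def loadArgs (b : ℕ) : ℕ → Prog
  | 0 => .skip
  | k + 1 => .seq (loadArgs b k) (.seq (.hd (b + 1 + k) b) (.tl b b))

/-- A program that evaluates the expression on the contents of register `b`; the registers
`c` and `c + 1` hold `1^n` and `1^L`. -/
def Fn.compile (c : ℕ) : Fn → ℕ → Prog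
  | .id, _ => .skip
  | .comp f g, b => .seq (g.compile c b) (f.compile c b)
  | .nil, b => .clear b
  | .hd, b => .hd b b
  | .tl, b => .tl b b
  | .pair f g, b => .seq (.copy (b + 1) b) (.seq (f.compile c (b + 1))
      (.seq (.copy (b + 2) b) (.seq (g.compile c (b + 2)) (.cons b (b + 1) (b + 2)))))
  | .eq, b => .seq (.hd (b + 1) b) (.seq (.tl (b + 2) b) (.eq b (b + 1) (b + 2)))
  | .flip, b => .flip b
  | .call f k, b => .seq (loadArgs b k) (.call b f ((List.range k).map fun i => b + 1 + i))
  | .secParam, b => .copy b c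
  | .users, b => .copy b (c + 1)
  | .ite t f g, b => .seq (.copy (b + 1) b) (.seq (t.compile c (b + 1))
      (.ite (b + 1) (f.compile c b) (g.compile c b)))
  | .iter f, b => .loop (c + 1) (f.compile c b)

/-- A bound for the number of steps of the compiled expression. -/
def Fn.cost : Fn → Polynomial ℕ
  | .id | .nil | .hd | .tl | .flip | .secParam | .users => 1
  | .eq => 3
  | .call _ k => Polynomial.C (2 * k + 2)
  | .comp f g => f.cost + g.cost
  | .pair f g => f.cost + g.cost + 3
  | .ite t f g => t.cost + f.cost + g.cost + 2
  | .iter f => Polynomial.X * f.cost + 1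

section Correctness

variable {P : PairingSystem} {σ : Type} {h : σ → Val → PMF (Val × σ)}

/-- `s'` arises from `s` in at most `t` steps by writing `v` to the register `b` and arbitrary
data to later registers. -/
structure Config.Wrote (s : Config σ) (b t : ℕ) (s' : Config σ) (v : Val) : Prop where
  out : s'.mem b = v
  below : ∀ r, r < b → s'.mem r = s.mem r
  env : s'.env = s.env
  time : s'.time ≤ s.time + t

theorem run_loadArgs (b k : ℕ) (s : Config σ) :
    ∃ s', Prog.run P h (loadArgs b k) s = PMF.pure s' ∧
      Config.Wrote s b (2 * k + 1) s' (Val.tl^[k] (s.mem b)) ∧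
      ∀ i < k, s'.mem (b + 1 + i) = (Val.tl^[i] (s.mem b)).hd := by
  induction k with
  | zero => exact ⟨s.tick, rfl, ⟨rfl, fun _ _ => rfl, rfl, le_refl _⟩, by simp⟩
  | succ k ih =>
    obtain ⟨s', e, w, a⟩ := ih
    refine ⟨(s'.set (b + 1 + k) (s'.mem b).hd).set b ((s'.set (b + 1 + k) (s'.mem b).hd).mem b).tl,
      ?_, ⟨?_, ?_, ?_, ?_⟩, ?_⟩
    · simp [loadArgs, Prog.run, e]
    · have : b ≠ b + 1 + k := by omega
      simp [Config.set, w.out, Function.iterate_succ_apply', Function.update_of_ne this]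
    · intro r hr
      have h₁ : r ≠ b + 1 + k := by omega
      have h₂ : r ≠ b := by omega
      simp [Config.set, h₁, h₂, w.below r hr]
    · simpa [Config.set] using w.env
    · have := w.time
      simp [Config.set]
      omega
    · intro i hi
      have h₂ : b + 1 + i ≠ b := by omega
      rcases Nat.lt_succ_iff_lt_or_eq.mp hi with hi | rfl
      · simp [Config.set, Function.update_apply, h₂, hi.ne, a i hi]
      · simp [Config.set, h₂, w.out]

theorem Config.Wrote.trans {s s₁ s₂ : Config σ} {b t₁ t₂ : ℕ} {v₁ v₂ : Val}
    (h₁ : Config.Wrote s b t₁ s₁ v₁) (h₂ : Config.Wrote s₁ b t₂ s₂ v₂) :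
    Config.Wrote s b (t₁ + t₂) s₂ v₂ :=
  ⟨h₂.out, fun r hr => (h₂.below r hr).trans (h₁.below r hr), h₂.env.trans h₁.env, by
    have := h₁.time; have := h₂.time; omega⟩

theorem Config.Wrote.mono {s s' : Config σ} {b t t' : ℕ} {v : Val}
    (h : Config.Wrote s b t s' v) (ht : t ≤ t') : Config.Wrote s b t' s' v :=
  ⟨h.out, h.below, h.env, by have := h.time; omega⟩

theorem Config.Wrote.set (s : Config σ) (b : ℕ) (v : Val) : Config.Wrote s b 1 (s.set b v) v :=
  ⟨by simp [Config.set], fun r hr => by simp [Config.set, hr.ne], rfl, le_refl _⟩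

/-- All writes go to `b` and to later registers, while the constants sit in `c` and `c + 1` before
`b`; hence nested compilations do not disturb each other. A coupling is used because the final
configuration is not determined by the value: scratch registers are arbitrary and the time is only
bounded. -/
theorem Fn.run_compile (n L c : ℕ) (f : Fn) : ∀ (b : ℕ) (s : Config σ), c + 1 < b →
    s.mem c = Val.ofNat n → s.mem (c + 1) = Val.ofNat L →
    Coupled (Config.Wrote s b (f.cost.eval L)) (Prog.run P h (f.compile c b) s)
      (f.den P n L (s.mem b)) := by
  induction f with
  | id =>
    intro b s hb hn hL
    exact Coupled.pure ⟨rfl, fun _ _ => rfl, rfl, by simp [Fn.cost, Config.tick]⟩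
  | nil =>
    intro b s hb hn hL
    exact Coupled.pure ((Config.Wrote.set s b _).mono (by simp [Fn.cost]))
  | hd =>
    intro b s hb hn hL
    exact Coupled.pure ((Config.Wrote.set s b _).mono (by simp [Fn.cost]))
  | tl =>
    intro b s hb hn hL
    exact Coupled.pure ((Config.Wrote.set s b _).mono (by simp [Fn.cost]))
  | secParam =>
    intro b s hb hn hL
    rw [Fn.den, ← hn]
    exact Coupled.pure ((Config.Wrote.set s b _).mono (by simp [Fn.cost]))
  | users =>
    intro b s hb hn hL
    rw [Fn.den, ← hL]
    exact Coupled.pure ((Config.Wrote.set s b _).mono (by simp [Fn.cost]))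
  | flip =>
    intro b s hb hn hL
    refine (Coupled.refl _).map ?_
    rintro x _ ⟨rfl, -⟩
    simpa [Fn.cost] using Config.Wrote.set s b _
  | eq =>
    intro b s hb hn hL
    simp only [Fn.compile, Prog.run, PMF.pure_bind, Fn.den]
    apply Coupled.pure
    have h₁ : b ≠ b + 1 := by omega
    have h₂ : b ≠ b + 2 := by omega
    have e₁ : ((s.set (b + 1) (s.mem b).hd).set (b + 2) (s.mem b).tl).mem (b + 1) = (s.mem b).hd := by
      simp [Config.set]
    have e₂ : ((s.set (b + 1) (s.mem b).hd).set (b + 2) (s.mem b).tl).mem (b + 2) = (s.mem b).tl := by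
      simp [Config.set]
    have e₃ : (s.set (b + 1) (s.mem b).hd).mem b = s.mem b := by
      simp [Config.set]
    rw [e₃, e₁, e₂]
    refine ⟨by simp [Config.set], fun r hr => ?_, rfl, by
      simp [Config.set, Fn.cost, add_assoc]⟩
    have h₃ : r ≠ b + 1 := by omega
    have h₄ : r ≠ b + 2 := by omega
    have h₅ : r ≠ b := by omega
    simp [Config.set, h₃, h₄, h₅]
  | call f k =>
    intro b s hb hn hL
    obtain ⟨s', e, w, a⟩ := run_loadArgs (P := P) (h := h) b k s
    simp only [Fn.compile, Prog.run, e, PMF.pure_bind, Fn.den]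
    have : ((List.range k).map fun i => b + 1 + i).map s'.mem = (s.mem b).args k := by
      rw [List.map_map, Val.args]
      exact List.map_congr_left fun i hi => a i (List.mem_range.mp hi)
    rw [this]
    refine (Coupled.refl _).map_left ?_
    rintro x _ ⟨rfl, -⟩
    exact (w.trans (Config.Wrote.set s' b _)).mono (by simp [Fn.cost])
  | comp f g ihf ihg =>
    intro b s hb hn hL
    refine (ihg b s hb hn hL).bind ?_
    intro s₁ v₁ w₁
    have := ihf b s₁ hb (by rw [w₁.below _ (by omega), hn]) (by rw [w₁.below _ (by omega), hL])
    rw [w₁.out] at this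
    exact this.mono fun _ _ w₂ => (w₁.trans w₂).mono (by simp [Fn.cost, add_comm])
  | pair f g ihf ihg =>
    intro b s hb hn hL
    simp only [Fn.compile, Prog.run, PMF.pure_bind, Fn.den]
    have w₀ := Config.Wrote.set s (b + 1) (s.mem b)
    have H := ihf (b + 1) (s.set (b + 1) (s.mem b)) (by omega)
      (by rw [w₀.below _ (by omega), hn]) (by rw [w₀.below _ (by omega), hL])
    rw [w₀.out] at H
    refine H.bind ?_
    intro s₁ v₁ w₁
    have w₁ := w₀.trans w₁
    have hb₁ := w₁.below b (by omega)
    have w₂ := Config.Wrote.set s₁ (b + 2) (s₁.mem b)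
    have H := ihg (b + 2) (s₁.set (b + 2) (s₁.mem b)) (by omega)
      (by rw [w₂.below _ (by omega), w₁.below _ (by omega), hn])
      (by rw [w₂.below _ (by omega), w₁.below _ (by omega), hL])
    rw [w₂.out] at H
    rw [hb₁] at H ⊢
    refine H.bind ?_
    intro s₃ v₃ w₃
    rw [hb₁] at w₂
    have w₃ := w₂.trans w₃
    rw [w₃.out, w₃.below (b + 1) (by omega), w₁.out]
    apply Coupled.pure
    refine ⟨by simp [Config.set], fun r hr => ?_, w₃.env.trans w₁.env, ?_⟩
    · rw [(Config.Wrote.set s₃ b _).below r hr, w₃.below r (by omega), w₁.below r (by omega)]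
    · have := w₃.time
      have := w₁.time
      simp only [Config.set, Fn.cost, Polynomial.eval_add, Polynomial.eval_ofNat]
      omega
  | ite t f g iht ihf ihg =>
    intro b s hb hn hL
    simp only [Fn.compile, Prog.run, PMF.pure_bind, Fn.den]
    have w₀ := Config.Wrote.set s (b + 1) (s.mem b)
    have H := iht (b + 1) (s.set (b + 1) (s.mem b)) (by omega)
      (by rw [w₀.below _ (by omega), hn]) (by rw [w₀.below _ (by omega), hL])
    rw [w₀.out] at H
    refine H.bind ?_
    intro s₁ v₁ w₁
    have w₁ := w₀.trans w₁
    rw [w₁.out]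
    have w₂ : Config.Wrote s b (t.cost.eval L + 2) s₁.tick (s.mem b) :=
      ⟨w₁.below b (by omega), fun r hr => w₁.below r (by omega), w₁.env, by
        have := w₁.time
        simp only [Config.tick]
        omega⟩
    split_ifs
    · have := ihf b s₁.tick hb (by rw [w₂.below _ (by omega), hn])
        (by rw [w₂.below _ (by omega), hL])
      rw [w₂.out] at this
      exact this.mono fun _ _ w₃ => (w₂.trans w₃).mono (by simp [Fn.cost]; omega)
    · have := ihg b s₁.tick hb (by rw [w₂.below _ (by omega), hn])
        (by rw [w₂.below _ (by omega), hL])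
      rw [w₂.out] at this
      exact this.mono fun _ _ w₃ => (w₂.trans w₃).mono (by simp [Fn.cost]; omega)
  | iter f ih =>
    intro b s hb hn hL
    simp only [Fn.compile, Prog.run, Fn.den]
    have hlen : (s.mem (c + 1)).len = L := by
      rw [hL, Val.len, Val.ofNat]
      have : ∀ l : List Val, (Val.ofList l).toList = l := by
        intro l
        induction l with
        | nil => rfl
        | cons a l ih => simp [Val.ofList, Val.toList, ih]
      simp [this]
    rw [hlen]
    -- The relation depends on the number of rounds made, so that the time bound can grow with it.
    have := Coupled.iterate (f := Prog.run P h (f.compile c b)) (g := f.den P n L)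
      (R := fun i => Config.Wrote s b (i * f.cost.eval L + 1)) (fun i s₁ v w => by
        have := ih b s₁ hb (by rw [w.below _ (by omega), hn]) (by rw [w.below _ (by omega), hL])
        rw [w.out] at this
        exact this.mono fun _ _ w₃ => (w.trans w₃).mono (by ring_nf; omega))
      L 0 s.tick (s.mem b) ⟨rfl, fun _ _ => rfl, rfl, by simp [Config.tick]⟩
    exact this.mono fun _ _ w₃ => w₃.mono (by simp [Fn.cost])

end Correctness

end DBE
end

noncomputable section
namespace DBE

/-! ## Reductions that run an adversary -/

/-- All registers of the program are smaller than `N`. -/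
def Prog.Below (N : ℕ) : Prog → Prop
  | .skip => True
  | .seq a b => a.Below N ∧ b.Below N
  | .clear x => x < N
  | .copy x y => x < N ∧ y < N
  | .cons x y z => x < N ∧ y < N ∧ z < N
  | .hd x y => x < N ∧ y < N
  | .tl x y => x < N ∧ y < N
  | .eq x y z => x < N ∧ y < N ∧ z < N
  | .flip x => x < N
  | .call x _ ys => x < N ∧ ∀ y ∈ ys, y < N
  | .query x y => x < N ∧ y < N
  | .ite x a b => x < N ∧ a.Below N ∧ b.Below N
  | .loop x a => x < N ∧ a.Below N

theorem Prog.Below.mono {N M : ℕ} (h : N ≤ M) (c : Prog) : c.Below N → c.Below M := by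
  induction c <;> simp only [Prog.Below] <;> grind

theorem Prog.exists_below (c : Prog) : ∃ N, 3 ≤ N ∧ c.Below N := by
  suffices h : ∃ N, c.Below N by
    obtain ⟨N, h⟩ := h
    exact ⟨max 3 N, le_max_left _ _, h.mono (le_max_right _ _)⟩
  induction c with
  | skip => exact ⟨0, trivial⟩
  | seq a b iha ihb =>
    obtain ⟨N, hN⟩ := iha
    obtain ⟨M, hM⟩ := ihb
    exact ⟨max N M, hN.mono (le_max_left _ _), hM.mono (le_max_right _ _)⟩
  | clear x => exact ⟨x + 1, by simp [Prog.Below]⟩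
  | copy x y => exact ⟨x + y + 1, by simp only [Prog.Below]; omega⟩
  | cons x y z => exact ⟨x + y + z + 1, by simp only [Prog.Below]; omega⟩
  | hd x y => exact ⟨x + y + 1, by simp only [Prog.Below]; omega⟩
  | tl x y => exact ⟨x + y + 1, by simp only [Prog.Below]; omega⟩
  | eq x y z => exact ⟨x + y + z + 1, by simp only [Prog.Below]; omega⟩
  | flip x => exact ⟨x + 1, by simp [Prog.Below]⟩
  | call x f ys =>
    refine ⟨x + ys.sum + 1, by omega, fun y hy => ?_⟩
    have := List.single_le_sum (fun _ _ => Nat.zero_le _) y hy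
    omega
  | query x y => exact ⟨x + y + 1, by simp only [Prog.Below]; omega⟩
  | ite x a b iha ihb =>
    obtain ⟨N, hN⟩ := iha
    obtain ⟨M, hM⟩ := ihb
    exact ⟨x + N + M + 1, by omega, hN.mono (by omega), hM.mono (by omega)⟩
  | loop x a ih =>
    obtain ⟨N, hN⟩ := ih
    exact ⟨x + N + 1, by omega, hN.mono (by omega)⟩

/-- A number that exceeds `2` and all registers of the program. -/
def Prog.bound (c : Prog) : ℕ := c.exists_below.choose

theorem Prog.three_le_bound (c : Prog) : 3 ≤ c.bound := c.exists_below.choose_spec.1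

theorem Prog.below_bound (c : Prog) : c.Below c.bound := c.exists_below.choose_spec.2

/-- Replaces queries by calls of the subroutine `H`, which takes a message and a state in
register `N + 2` and leaves there the answer and the next state. -/
def Prog.subst (N : ℕ) (H : Prog) : Prog → Prog
  | .seq a b => .seq (Prog.subst N H a) (Prog.subst N H b)
  | .query x y => .seq (.cons (N + 2) y (N + 2)) (.seq H (.seq (.hd x (N + 2))
      (.tl (N + 2) (N + 2))))
  | .ite x a b => .ite x (Prog.subst N H a) (Prog.subst N H b)
  | .loop x a => .loop x (Prog.subst N H a)
  | c => c

/-- The environment whose state is data and whose answers are computed by `H`. -/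
def Fn.handler (P : PairingSystem) (n L : ℕ) (H : Fn) (st msg : Val) : PMF (Val × Val) :=
  (H.den P n L (Val.node msg st)).map fun r => (r.hd, r.tl)

/-- The algorithm that computes a state from its input by `I`, runs `A`, answers the queries of
`A` by `H`, and applies `F` to the output of `A` and the last state. -/
def reduction (A : Prog) (I H F : Fn) : Prog :=
  .seq (.copy A.bound 0) (.seq (.copy (A.bound + 1) 1) (.seq (.copy (A.bound + 2) 2)
    (.seq (.clear 2) (.seq (I.compile A.bound (A.bound + 2))
      (.seq (Prog.subst A.bound (H.compile A.bound (A.bound + 2)) A)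
        (.seq (.cons (A.bound + 2) 0 (A.bound + 2)) (.seq (F.compile A.bound (A.bound + 2))
          (.copy 0 (A.bound + 2)))))))))

section Correctness

variable {P : PairingSystem} {σ : Type} {h : σ → Val → PMF (Val × σ)}

/-- `s'` is a configuration of a reduction that corresponds to the configuration `s` of the
adversary. -/
structure Config.Simulates (N n L K T : ℕ) (s' : Config σ) (s : Config Val) : Prop where
  mem : ∀ r, r < N → s'.mem r = s.mem r
  secParam : s'.mem N = Val.ofNat n
  users : s'.mem (N + 1) = Val.ofNat L
  state : s'.mem (N + 2) = s.env
  time : s'.time ≤ K * s.time + T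

theorem Config.Simulates.set {N n L K T : ℕ} {s' : Config σ} {s : Config Val}
    (w : Config.Simulates N n L K T s' s) (hK : 1 ≤ K) {x : ℕ} (hx : x < N) {v v' : Val}
    (hv : v' = v) : Config.Simulates N n L K T (s'.set x v') (s.set x v) := by
  subst hv
  refine ⟨fun r hr => ?_, ?_, ?_, ?_, ?_⟩
  · simp [Config.set, Function.update_apply, w.mem r hr]
  · simp [Config.set, w.secParam, hx.ne']
  · simp [Config.set, w.users, (hx.trans (Nat.lt_succ_self N)).ne']
  · simp [Config.set, w.state, show N + 2 ≠ x by omega]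
  · have := w.time
    simp only [Config.set, mul_add]
    omega

theorem Config.Simulates.tick {N n L K T : ℕ} {s' : Config σ} {s : Config Val}
    (w : Config.Simulates N n L K T s' s) (hK : 1 ≤ K) :
    Config.Simulates N n L K T s'.tick s.tick := by
  refine ⟨w.mem, w.secParam, w.users, w.state, ?_⟩
  have := w.time
  simp only [Config.tick, mul_add]
  omega

/-- The factor `K` pays for a query: one `cons`, the cost of `H`, and two projections replace a
single step. All other steps of the adversary are copied at cost one. -/
theorem Prog.run_subst (N n L K T : ℕ) (H : Fn) (hK : K = H.cost.eval L + 3) (A : Prog) :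
    A.Below N → ∀ (s' : Config σ) (s : Config Val), Config.Simulates N n L K T s' s →
      Coupled (Config.Simulates N n L K T)
        (Prog.run P h (Prog.subst N (H.compile N (N + 2)) A) s')
        (Prog.run P (H.handler P n L) A s) := by
  have hK' : 1 ≤ K := by omega
  induction A with
  | skip => intro _ s' s w; exact Coupled.pure (w.tick hK')
  | seq a b iha ihb =>
    intro hN s' s w
    exact (iha hN.1 s' s w).bind fun s₁' s₁ w₁ => ihb hN.2 s₁' s₁ w₁
  | clear x => intro hN s' s w; exact Coupled.pure (w.set hK' hN rfl)
  | copy x y => intro hN s' s w; exact Coupled.pure (w.set hK' hN.1 (w.mem y hN.2))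
  | cons x y z =>
    intro hN s' s w
    exact Coupled.pure (w.set hK' hN.1 (by rw [w.mem y hN.2.1, w.mem z hN.2.2]))
  | hd x y => intro hN s' s w; exact Coupled.pure (w.set hK' hN.1 (by rw [w.mem y hN.2]))
  | tl x y => intro hN s' s w; exact Coupled.pure (w.set hK' hN.1 (by rw [w.mem y hN.2]))
  | eq x y z =>
    intro hN s' s w
    exact Coupled.pure (w.set hK' hN.1 (by rw [w.mem y hN.2.1, w.mem z hN.2.2]))
  | flip x =>
    intro hN s' s w
    refine (Coupled.refl _).map ?_
    rintro b _ ⟨rfl, -⟩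
    exact w.set hK' hN rfl
  | call x f ys =>
    intro hN s' s w
    have : ys.map s'.mem = ys.map s.mem := List.map_congr_left fun y hy => w.mem y (hN.2 y hy)
    simp only [Prog.subst, Prog.run, this]
    refine (Coupled.refl _).map ?_
    rintro b _ ⟨rfl, -⟩
    exact w.set hK' hN.1 rfl
  | query x y =>
    intro hN s' s w
    simp only [Prog.subst, Prog.run, PMF.pure_bind, Fn.handler, PMF.map_comp]
    have w₁ := Config.Wrote.set s' (N + 2) (Val.node (s'.mem y) (s'.mem (N + 2)))
    have := Fn.run_compile (P := P) (h := h) n L N H (N + 2) _ (by omega)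
      (by rw [w₁.below _ (by omega), w.secParam]) (by rw [w₁.below _ (by omega), w.users])
    rw [w₁.out, w.mem y hN.2, w.state] at this
    rw [w.mem y hN.2, w.state] at w₁ ⊢
    refine this.map ?_
    intro s₁ v w₂
    have w₂ := w₁.trans w₂
    have hx : x < N := hN.1
    refine ⟨fun r hr => ?_, ?_, ?_, ?_, ?_⟩
    · have h₁ : r ≠ N + 2 := by omega
      simp [Config.set, Function.update_apply, h₁, w₂.out, w₂.below r (by omega), w.mem r hr]
    · have h₁ : N ≠ x := by omega
      simp [Config.set, Function.update_apply, h₁, w₂.below N (by omega), w.secParam]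
    · have h₁ : N + 1 ≠ x := by omega
      simp [Config.set, Function.update_apply, h₁, w₂.below (N + 1) (by omega), w.users]
    · have h₁ : N + 2 ≠ x := by omega
      simp [Config.set, h₁, w₂.out]
    · have h₁ := w₂.time
      have h₂ := w.time
      simp only [Config.set, mul_add, Function.comp_apply]
      omega
  | ite x a b iha ihb =>
    intro hN s' s w
    simp only [Prog.subst, Prog.run, w.mem x hN.1]
    split_ifs
    · exact iha hN.2.1 _ _ (w.tick hK')
    · exact ihb hN.2.2 _ _ (w.tick hK')
  | loop x a ih =>
    intro hN s' s w
    simp only [Prog.subst, Prog.run, w.mem x hN.1]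
    exact Coupled.iterate (R := fun _ => Config.Simulates N n L K T)
      (fun _ s₁' s₁ w₁ => ih hN.2 s₁' s₁ w₁) _ 0 _ _ (w.tick hK')

/-- The output of `reduction A I H F` on `input`. -/
def reductionOutput (P : PairingSystem) (A : Prog) (I H F : Fn) (n L : ℕ) (input : Val) :
    PMF (Config Val × Val) :=
  (I.den P n L input).bind fun st =>
    (A.run P (H.handler P n L) (Config.start n L Val.nil st)).bind fun s =>
      (F.den P n L (Val.node (s.mem 0) s.env)).map fun v => (s, v)

/-- The last conjunct keeps the adversary's final configuration in the support of one of its runs,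
since `PPT` bounds the time on supports. The constant `6` counts four register moves at the start
and the `cons` and `copy` around `F`. -/
theorem run_reduction (A : Prog) (I H F : Fn) (n L : ℕ) (input : Val) (env : σ) :
    Coupled (fun (s' : Config σ) (r : Config Val × Val) => s'.mem 0 = r.2 ∧
        s'.time ≤ (H.cost.eval L + 3) * r.1.time + (I.cost.eval L + F.cost.eval L + 6) ∧
        ∃ st, r.1 ∈ (A.run P (H.handler P n L) (Config.start n L Val.nil st)).support)
      (Prog.run P h (reduction A I H F) (Config.start n L input env))
      (reductionOutput P A I H F n L input) := by
  have hA := A.below_bound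
  have hN := A.three_le_bound
  simp only [reduction, reductionOutput]
  generalize A.bound = N at hA hN
  simp only [Prog.run, PMF.pure_bind]
  set s₀ : Config σ := ((((Config.start n L input env).set N _).set (N + 1) _).set (N + 2) _).set
    2 _ with hs₀
  have k₀ : N ≠ 0 := by omega
  have k₁ : N ≠ 1 := by omega
  have k₂ : N ≠ 2 := by omega
  have e₀ : s₀.mem N = Val.ofNat n := by
    simp [hs₀, Config.set, Function.update_apply, k₂, Config.start]
  have e₁ : s₀.mem (N + 1) = Val.ofNat L := by
    simp [hs₀, Config.set, Function.update_apply, show N + 1 ≠ 2 by omega, Config.start, k₁.symm]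
  have e₂ : s₀.mem (N + 2) = input := by
    simp [hs₀, Config.set, Function.update_apply, Config.start, k₀, k₂.symm,
      show 2 ≠ N + 1 by omega]
  have e₃ : ∀ r < N, s₀.mem r = (Config.start n L Val.nil Val.nil).mem r := by
    intro r hr
    have := hr.ne
    have := (hr.trans (Nat.lt_succ_self N)).ne
    have : r ≠ N + 2 := by omega
    by_cases h2 : r = 2
    · simp [hs₀, Config.set, h2, Config.start]
    · simp [Config.set, Function.update_apply, Config.start, *]
  have e₄ : s₀.time = 4 := by simp [hs₀, Config.set, Config.start]
  have := Fn.run_compile (P := P) (h := h) n L N I (N + 2) s₀ (by omega) e₀ e₁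
  rw [e₂] at this
  refine this.bind ?_
  intro s₁ st w₁
  have w : Config.Simulates N n L (H.cost.eval L + 3) (I.cost.eval L + 4) s₁
      (Config.start n L Val.nil st) :=
    ⟨fun r hr => by rw [w₁.below r (by omega), e₃ r hr]; rfl, by rw [w₁.below _ (by omega), e₀],
      by rw [w₁.below _ (by omega), e₁], w₁.out, by
        have := w₁.time
        simp only [Config.start]
        omega⟩
  have hsup := (Prog.run_subst (P := P) (h := h) N n L _ _ H rfl A hA s₁ _ w)
  obtain ⟨c, c₁, c₂, c₃⟩ := hsup
  have hsup : Coupled (fun s' s => Config.Simulates N n L (H.cost.eval L + 3)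
      (I.cost.eval L + 4) s' s ∧
      s ∈ (A.run P (H.handler P n L) (Config.start n L Val.nil st)).support) _ _ :=
    ⟨c, c₁, c₂, fun x hx => ⟨c₃ x hx, by
      rw [← c₂]; exact (PMF.mem_support_map_iff _ _ _).mpr ⟨x, hx, rfl⟩⟩⟩
  refine hsup.bind ?_
  rintro s₂ s ⟨w₂, hs⟩
  have w₃ := Config.Wrote.set s₂ (N + 2) (Val.node (s₂.mem 0) (s₂.mem (N + 2)))
  have := Fn.run_compile (P := P) (h := h) n L N F (N + 2) _ (by omega)
      (by rw [w₃.below _ (by omega), w₂.secParam]) (by rw [w₃.below _ (by omega), w₂.users])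
  rw [w₃.out, w₂.mem 0 (by omega), w₂.state] at this
  rw [w₂.mem 0 (by omega), w₂.state] at w₃ ⊢
  refine this.bind ?_
  intro s₄ v w₄
  have w₄ := w₃.trans w₄
  refine Coupled.pure ⟨by simp [Config.set, w₄.out], ?_, st, hs⟩
  have t₂ := w₂.time
  have t₄ := w₄.time
  simp only [Config.set]
  omega

theorem output_reduction (A : Prog) (I H F : Fn) (n L : ℕ) (input : Val) :
    (reduction A I H F).output P n L input =
      (reductionOutput P A I H F n L input).map Prod.snd :=
  (run_reduction A I H F n L input ()).map_eq_map fun _ _ h => h.1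

/-- `PPT` bounds the time of `A` in every environment, in particular in the one computed by `H`, so
no property of the simulated environment is needed. -/
theorem PPT.reduction {L : ℕ → ℕ} {q : Polynomial ℕ} (hq : ∀ n, L n ≤ q.eval n) {A : Prog}
    (hA : PPT P L A) (I H F : Fn) : PPT P L (reduction A I H F) := by
  obtain ⟨r, hr⟩ := hA
  refine ⟨(H.cost.comp q + 3) * r + (I.cost.comp q + F.cost.comp q + 6), ?_⟩
  intro n input σ h env s hs
  obtain ⟨x, -, -, ht, st, hx⟩ := (run_reduction A I H F n (L n) input env).exists_right hs
  refine ht.trans ?_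
  -- Coefficients are natural numbers, so evaluation is monotone.
  have mono : ∀ p : Polynomial ℕ, p.eval (L n) ≤ p.eval (q.eval n) := by
    intro p
    rw [Polynomial.eval_eq_sum_range, Polynomial.eval_eq_sum_range]
    exact Finset.sum_le_sum fun i _ => by gcongr; exact hq n
  have := hr n Val.nil Val (H.handler P n (L n)) st _ hx
  simp only [Polynomial.eval_add, Polynomial.eval_mul, Polynomial.eval_comp,
    Polynomial.eval_ofNat]
  have hH := mono H.cost
  have hI := mono I.cost
  have hF := mono F.cost
  exact add_le_add (Nat.mul_le_mul (by omega) this) (by omega)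

end Correctness

end DBE
end

noncomputable section
namespace DBE

/-! ## Functions computed by expressions -/

/-- `f` is computed by an expression.  (A class, so that instance search composes such
functions.) -/
class Feas (P : PairingSystem) (f : ℕ → ℕ → Val → Val) : Prop where
  out : ∃ F : Fn, ∀ n L v, F.den P n L v = PMF.pure (f n L v)

/-- The randomized function `f` is computed by an expression. -/
class FeasR (P : PairingSystem) (f : ℕ → ℕ → Val → PMF Val) : Prop where
  out : ∃ F : Fn, ∀ n L v, F.den P n L v = f n L v

open Classical in
/-- Equality test. -/
def Val.beq (a b : Val) : Val := Val.ofBool (decide (a = b))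

def Val.cond (c a b : Val) : Val := if c.toBool = true then a else b

/-- Number of iterations available for loops. -/
def cap (L : ℕ) : ℕ := L + L + L + L + 4

theorem PMF.pure_inj {α : Type} {a b : α} (h : PMF.pure a = PMF.pure b) : a = b := by
  have : a ∈ (PMF.pure b).support := by rw [← h]; simp
  simpa using this

section Closure

variable {P : PairingSystem}

theorem Feas.comp' {f g : ℕ → ℕ → Val → Val} (hf : Feas P f) (hg : Feas P g) :
    Feas P fun n L v => f n L (g n L v) := by
  obtain ⟨F, hF⟩ := hf
  obtain ⟨G, hG⟩ := hg
  exact ⟨.comp F G, fun n L v => by simp [Fn.den, hF, hG]⟩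

instance Feas.input : Feas P fun _ _ v => v := ⟨.id, fun _ _ _ => rfl⟩

instance Feas.nil : Feas P fun _ _ _ => Val.nil := ⟨.nil, fun _ _ _ => rfl⟩

instance Feas.secParam : Feas P fun n _ _ => Val.ofNat n := ⟨.secParam, fun _ _ _ => rfl⟩

instance Feas.users : Feas P fun _ L _ => Val.ofNat L := ⟨.users, fun _ _ _ => rfl⟩

instance Feas.hd {f : ℕ → ℕ → Val → Val} [hf : Feas P f] : Feas P fun n L v => (f n L v).hd :=
  Feas.comp' (f := fun _ _ v => v.hd) ⟨.hd, fun _ _ _ => rfl⟩ hf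

instance Feas.tl {f : ℕ → ℕ → Val → Val} [hf : Feas P f] : Feas P fun n L v => (f n L v).tl :=
  Feas.comp' (f := fun _ _ v => v.tl) ⟨.tl, fun _ _ _ => rfl⟩ hf

instance Feas.node {f g : ℕ → ℕ → Val → Val} [hf : Feas P f] [hg : Feas P g] :
    Feas P fun n L v => Val.node (f n L v) (g n L v) := by
  obtain ⟨F, hF⟩ := hf
  obtain ⟨G, hG⟩ := hg
  exact ⟨.pair F G, fun n L v => by simp [Fn.den, hF, hG]⟩

instance Feas.beq {f g : ℕ → ℕ → Val → Val} [hf : Feas P f] [hg : Feas P g] :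
    Feas P fun n L v => Val.beq (f n L v) (g n L v) :=
  Feas.comp' (f := fun _ _ v => Val.beq v.hd v.tl) (g := fun n L v => .node (f n L v) (g n L v))
    ⟨.eq, fun _ _ _ => rfl⟩ inferInstance

instance Feas.cond {c f g : ℕ → ℕ → Val → Val} [hc : Feas P c] [hf : Feas P f]
    [hg : Feas P g] : Feas P fun n L v => Val.cond (c n L v) (f n L v) (g n L v) := by
  obtain ⟨C, hC⟩ := hc
  obtain ⟨F, hF⟩ := hf
  obtain ⟨G, hG⟩ := hg
  refine ⟨.ite C F G, fun n L v => ?_⟩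
  simp only [Fn.den, hC, hF, hG, PMF.pure_bind, Val.cond]
  split_ifs <;> rfl

/-- Four nested applications of a loop of length `L`, followed by four single applications, make up
`cap L` rounds. -/
theorem Feas.iterate {f : ℕ → ℕ → Val → Val} (hf : Feas P f) {a : ℕ → ℕ → Val → Val}
    (ha : Feas P a) : Feas P fun n L v => (f n L)^[cap L] (a n L v) := by
  have one : ∀ {a : ℕ → ℕ → Val → Val}, Feas P a → Feas P fun n L v => (f n L)^[L] (a n L v) := by
    intro a ha
    obtain ⟨F, hF⟩ := hf
    refine Feas.comp' (f := fun n L => (f n L)^[L]) ⟨.iter F, fun n L v => ?_⟩ ha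
    simp only [Fn.den]
    have : ∀ k v, DBE.iterate (F.den P n L) k v = PMF.pure ((f n L)^[k] v) := by
      intro k
      induction k with
      | zero => intro v; rfl
      | succ k ih => intro v; simp [DBE.iterate, hF, ih]
    exact this L v
  have := hf.comp' (hf.comp' (hf.comp' (hf.comp' (one (one (one (one ha)))))))
  refine ⟨this.out.choose, fun n L v => (this.out.choose_spec n L v).trans ?_⟩
  have e : cap L = 4 + (L + (L + (L + L))) := by rw [cap]; omega
  rw [e, Function.iterate_add_apply, Function.iterate_add_apply, Function.iterate_add_apply,
    Function.iterate_add_apply]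
  rfl

end Closure

/-! ## Bounded folds -/

/-- `f i₁ (f i₂ (… a))` for the proper tails `i₁, i₂, …` of `c`, the shortest first; at most `m`
rounds. -/
def Val.fold (m : ℕ) (f : Val → Val → Val) (c a : Val) : Val :=
  ((fun s : Val => Val.cond s.hd (.node s.hd.tl (f s.hd.tl s.tl)) s)^[m] (.node c a)).tl

namespace Val

@[simp] theorem hd_node (a b : Val) : (node a b).hd = a := rfl
@[simp] theorem tl_node (a b : Val) : (node a b).tl = b := rfl
@[simp] theorem hd_nil : nil.hd = nil := rfl
@[simp] theorem tl_nil : nil.tl = nil := rfl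
@[simp] theorem toBool_nil : nil.toBool = false := rfl
@[simp] theorem toBool_node (a b : Val) : (node a b).toBool = true := rfl
@[simp] theorem toBool_ofBool (b : Bool) : (ofBool b).toBool = b := by cases b <;> rfl
@[simp] theorem ofNat_zero : ofNat 0 = nil := rfl
theorem ofNat_succ (k : ℕ) : ofNat (k + 1) = node nil (ofNat k) := by
  simp [ofNat, List.replicate_succ, ofList]
@[simp] theorem toList_ofList (l : List Val) : (ofList l).toList = l := by
  induction l with
  | nil => rfl
  | cons a l ih => simp [ofList, toList, ih]
theorem ofList_inj {l m : List Val} (h : ofList l = ofList m) : l = m := by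
  rw [← toList_ofList l, h, toList_ofList]
@[simp] theorem len_ofNat (k : ℕ) : (ofNat k).len = k := by simp [len, ofNat]
@[simp] theorem len_nil : nil.len = 0 := rfl
@[simp] theorem len_node (a b : Val) : (node a b).len = b.len + 1 := by simp [len, toList]
@[simp] theorem ofList_cons (a : Val) (l : List Val) : ofList (a :: l) = node a (ofList l) := rfl
@[simp] theorem ofList_nil : ofList [] = nil := rfl
theorem ofNat_inj {k l : ℕ} (h : ofNat k = ofNat l) : k = l := by
  rw [← len_ofNat k, h, len_ofNat]
theorem ofBool_inj {a b : Bool} (h : ofBool a = ofBool b) : a = b := by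
  rw [← toBool_ofBool a, h, toBool_ofBool]
theorem ofBits_inj {l m : List Bool} (h : ofBits l = ofBits m) : l = m :=
  List.map_injective_iff.mpr (fun _ _ => ofBool_inj) (ofList_inj h)
@[simp] theorem toBool_beq (a b : Val) : (beq a b).toBool = true ↔ a = b := by
  simp [beq]
theorem cond_def (c a b : Val) : cond c a b = if c.toBool = true then a else b := rfl
@[simp] theorem cond_nil (a b : Val) : cond nil a b = b := rfl
@[simp] theorem cond_node (c d a b : Val) : cond (node c d) a b = a := rfl

theorem tl_iterate_hd (v : Val) (k : ℕ) : (tl^[k] v).hd = v.toList.getD k nil := by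
  induction k generalizing v with
  | zero => cases v <;> simp [toList]
  | succ k ih =>
    rw [Function.iterate_succ_apply, ih]
    cases v <;> simp [toList]

theorem tl_iterate_len (v : Val) (k : ℕ) : (tl^[k] v).len = v.len - k := by
  induction k generalizing v with
  | zero => rfl
  | succ k ih =>
    rw [Function.iterate_succ_apply, ih]
    cases v <;> simp

theorem tl_iterate_ofNat (j k : ℕ) : tl^[k] (ofNat j) = ofNat (j - k) := by
  induction k generalizing j with
  | zero => rfl
  | succ k ih =>
    rw [Function.iterate_succ_apply]
    cases j with
    | zero => rw [ofNat_zero, tl_nil, ← ofNat_zero, ih]; simp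
    | succ j => rw [ofNat_succ, tl_node, ih]; simp

theorem len_eq_zero {v : Val} : v.len = 0 ↔ v = nil := by cases v <;> simp

theorem fold_nil (m : ℕ) (f : Val → Val → Val) (a : Val) : fold m f nil a = a := by
  have : ∀ m, ((fun s : Val => Val.cond s.hd (.node s.hd.tl (f s.hd.tl s.tl)) s)^[m]
      (.node nil a)) = .node nil a := by
    intro m
    induction m with
    | zero => rfl
    | succ m ih => rw [Function.iterate_succ_apply]; simpa using ih
  rw [fold, this]
  rfl

theorem fold_node (m : ℕ) (f : Val → Val → Val) (x c a : Val) :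
    fold (m + 1) f (node x c) a = fold m f c (f c a) := by
  simp [fold, Function.iterate_succ_apply]

/-- The body receives the counter after its decrement, so the indices run from `k - 1` down to `0`.
Lists consed together by a fold therefore come out in increasing order of the index. -/
theorem fold_ofNat {m k : ℕ} (h : k ≤ m) (f : Val → Val → Val) (a : Val) :
    fold m f (ofNat k) a = (List.range k).foldr (fun i acc => f (ofNat i) acc) a := by
  induction k generalizing m a with
  | zero => exact fold_nil _ _ _
  | succ k ih =>
    obtain ⟨m, rfl⟩ : ∃ m', m = m' + 1 := ⟨m - 1, by omega⟩
    rw [ofNat_succ, fold_node, ih (by omega), List.range_succ, List.foldr_append]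
    rfl

theorem fold_const {m : ℕ} (f : Val → Val) {c : Val} (h : c.len ≤ m) (a : Val) :
    fold m (fun _ => f) c a = f^[c.len] a := by
  induction c generalizing m a with
  | nil => exact fold_nil _ _ _
  | node x c _ ih =>
    rw [len_node] at h
    obtain ⟨m, rfl⟩ : ∃ m', m = m' + 1 := ⟨m - 1, by omega⟩
    rw [fold_node, ih (by omega), len_node, Function.iterate_succ_apply]

end Val

section Closure

variable {P : PairingSystem}

/-- A loop body is an expression in the loop state alone; the outer value `v`, on which `B` may
depend, has to travel inside that state. -/
instance Feas.fold {B : ℕ → ℕ → Val → Val → Val → Val} {c a : ℕ → ℕ → Val → Val}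
    [hB : Feas P fun n L x => B n L x.hd x.tl.hd x.tl.tl] [hc : Feas P c] [ha : Feas P a] :
    Feas P fun n L v => Val.fold (cap L) (fun i acc => B n L v i acc) (c n L v) (a n L v) := by
  -- the state is `node v (node c a)`
  have hstep : Feas P fun n L s => Val.cond s.tl.hd (.node s.hd (.node s.tl.hd.tl
      (B n L s.hd s.tl.hd.tl s.tl.tl))) s := by
    have : Feas P fun n L s => B n L s.hd s.tl.hd.tl s.tl.tl :=
      Feas.comp' (f := fun n L x => B n L x.hd x.tl.hd x.tl.tl)
        (g := fun n L s => .node s.hd (.node s.tl.hd.tl s.tl.tl)) hB inferInstance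
    infer_instance
  have := Feas.iterate hstep (a := fun n L v => .node v (.node (c n L v) (a n L v)))
    inferInstance
  have : Feas P fun n L v => (((fun s => Val.cond s.tl.hd (.node s.hd (.node s.tl.hd.tl
      (B n L s.hd s.tl.hd.tl s.tl.tl))) s)^[cap L] (.node v (.node (c n L v) (a n L v))))).tl.tl :=
    inferInstance
  obtain ⟨F, hF⟩ := this
  refine ⟨F, fun n L v => (hF n L v).trans ?_⟩
  congr 1
  have key : ∀ m c a, ((fun s => Val.cond s.tl.hd (.node s.hd (.node s.tl.hd.tl
      (B n L s.hd s.tl.hd.tl s.tl.tl))) s)^[m] (.node v (.node c a))) =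
      .node v ((fun s : Val => Val.cond s.hd (.node s.hd.tl (B n L v s.hd.tl s.tl)) s)^[m]
        (.node c a)) := by
    intro m
    induction m with
    | zero => intro c a; rfl
    | succ m ih =>
      intro c a
      rw [Function.iterate_succ_apply, Function.iterate_succ_apply]
      cases c with
      | nil => simpa using ih Val.nil a
      | node x c => simpa using ih c _
  rw [key]
  rfl

end Closure

namespace Val

/-- `v` without the first `k.len` entries. -/
def dropBy (L : ℕ) (k v : Val) : Val := fold (cap L) (fun _ acc => acc.tl) k v

/-- Entry number `k.len`, counted from `0`. -/
def get (L : ℕ) (v k : Val) : Val := (dropBy L k v).hd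

def uadd (L : ℕ) (a b : Val) : Val := fold (cap L) (fun _ acc => node nil acc) a b

/-- The list of the values `f i` for the `i < c` with `p i`. -/
def build (L : ℕ) (p f : Val → Val) (c : Val) : Val :=
  fold (cap L) (fun i acc => cond (p i) (node (f i) acc) acc) c nil

def not (a : Val) : Val := cond a nil (node nil nil)
def and (a b : Val) : Val := cond a b nil

@[simp] theorem toBool_not (a : Val) : a.not.toBool = !a.toBool := by cases a <;> rfl
@[simp] theorem toBool_and (a b : Val) : (a.and b).toBool = (a.toBool && b.toBool) := by
  cases a <;> simp [and]

theorem dropBy_eq {L : ℕ} {k : Val} (h : k.len ≤ cap L) (v : Val) :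
    dropBy L k v = tl^[k.len] v := fold_const _ h _

theorem get_eq {L : ℕ} {k : Val} (h : k.len ≤ cap L) (v : Val) :
    get L v k = v.toList.getD k.len nil := by
  rw [get, dropBy_eq h, tl_iterate_hd]

theorem get_ofNat {L k : ℕ} (h : k ≤ cap L) (v : Val) :
    get L v (ofNat k) = v.toList.getD k nil := by
  rw [get_eq (by simpa using h), len_ofNat]

theorem uadd_ofNat {L a : ℕ} (h : a ≤ cap L) (b : ℕ) :
    uadd L (ofNat a) (ofNat b) = ofNat (a + b) := by
  rw [uadd, fold_const _ (by simpa using h), len_ofNat]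
  induction a with
  | zero => simp
  | succ a ih => rw [Function.iterate_succ_apply', ih (by omega), ← ofNat_succ]; congr 1; omega

theorem build_ofNat {L k : ℕ} (h : k ≤ cap L) (p f : Val → Val) :
    build L p f (ofNat k) = ofList (((List.range k).filter fun i => (p (ofNat i)).toBool).map
      fun i => f (ofNat i)) := by
  rw [build, fold_ofNat h]
  induction List.range k with
  | nil => rfl
  | cons i l ih =>
    rw [List.foldr_cons, ih, cond_def, List.filter_cons]
    split_ifs <;> rfl

end Val

section Closure

variable {P : PairingSystem} {a b f : ℕ → ℕ → Val → Val} [Feas P a] [Feas P b] [Feas P f]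

instance Feas.dropBy : Feas P fun n L v => Val.dropBy L (a n L v) (b n L v) := by
  unfold Val.dropBy; infer_instance

instance Feas.get : Feas P fun n L v => Val.get L (a n L v) (b n L v) := by
  unfold Val.get; infer_instance

instance Feas.uadd : Feas P fun n L v => Val.uadd L (a n L v) (b n L v) := by
  unfold Val.uadd; infer_instance

instance Feas.not : Feas P fun n L v => Val.not (a n L v) := by
  unfold Val.not; infer_instance

instance Feas.and : Feas P fun n L v => Val.and (a n L v) (b n L v) := by
  unfold Val.and; infer_instance

instance Feas.build {p f : ℕ → ℕ → Val → Val → Val} [hp : Feas P fun n L x => p n L x.hd x.tl]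
    [hf : Feas P fun n L x => f n L x.hd x.tl] :
    Feas P fun n L v => Val.build L (fun i => p n L v i) (fun i => f n L v i) (a n L v) := by
  unfold Val.build
  have h₁ : Feas P fun n L x => p n L x.hd x.tl.hd :=
    Feas.comp' (f := fun n L x => p n L x.hd x.tl) (g := fun n L x => .node x.hd x.tl.hd) hp
      inferInstance
  have h₂ : Feas P fun n L x => f n L x.hd x.tl.hd :=
    Feas.comp' (f := fun n L x => f n L x.hd x.tl) (g := fun n L x => .node x.hd x.tl.hd) hf
      inferInstance
  infer_instance

end Closure

end DBE
end

noncomputable section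
namespace DBE

/-! ## Basic algorithms in expressions -/

theorem exists_getD_bind {α : Type} (o : Option α) (f : α → Option (PMF Val))
    (h : ∀ a, ∃ v, (f a).getD (PMF.pure Val.nil) = PMF.pure v) :
    ∃ v, (o >>= f).getD (PMF.pure Val.nil) = PMF.pure v := by
  cases o with
  | none => exact ⟨Val.nil, rfl⟩
  | some a => exact h a

/-- The basic algorithms that make no random choices. -/
def Prim.isDet : Prim → Bool
  | .scalarRand | .randG | .randGh | .genKey1 | .genKey2 => false
  | _ => true

theorem Prim.exists_eval_eq_pure (P : PairingSystem) {f : Prim} (hf : f.isDet = true)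
    (args : List Val) : ∃ v, f.eval P args = PMF.pure v := by
  cases f <;> first
    | (simp [Prim.isDet] at hf; done)
    | (rw [Prim.eval]
       unfold Prim.eval?
       split <;> first
         | (repeat (refine exists_getD_bind _ _ fun _ => ?_)
            exact ⟨_, rfl⟩)
         | simp_all)

open Classical in
/-- The result of a basic algorithm that makes no random choices. -/
def Prim.det (P : PairingSystem) (f : Prim) (args : List Val) : Val :=
  if h : ∃ v, f.eval P args = PMF.pure v then h.choose else Val.nil

theorem Prim.eval_eq_pure_det {P : PairingSystem} {f : Prim} (hf : f.isDet = true)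
    (args : List Val) : f.eval P args = PMF.pure (f.det P args) := by
  rw [Prim.det, dif_pos (Prim.exists_eval_eq_pure P hf args)]
  exact (Prim.exists_eval_eq_pure P hf args).choose_spec

theorem Prim.det_eq {P : PairingSystem} {f : Prim} {args : List Val} {v : Val}
    (h : f.eval P args = PMF.pure v) : f.det P args = v := by
  have h' : ∃ v, f.eval P args = PMF.pure v := ⟨v, h⟩
  rw [Prim.det, dif_pos h']
  exact PMF.pure_inj (h'.choose_spec.symm.trans h)

/-- A class, so that instance search can verify that a call makes no random choice. -/
class Prim.Det (f : Prim) : Prop where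
  det : f.isDet = true

instance : Prim.Det .scalarAdd := ⟨rfl⟩
instance : Prim.Det .scalarMul := ⟨rfl⟩
instance : Prim.Det .scalarNeg := ⟨rfl⟩
instance : Prim.Det .scalarInv := ⟨rfl⟩
instance : Prim.Det .isG := ⟨rfl⟩
instance : Prim.Det .mulG := ⟨rfl⟩
instance : Prim.Det .powG := ⟨rfl⟩
instance : Prim.Det .isGh := ⟨rfl⟩
instance : Prim.Det .mulGh := ⟨rfl⟩
instance : Prim.Det .powGh := ⟨rfl⟩
instance : Prim.Det .mulGT := ⟨rfl⟩
instance : Prim.Det .powGT := ⟨rfl⟩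
instance : Prim.Det .pair := ⟨rfl⟩
instance : Prim.Det .hash1 := ⟨rfl⟩
instance : Prim.Det .hash2 := ⟨rfl⟩

section Encodings

variable (P : PairingSystem)

theorem PairingSystem.descVal_inj : Function.Injective P.descVal := by
  intro d e h
  simp only [PairingSystem.descVal, Val.node.injEq] at h
  exact P.encDesc_inj h.2

theorem BilinearGroup.encScalar_inj (𝔹 : BilinearGroup) : Function.Injective 𝔹.encScalar := by
  intro x y h
  apply ZMod.val_injective
  have := Val.ofBits_inj h
  rw [← Nat.digits_inj_iff (b := 2), Nat.digits_two_eq_bits, Nat.digits_two_eq_bits, this]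

@[simp] theorem partialInv_descVal (d : P.Desc) :
    Function.partialInv P.descVal (P.descVal d) = some d :=
  Function.partialInv_left P.descVal_inj d

@[simp] theorem partialInv_encScalar (𝔹 : BilinearGroup) (x : ZMod 𝔹.p) :
    Function.partialInv 𝔹.encScalar (𝔹.encScalar x) = some x :=
  Function.partialInv_left 𝔹.encScalar_inj x

@[simp] theorem partialInv_encG (d : P.Desc) (x : (P.grp d).G) :
    Function.partialInv (P.encG d) (P.encG d x) = some x :=
  Function.partialInv_left (P.encG_inj d) x

@[simp] theorem partialInv_encGh (d : P.Desc) (x : (P.grp d).Gh) :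
    Function.partialInv (P.encGh d) (P.encGh d x) = some x :=
  Function.partialInv_left (P.encGh_inj d) x

@[simp] theorem partialInv_encGT (d : P.Desc) (x : (P.grp d).GT) :
    Function.partialInv (P.encGT d) (P.encGT d x) = some x :=
  Function.partialInv_left (P.encGT_inj d) x

@[simp] theorem partialInv_encKey1 (n : ℕ) (d : P.Desc) (x : P.Key1 n d) :
    Function.partialInv (P.encKey1 n d) (P.encKey1 n d x) = some x :=
  Function.partialInv_left (P.encKey1_inj n d) x

@[simp] theorem partialInv_encKey2 (n : ℕ) (d : P.Desc) (x : P.Key2 n d) :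
    Function.partialInv (P.encKey2 n d) (P.encKey2 n d x) = some x :=
  Function.partialInv_left (P.encKey2_inj n d) x

end Encodings

section Values

variable {P : PairingSystem} (d : P.Desc)

open Prim

@[simp] theorem det_scalarAdd (x y : ZMod (P.grp d).p) :
    scalarAdd.det P [P.descVal d, (P.grp d).encScalar x, (P.grp d).encScalar y] = (P.grp d).encScalar (x + y) :=
  det_eq (by simp [eval, eval?])

@[simp] theorem det_scalarMul (x y : ZMod (P.grp d).p) :
    scalarMul.det P [P.descVal d, (P.grp d).encScalar x, (P.grp d).encScalar y] = (P.grp d).encScalar (x * y) :=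
  det_eq (by simp [eval, eval?])

@[simp] theorem det_scalarNeg (x : ZMod (P.grp d).p) :
    scalarNeg.det P [P.descVal d, (P.grp d).encScalar x] = (P.grp d).encScalar (-x) :=
  det_eq (by simp [eval, eval?])

@[simp] theorem det_scalarInv (x : ZMod (P.grp d).p) :
    scalarInv.det P [P.descVal d, (P.grp d).encScalar x] = (P.grp d).encScalar x⁻¹ :=
  det_eq (by simp [eval, eval?])

@[simp] theorem det_mulG (x y : (P.grp d).G) :
    mulG.det P [P.descVal d, P.encG d x, P.encG d y] = P.encG d (x * y) :=
  det_eq (by simp [eval, eval?])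

@[simp] theorem det_powG (x : (P.grp d).G) (z : ZMod (P.grp d).p) :
    powG.det P [P.descVal d, P.encG d x, (P.grp d).encScalar z] = P.encG d (x ^ z.val) :=
  det_eq (by simp [eval, eval?])

@[simp] theorem det_isG (v : Val) :
    isG.det P [P.descVal d, v] = Val.ofBool (Function.partialInv (P.encG d) v).isSome :=
  det_eq (by simp [eval, eval?])

@[simp] theorem det_mulGh (x y : (P.grp d).Gh) :
    mulGh.det P [P.descVal d, P.encGh d x, P.encGh d y] = P.encGh d (x * y) :=
  det_eq (by simp [eval, eval?])

@[simp] theorem det_powGh (x : (P.grp d).Gh) (z : ZMod (P.grp d).p) :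
    powGh.det P [P.descVal d, P.encGh d x, (P.grp d).encScalar z] = P.encGh d (x ^ z.val) :=
  det_eq (by simp [eval, eval?])

@[simp] theorem det_isGh (v : Val) :
    isGh.det P [P.descVal d, v] = Val.ofBool (Function.partialInv (P.encGh d) v).isSome :=
  det_eq (by simp [eval, eval?])

@[simp] theorem det_mulGT (x y : (P.grp d).GT) :
    mulGT.det P [P.descVal d, P.encGT d x, P.encGT d y] = P.encGT d (x * y) :=
  det_eq (by simp [eval, eval?])

@[simp] theorem det_powGT (x : (P.grp d).GT) (z : ZMod (P.grp d).p) :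
    powGT.det P [P.descVal d, P.encGT d x, (P.grp d).encScalar z] = P.encGT d (x ^ z.val) :=
  det_eq (by simp [eval, eval?])

@[simp] theorem det_pair (x : (P.grp d).G) (y : (P.grp d).Gh) :
    pair.det P [P.descVal d, P.encG d x, P.encGh d y] = P.encGT d ((P.grp d).e x y) :=
  det_eq (by simp [eval, eval?])

@[simp] theorem det_hash1 (n : ℕ) (κ : P.Key1 n d) (x : (P.grp d).Gh) (v : Val) :
    hash1.det P [Val.ofNat n, P.descVal d, P.encKey1 n d κ, P.encGh d x, v] = (P.grp d).encScalar (P.H1 n d κ x v.toBits) :=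
  det_eq (by
    -- The key has type `P.Key1 n d`, but evaluation looks for a key of type `P.Key1 N.len d`;
    -- replacing `n` by `N.len` makes the types agree by definition.
    generalize h : Val.ofNat n = N
    have : N.len = n := by rw [← h, Val.len_ofNat]
    subst this
    simp [eval, eval?])

@[simp] theorem det_hash2 (n : ℕ) (κ : P.Key2 n d) (x : (P.grp d).GT) :
    hash2.det P [Val.ofNat n, P.descVal d, P.encKey2 n d κ, P.encGT d x] = Val.ofBits (P.H2 n d κ x).toList :=
  det_eq (by
    generalize h : Val.ofNat n = N
    have : N.len = n := by rw [← h, Val.len_ofNat]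
    subst this
    simp [eval, eval?])

@[simp] theorem eval_scalarRand  :
    scalarRand.eval P [P.descVal d] = (P.grp d).randScalar.map (P.grp d).encScalar := by
  simp [eval, eval?]

@[simp] theorem eval_randG  :
    randG.eval P [P.descVal d] = (P.grp d).randG.map (P.encG d) := by
  simp [eval, eval?]

@[simp] theorem eval_randGh  :
    randGh.eval P [P.descVal d] = (P.grp d).randGh.map (P.encGh d) := by
  simp [eval, eval?]

@[simp] theorem eval_genKey1 (n : ℕ) :
    genKey1.eval P [Val.ofNat n, P.descVal d] = (P.genKey1 n d).map (P.encKey1 n d) := by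
  generalize h : Val.ofNat n = N
  have : N.len = n := by rw [← h, Val.len_ofNat]
  subst this
  simp [eval, eval?]

@[simp] theorem eval_genKey2 (n : ℕ) :
    genKey2.eval P [Val.ofNat n, P.descVal d] = (P.genKey2 n d).map (P.encKey2 n d) := by
  generalize h : Val.ofNat n = N
  have : N.len = n := by rw [← h, Val.len_ofNat]
  subst this
  simp [eval, eval?]

end Values

section Closure

variable {P : PairingSystem}

theorem Feas.call {f : Prim} (hf : f.isDet = true) (k : ℕ) {a : ℕ → ℕ → Val → Val}
    (ha : Feas P a) : Feas P fun n L v => f.det P ((a n L v).args k) :=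
  Feas.comp' (f := fun _ _ v => f.det P (v.args k))
    ⟨.call f k, fun _ _ _ => Prim.eval_eq_pure_det hf _⟩ ha

variable {f : Prim} [hf : f.Det] {a₁ a₂ a₃ a₄ a₅ : ℕ → ℕ → Val → Val} [Feas P a₁] [Feas P a₂]

instance Feas.call2 : Feas P fun n L v => f.det P [a₁ n L v, a₂ n L v] :=
  Feas.call hf.det 2 (a := fun n L v => .node (a₁ n L v) (.node (a₂ n L v) .nil)) inferInstance

variable [Feas P a₃]

instance Feas.call3 : Feas P fun n L v => f.det P [a₁ n L v, a₂ n L v, a₃ n L v] :=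
  Feas.call hf.det 3
    (a := fun n L v => .node (a₁ n L v) (.node (a₂ n L v) (.node (a₃ n L v) .nil))) inferInstance

variable [Feas P a₄]

instance Feas.call4 : Feas P fun n L v => f.det P [a₁ n L v, a₂ n L v, a₃ n L v, a₄ n L v] :=
  Feas.call hf.det 4 (a := fun n L v => .node (a₁ n L v) (.node (a₂ n L v) (.node (a₃ n L v)
    (.node (a₄ n L v) .nil)))) inferInstance

variable [Feas P a₅]

instance Feas.call5 :
    Feas P fun n L v => f.det P [a₁ n L v, a₂ n L v, a₃ n L v, a₄ n L v, a₅ n L v] :=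
  Feas.call hf.det 5 (a := fun n L v => .node (a₁ n L v) (.node (a₂ n L v) (.node (a₃ n L v)
    (.node (a₄ n L v) (.node (a₅ n L v) .nil))))) inferInstance

instance Feas.ofList_nil : Feas P fun _ _ _ => Val.ofList [] := Feas.nil

instance Feas.ofList_cons {a : ℕ → ℕ → Val → Val} {l : ℕ → ℕ → Val → List Val} [Feas P a]
    [h : Feas P fun n L v => Val.ofList (l n L v)] :
    Feas P fun n L v => Val.ofList (a n L v :: l n L v) := by
  have : Feas P fun n L v => Val.node (a n L v) (Val.ofList (l n L v)) := inferInstance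
  exact this

instance FeasR.pure {f : ℕ → ℕ → Val → Val} [h : Feas P f] :
    FeasR P fun n L v => PMF.pure (f n L v) := ⟨h.out⟩

instance FeasR.map {f : ℕ → ℕ → Val → PMF Val} {g : ℕ → ℕ → Val → Val → Val}
    [hf : FeasR P f] [hg : Feas P fun n L v => g n L v.hd v.tl] :
    FeasR P fun n L v => (f n L v).map fun x => g n L v x := by
  obtain ⟨F, hF⟩ := hf
  obtain ⟨G, hG⟩ := hg
  refine ⟨.comp G (.pair .id F), fun n L v => ?_⟩
  simp only [Fn.den, hF, PMF.pure_bind, PMF.bind_bind, hG]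
  rfl

instance FeasR.bind {f : ℕ → ℕ → Val → PMF Val} {g : ℕ → ℕ → Val → Val → PMF Val}
    [hf : FeasR P f] [hg : FeasR P fun n L v => g n L v.hd v.tl] :
    FeasR P fun n L v => (f n L v).bind fun x => g n L v x := by
  obtain ⟨F, hF⟩ := hf
  obtain ⟨G, hG⟩ := hg
  refine ⟨.comp G (.pair .id F), fun n L v => ?_⟩
  simp only [Fn.den, hF, PMF.pure_bind, PMF.bind_bind, hG]
  rfl

instance FeasR.flip : FeasR P fun _ _ _ => (PMF.uniformOfFintype Bool).map Val.ofBool :=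
  ⟨.flip, fun _ _ _ => rfl⟩

theorem FeasR.comp {f : ℕ → ℕ → Val → PMF Val} {g : ℕ → ℕ → Val → Val} (hf : FeasR P f)
    (hg : Feas P g) : FeasR P fun n L v => f n L (g n L v) := by
  obtain ⟨F, hF⟩ := hf
  obtain ⟨G, hG⟩ := hg
  exact ⟨.comp F G, fun n L v => by simp [Fn.den, hF, hG]⟩

theorem FeasR.iterate {f : ℕ → ℕ → Val → PMF Val} (hf : FeasR P f) {a : ℕ → ℕ → Val → Val}
    (ha : Feas P a) : FeasR P fun n L v => DBE.iterate (f n L) L (a n L v) := by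
  obtain ⟨F, hF⟩ := hf
  refine FeasR.comp (f := fun n L => DBE.iterate (f n L) L) ⟨.iter F, fun n L v => ?_⟩ ha
  simp only [Fn.den]
  congr 1
  funext v
  exact hF n L v

instance FeasR.call1 (f : Prim) {a : ℕ → ℕ → Val → Val} [ha : Feas P a] :
    FeasR P fun n L v => f.eval P [a n L v] :=
  FeasR.comp (f := fun _ _ v => f.eval P [v.hd]) (g := fun n L v => .node (a n L v) .nil)
    ⟨.call f 1, fun _ _ _ => rfl⟩ inferInstance

instance FeasR.call2 (f : Prim) {a b : ℕ → ℕ → Val → Val} [ha : Feas P a] [hb : Feas P b] :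
    FeasR P fun n L v => f.eval P [a n L v, b n L v] :=
  FeasR.comp (f := fun _ _ v => f.eval P [v.hd, v.tl.hd])
    (g := fun n L v => .node (a n L v) (.node (b n L v) .nil))
    ⟨.call f 2, fun _ _ _ => rfl⟩ inferInstance

end Closure

end DBE
end

noncomputable section
namespace DBE

/-! ## The table-driven challenger -/

/-- Data from which all answers in the security experiment and in its simulations are
computed. -/
structure Tab (P : PairingSystem) (n : ℕ) where
  d : P.Desc
  κ₁ : P.Key1 n d
  κ₂ : P.Key2 n d
  /-- the published parameters -/
  ppV : Val
  /-- the public keys of the users -/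
  upkV : ℕ → Val
  /-- `A_{L+1}`, `B`, and `A_j V_j` -/
  AL : (P.grp d).G
  B : (P.grp d).G
  TF : ℕ → (P.grp d).G
  gh : (P.grp d).Gh
  /-- first component of the challenge -/
  C₁ : (P.grp d).Gh
  /-- the second component of the challenge is `cB * ∏ j ∈ S, Tc j` -/
  cB : (P.grp d).G
  Tc : ℕ → (P.grp d).G
  /-- session key of the challenge -/
  ck : Val
  /-- decryption computes `(e C₂ X * e (q * ∏ j ∈ S, Tq j) C₁) ^ (u₁ ω + u₀)⁻¹` -/
  X : (P.grp d).Gh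
  q : (P.grp d).G
  Tq : ℕ → (P.grp d).G
  u₁ : ZMod (P.grp d).p
  u₀ : ZMod (P.grp d).p
  /-- a user and a bit that select the ciphertexts to be recorded -/
  k : ℕ
  b : Bool

/-- Phase, committed set and challenge set. -/
structure Core where
  ph : ℕ
  S₀ : Val
  S₁ : Val

/-- State of the challenger together with a record of two kinds of exceptional queries. -/
structure Full where
  core : Core
  rec₁ : Val
  rec₂ : Val
  ev : Option (Finset ℕ × Option (Finset ℕ))

def Core.init : Core := ⟨0, Val.nil, Val.nil⟩

def Full.init : Full := ⟨Core.init, Val.nil, Val.nil, none⟩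

/-- The parts of a decryption query. -/
def Val.qset (L : ℕ) (m : Val) : Finset ℕ := m.tl.hd.toSet L
def Val.qc₁ (m : Val) : Val := m.tl.tl.hd
def Val.qc₂ (m : Val) : Val := m.tl.tl.tl.hd
def Val.quser (m : Val) : Val := m.tl.tl.tl.tl.hd
def Val.qaux (m : Val) : Val := m.tl.tl.tl.tl.tl.hd

namespace Tab

variable {P : PairingSystem} {n : ℕ} (T : Tab P n) (L : ℕ)

def ω (c₁ : (P.grp T.d).Gh) (au : List Bool) : ZMod (P.grp T.d).p := P.H1 n T.d T.κ₁ c₁ au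

def F (S : Finset ℕ) (ω : ZMod (P.grp T.d).p) : (P.grp T.d).G :=
  T.AL ^ ω.val * T.B * ∏ j ∈ S, T.TF j

def C₂ (S : Finset ℕ) : (P.grp T.d).G := T.cB * ∏ j ∈ S, T.Tc j

def ans (S : Finset ℕ) (ω : ZMod (P.grp T.d).p) (c₁ : (P.grp T.d).Gh) (c₂ : (P.grp T.d).G) :
    (P.grp T.d).GT :=
  ((P.grp T.d).e c₂ T.X * (P.grp T.d).e (T.q * ∏ j ∈ S, T.Tq j) c₁) ^
    ((T.u₁ * ω + T.u₀)⁻¹).val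

def Valid (S : Finset ℕ) (ω : ZMod (P.grp T.d).p) (c₁ : (P.grp T.d).Gh) (c₂ : (P.grp T.d).G) :
    Prop := (P.grp T.d).e c₂ T.gh = (P.grp T.d).e (T.F S ω) c₁

open Classical in
/-- The ciphertext of an admissible decryption query. -/
def query (s : Core) (m : Val) : Option ((P.grp T.d).Gh × (P.grp T.d).G) :=
  if 2 ≤ s.ph ∧ m.hd.toBool = true then
    match Function.partialInv (P.encGh T.d) m.qc₁, Function.partialInv (P.encG T.d) m.qc₂ with
    | some c₁, some c₂ =>
        if m.qset L ⊆ s.S₀.toSet L ∧ m.quser.len ∈ m.qset L ∧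
          ¬ (2 < s.ph ∧ c₁ = T.C₁ ∧ c₂ = T.C₂ (s.S₁.toSet L)) then some (c₁, c₂) else none
    | _, _ => none
  else none

open Classical in
def decAns (m : Val) (c₁ : (P.grp T.d).Gh) (c₂ : (P.grp T.d).G) : Val :=
  if T.Valid (m.qset L) (T.ω c₁ m.qaux.toBits) c₁ c₂ then
    Val.node Val.nil (Val.ofBits (P.H2 n T.d T.κ₂
      (T.ans (m.qset L) (T.ω c₁ m.qaux.toBits) c₁ c₂)).toList)
  else Val.nil

/-- The message is an admissible request for the challenge. -/
def Challenge (s : Core) (m : Val) : Prop :=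
  s.ph = 2 ∧ m.hd.toBool = false ∧ m.tl.toSet L ⊆ s.S₀.toSet L

open Classical in
def answer (s : Core) (m : Val) : Val :=
  if s.ph = 0 then T.ppV
  else if s.ph = 1 then
    Val.ofList (((List.range' 1 L).filter (· ∈ s.S₀.toSet L)).map T.upkV)
  else if Challenge L s m then
    Val.ofList [P.encGh T.d T.C₁, P.encG T.d (T.C₂ (m.tl.toSet L)), T.ck]
  else (T.query L s m).elim Val.nil fun c => T.decAns L m c.1 c.2

open Classical in
def nextCore (s : Core) (m : Val) : Core :=
  if s.ph = 0 then ⟨1, m, s.S₁⟩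
  else if s.ph = 1 then ⟨2, s.S₀, s.S₁⟩
  else if Challenge L s m then ⟨3, s.S₀, m.tl⟩
  else s

/-- Two arguments of `H₁` with the value of the challenge. -/
def Coll (m : Val) (c₁ : (P.grp T.d).Gh) : Prop :=
  T.ω c₁ m.qaux.toBits = T.ω T.C₁ [] ∧ ¬ (c₁ = T.C₁ ∧ m.qaux = Val.nil)

/-- A valid ciphertext with the first component of the challenge. -/
def Hit (m : Val) (c : (P.grp T.d).Gh × (P.grp T.d).G) : Prop :=
  c.1 = T.C₁ ∧ m.qaux = Val.nil ∧ T.Valid (m.qset L) (T.ω c.1 m.qaux.toBits) c.1 c.2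

-- `rec₁` and `rec₂` hold the latest exceptional query, `ev` the first one. `ev` serves only the
-- analysis and is not part of `encState`. `rec₂` stores the component sent by the adversary beside
-- the one that the table computes for the same set; in the second simulation the two differ by a
-- factor `g^(±a t)`.
open Classical in
def next (s : Full) (m : Val) : Full where
  core := nextCore L s.core m
  rec₁ := (T.query L s.core m).elim s.rec₁ fun c =>
    if T.Coll m c.1 then Val.node m.qc₁ m.qaux else s.rec₁
  rec₂ := (T.query L s.core m).elim s.rec₂ fun c =>
    if T.Hit L m c ∧ decide (T.k + 1 ∈ m.qset L) ≠ T.b then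
      Val.node m.qc₂ (P.encG T.d (T.C₂ (m.qset L))) else s.rec₂
  ev := (T.query L s.core m).elim s.ev fun c =>
    if s.ev = none ∧ T.Hit L m c then
      some (m.qset L, if 2 < s.core.ph then some (s.core.S₁.toSet L) else none) else s.ev

/-- The table as seen by programs. -/
def enc (aux : Val) : Val := Val.ofList [
  P.descVal T.d, P.encKey1 n T.d T.κ₁, P.encKey2 n T.d T.κ₂, T.ppV,
  Val.ofList ((List.range' 1 L).map T.upkV),
  P.encG T.d T.AL, P.encG T.d T.B,
  Val.ofList ((List.range' 1 L).map fun j => P.encG T.d (T.TF j)),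
  P.encGh T.d T.gh, P.encGh T.d T.C₁, P.encG T.d T.cB,
  Val.ofList ((List.range' 1 L).map fun j => P.encG T.d (T.Tc j)),
  T.ck, P.encGh T.d T.X, P.encG T.d T.q,
  Val.ofList ((List.range' 1 L).map fun j => P.encG T.d (T.Tq j)),
  (P.grp T.d).encScalar T.u₁, (P.grp T.d).encScalar T.u₀, Val.ofNat T.k, Val.ofBool T.b, aux]

def encState (aux : Val) (s : Full) : Val :=
  Val.node (T.enc L aux) (Val.node (Val.ofNat s.core.ph) (Val.node s.core.S₀ (Val.node s.core.S₁
    (Val.node s.rec₁ s.rec₂))))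

end Tab

/-! ## The challenger as a program -/

namespace Val

def fld (v : Val) : ℕ → Val
  | 0 => v.hd
  | i + 1 => v.tl.fld i

def subset (L : ℕ) (a b : Val) : Val :=
  fold (cap L) (fun i acc => cond (and (get L a i) (not (get L b i))) nil acc) (ofNat L)
    (node nil nil)

/-- The first two conjuncts express `1 ≤ i ≤ L` for the numeral `i`; user `i` is at position `i -
1`, hence `i.tl`. -/
def memSet (L : ℕ) (i S : Val) : Val :=
  and (and i (not (dropBy L (ofNat L) i))) (get L S i.tl)

theorem mem_toSet {L j : ℕ} {S : Val} :
    j ∈ S.toSet L ↔ 1 ≤ j ∧ j ≤ L ∧ (S.toList.getD (j - 1) nil).toBool = true := by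
  simp [toSet, and_assoc]

theorem succ_mem_toSet {L i : ℕ} {S : Val} :
    i + 1 ∈ S.toSet L ↔ i < L ∧ (S.toList.getD i nil).toBool = true := by
  simp [mem_toSet]

theorem toBool_get {L i : ℕ} (hi : i < L) (S : Val) :
    (get L S (ofNat i)).toBool = true ↔ i + 1 ∈ S.toSet L := by
  rw [get_ofNat (by rw [cap]; omega), succ_mem_toSet]
  simp [hi]

theorem toBool_subset (L : ℕ) (a b : Val) :
    (subset L a b).toBool = true ↔ a.toSet L ⊆ b.toSet L := by
  rw [subset, fold_ofNat (by rw [cap]; omega)]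
  have : ∀ l : List ℕ, (∀ i ∈ l, i < L) → ((l.foldr (fun i acc => cond (and (get L a (ofNat i))
      (not (get L b (ofNat i)))) nil acc) (node nil nil)).toBool = true ↔
      ∀ i ∈ l, i + 1 ∈ a.toSet L → i + 1 ∈ b.toSet L) := by
    intro l hl
    induction l with
    | nil => simp
    | cons i l ih =>
      have ih := ih fun i hi => hl i (List.mem_cons_of_mem _ hi)
      have ha := toBool_get (hl i List.mem_cons_self) a
      have hb := toBool_get (hl i List.mem_cons_self) b
      rw [List.foldr_cons, cond_def, List.forall_mem_cons, ← ih, ← ha, ← hb, toBool_and,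
        toBool_not]
      cases (get L a (ofNat i)).toBool <;> cases (get L b (ofNat i)).toBool <;> simp
  rw [this _ fun i hi => List.mem_range.mp hi]
  constructor
  · intro h j hj
    obtain ⟨h₁, h₂, -⟩ := mem_toSet.mp hj
    obtain ⟨i, rfl⟩ : ∃ i, j = i + 1 := ⟨j - 1, by omega⟩
    exact h i (List.mem_range.mpr (by omega)) hj
  · intro h i _ hi
    exact h hi

theorem toBool_memSet (L : ℕ) (i S : Val) :
    (memSet L i S).toBool = true ↔ i.len ∈ S.toSet L := by
  rw [memSet, toBool_and, toBool_and, toBool_not, dropBy_eq (by rw [len_ofNat, cap]; omega),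
    len_ofNat, mem_toSet]
  have hz : ∀ v : Val, v.toBool = true ↔ 1 ≤ v.len := by intro v; cases v <;> simp
  by_cases h : i.len ≤ L
  · have h₀ : (tl^[L] i).toBool = false := by
      rw [← Bool.not_eq_true, hz, tl_iterate_len]
      omega
    have h₁ : i.tl.len = i.len - 1 := by cases i <;> simp
    rw [get_eq (by rw [h₁, cap]; omega), h₀, h₁]
    simp [hz, h]
  · have h₀ : (tl^[L] i).toBool = true := by
      rw [hz, tl_iterate_len]
      omega
    simp [h₀, h]

end Val

instance Feas.fld {P : PairingSystem} {f : ℕ → ℕ → Val → Val} [hf : Feas P f] (i : ℕ) :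
    Feas P fun n L v => (f n L v).fld i := by
  induction i generalizing f with
  | zero => unfold Val.fld; infer_instance
  | succ i ih => unfold Val.fld; infer_instance

section Programs

variable (P : PairingSystem)

open Prim

/-- `acc * ∏ j ∈ S, T j`. -/
def prodV (L : ℕ) (D S T acc : Val) : Val :=
  Val.fold (cap L) (fun i acc => Val.cond (Val.get L S i) (mulG.det P [D, acc, Val.get L T i]) acc)
    (Val.ofNat L) acc

variable {P} in
theorem getD_map_range' {α : Type} (a L i : ℕ) (hi : i < L) (f : ℕ → α) (x : α) :
    (((List.range' a L).map f).getD i x) = f (a + i) := by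
  rw [List.getD_eq_getElem _ _ (by simpa using hi)]
  simp

variable {P} in
theorem prodV_eq (L : ℕ) (d : P.Desc) (S : Val) (t : ℕ → (P.grp d).G) (a : (P.grp d).G) :
    prodV P L (P.descVal d) S (Val.ofList ((List.range' 1 L).map fun j => P.encG d (t j)))
      (P.encG d a) = P.encG d (a * ∏ j ∈ S.toSet L, t j) := by
  classical
  rw [prodV, Val.fold_ofNat (by rw [cap]; omega)]
  have : ∀ l : List ℕ, l.Nodup → (∀ i ∈ l, i < L) → l.foldr (fun i acc =>
      Val.cond (Val.get L S (Val.ofNat i)) (mulG.det P [P.descVal d, acc,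
        Val.get L (Val.ofList ((List.range' 1 L).map fun j => P.encG d (t j))) (Val.ofNat i)]) acc)
      (P.encG d a) = P.encG d (a * ∏ i ∈ l.toFinset with i + 1 ∈ S.toSet L, t (i + 1)) := by
    intro l hn hl
    induction l with
    | nil => simp
    | cons i l ih =>
      have hi := hl i List.mem_cons_self
      rw [List.nodup_cons] at hn
      rw [List.foldr_cons, ih hn.2 fun i hi => hl i (List.mem_cons_of_mem _ hi), Val.cond_def,
        Val.get_ofNat (v := Val.ofList _) (by rw [cap]; omega), Val.toList_ofList,
        getD_map_range' _ _ _ hi, det_mulG, List.toFinset_cons, Finset.filter_insert]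
      simp only [Val.toBool_get hi]
      split_ifs with h
      · rw [Finset.prod_insert (by simp [hn.1]), add_comm 1 i]
        congr 1
        rw [mul_assoc]
        congr 1
        exact mul_comm _ _
      · rfl
  rw [this _ List.nodup_range fun i hi => List.mem_range.mp hi]
  congr 2
  -- List positions count from `0`, users from `1`.
  refine Finset.prod_nbij (· + 1) ?_ ?_ ?_ ?_
  · intro i hi
    exact (Finset.mem_filter.mp hi).2
  · intro i _ j _ h
    simpa using h
  · intro j hj
    obtain ⟨h₁, h₂, -⟩ := Val.mem_toSet.mp hj
    refine ⟨j - 1, ?_, by simp; omega⟩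
    simp only [Finset.coe_filter, List.mem_toFinset, List.mem_range, Set.mem_ofPred_eq]
    rw [show j - 1 + 1 = j by omega]
    exact ⟨by omega, hj⟩
  · intro i _
    rfl

instance Feas.prodV {P : PairingSystem} {a b c e : ℕ → ℕ → Val → Val} [Feas P a] [Feas P b]
    [Feas P c] [Feas P e] :
    Feas P fun n L v => DBE.prodV P L (a n L v) (b n L v) (c n L v) (e n L v) := by
  have : Feas P fun n L x => DBE.prodV P L x.hd x.tl.hd x.tl.tl.hd x.tl.tl.tl := by
    unfold DBE.prodV
    infer_instance
  exact Feas.comp' this (g := fun n L v => .node (a n L v) (.node (b n L v)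
    (.node (c n L v) (e n L v)))) inferInstance

instance Feas.subset {P : PairingSystem} {a b : ℕ → ℕ → Val → Val} [Feas P a] [Feas P b] :
    Feas P fun n L v => Val.subset L (a n L v) (b n L v) := by
  have : Feas P fun n L x => Val.subset L x.hd x.tl := by
    unfold Val.subset
    infer_instance
  exact Feas.comp' this (g := fun n L v => .node (a n L v) (b n L v)) inferInstance

instance Feas.memSet {P : PairingSystem} {a b : ℕ → ℕ → Val → Val} [Feas P a] [Feas P b] :
    Feas P fun n L v => Val.memSet L (a n L v) (b n L v) := by
  unfold Val.memSet
  infer_instance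

end Programs

end DBE
end

/-! ### The program that computes answers and next states from the encoded table -/

noncomputable section
namespace DBE

section Handler

variable (P : PairingSystem)

open Prim Val

/-- Components of a message `x.hd` together with the state of the challenger `x.tl`. -/
def Val.ph (x : Val) : Val := x.tl.tl.hd
def Val.set₀ (x : Val) : Val := x.tl.tl.tl.hd
def Val.set₁ (x : Val) : Val := x.tl.tl.tl.tl.hd
def Val.rec₁ (x : Val) : Val := x.tl.tl.tl.tl.tl.hd
def Val.rec₂ (x : Val) : Val := x.tl.tl.tl.tl.tl.tl
-- The index refers to the order of the entries in `Tab.enc`.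
def Val.tb (x : Val) (i : ℕ) : Val := x.tl.hd.fld i

instance Feas.qc₁ {f : ℕ → ℕ → Val → Val} [Feas P f] : Feas P fun n L v => (f n L v).qc₁ := by
  unfold Val.qc₁; infer_instance
instance Feas.qc₂ {f : ℕ → ℕ → Val → Val} [Feas P f] : Feas P fun n L v => (f n L v).qc₂ := by
  unfold Val.qc₂; infer_instance
instance Feas.quser {f : ℕ → ℕ → Val → Val} [Feas P f] : Feas P fun n L v => (f n L v).quser := by
  unfold Val.quser; infer_instance
instance Feas.qaux {f : ℕ → ℕ → Val → Val} [Feas P f] : Feas P fun n L v => (f n L v).qaux := by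
  unfold Val.qaux; infer_instance
instance Feas.ph {f : ℕ → ℕ → Val → Val} [Feas P f] : Feas P fun n L v => (f n L v).ph := by
  unfold Val.ph; infer_instance
instance Feas.set₀ {f : ℕ → ℕ → Val → Val} [Feas P f] : Feas P fun n L v => (f n L v).set₀ := by
  unfold Val.set₀; infer_instance
instance Feas.set₁ {f : ℕ → ℕ → Val → Val} [Feas P f] : Feas P fun n L v => (f n L v).set₁ := by
  unfold Val.set₁; infer_instance
instance Feas.rec₁ {f : ℕ → ℕ → Val → Val} [Feas P f] : Feas P fun n L v => (f n L v).rec₁ := by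
  unfold Val.rec₁; infer_instance
instance Feas.rec₂ {f : ℕ → ℕ → Val → Val} [Feas P f] : Feas P fun n L v => (f n L v).rec₂ := by
  unfold Val.rec₂; infer_instance
instance Feas.tb {f : ℕ → ℕ → Val → Val} [Feas P f] (i : ℕ) :
    Feas P fun n L v => (f n L v).tb i := by
  unfold Val.tb; infer_instance

def ωV (n _L : ℕ) (x : Val) : Val :=
  hash1.det P [ofNat n, x.tb 0, x.tb 1, x.hd.qc₁, x.hd.qaux]

instance : Feas P (ωV P) := by unfold ωV; infer_instance

def FV (n L : ℕ) (x : Val) : Val :=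
  prodV P L (x.tb 0) x.hd.tl.hd (x.tb 7)
    (mulG.det P [x.tb 0, powG.det P [x.tb 0, x.tb 5, ωV P n L x], x.tb 6])

instance : Feas P (FV P) := by unfold FV; infer_instance

def validV (n L : ℕ) (x : Val) : Val :=
  beq (pair.det P [x.tb 0, x.hd.qc₂, x.tb 8]) (pair.det P [x.tb 0, FV P n L x, x.hd.qc₁])

instance : Feas P (validV P) := by unfold validV; infer_instance

def C₂V (L : ℕ) (x S : Val) : Val := prodV P L (x.tb 0) S (x.tb 11) (x.tb 10)

instance {f g : ℕ → ℕ → Val → Val} [Feas P f] [Feas P g] :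
    Feas P fun n L x => C₂V P L (f n L x) (g n L x) := by
  unfold C₂V; infer_instance

def ansV (n L : ℕ) (x : Val) : Val :=
  powGT.det P [x.tb 0, mulGT.det P [x.tb 0, pair.det P [x.tb 0, x.hd.qc₂, x.tb 13],
      pair.det P [x.tb 0, prodV P L (x.tb 0) x.hd.tl.hd (x.tb 15) (x.tb 14), x.hd.qc₁]],
    scalarInv.det P [x.tb 0, scalarAdd.det P [x.tb 0,
      scalarMul.det P [x.tb 0, x.tb 16, ωV P n L x], x.tb 17]]]

instance : Feas P (ansV P) := by unfold ansV; infer_instance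

def decV (n L : ℕ) (x : Val) : Val :=
  cond (validV P n L x)
    (node nil (hash2.det P [ofNat n, x.tb 0, x.tb 2, ansV P n L x])) nil

instance : Feas P (decV P) := by unfold decV; infer_instance

/-- The phase is a unary numeral, so `x.ph.tl.tl` is a true bit exactly if the phase exceeds `2`,
that is, after the challenge. -/
def forbV (L : ℕ) (x : Val) : Val :=
  and x.ph.tl.tl (and (beq x.hd.qc₁ (x.tb 9)) (beq x.hd.qc₂ (C₂V P L x x.set₁)))

def admV (L : ℕ) (x : Val) : Val :=
  and (and x.ph.tl x.hd.hd) (and (and (isGh.det P [x.tb 0, x.hd.qc₁])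
    (isG.det P [x.tb 0, x.hd.qc₂])) (and (subset L x.hd.tl.hd x.set₀)
      (and (memSet L x.hd.quser x.hd.tl.hd) (not (forbV P L x)))))

instance : Feas P fun _ L x => admV P L x := by unfold admV forbV; infer_instance

def chalV (L : ℕ) (x : Val) : Val :=
  and (not x.ph.tl.tl) (and (not x.hd.hd) (subset L x.hd.tl x.set₀))

instance : Feas P fun _ L x => chalV L x := by unfold chalV; infer_instance

def hitV (n L : ℕ) (x : Val) : Val :=
  and (and (beq x.hd.qc₁ (x.tb 9)) (not x.hd.qaux)) (validV P n L x)

instance : Feas P (hitV P) := by unfold hitV; infer_instance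

def collV (n L : ℕ) (x : Val) : Val :=
  and (beq (ωV P n L x) (hash1.det P [ofNat n, x.tb 0, x.tb 1, x.tb 9, nil]))
    (not (and (beq x.hd.qc₁ (x.tb 9)) (not x.hd.qaux)))

instance : Feas P (collV P) := by unfold collV; infer_instance

/-- Membership of the selected user. -/
def selV (L : ℕ) (x : Val) : Val := memSet L (node nil (x.tb 18)) x.hd.tl.hd

instance : Feas P fun _ L x => selV L x := by unfold selV; infer_instance

def answerV (n L : ℕ) (x : Val) : Val :=
  cond (not x.ph) (x.tb 3)
    (cond (not x.ph.tl)
      (build L (fun i => get L x.set₀ i) (fun i => get L (x.tb 4) i) (ofNat L))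
      (cond (chalV L x)
        (ofList [x.tb 9, C₂V P L x x.hd.tl, x.tb 12])
        (cond (admV P L x) (decV P n L x) nil)))

instance : Feas P (answerV P) := by unfold answerV; infer_instance

def nextV (n L : ℕ) (x : Val) : Val :=
  node x.tl.hd (node
    (cond (not x.ph) (ofNat 1) (cond (not x.ph.tl) (ofNat 2) (cond (chalV L x) (ofNat 3) x.ph)))
    (node (cond (not x.ph) x.hd x.set₀)
      (node (cond (and x.ph.tl (chalV L x)) x.hd.tl x.set₁)
        (node (cond (and (admV P L x) (collV P n L x)) (node x.hd.qc₁ x.hd.qaux) x.rec₁)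
          (cond (and (admV P L x) (and (hitV P n L x) (not (beq (cond (selV L x) (node nil nil) nil)
              (x.tb 19)))))
            (node x.hd.qc₂ (C₂V P L x x.hd.tl.hd)) x.rec₂)))))

instance : Feas P fun _ _ _ => ofNat 1 := by simp only [ofNat_succ, ofNat_zero]; infer_instance
instance : Feas P fun _ _ _ => ofNat 2 := by simp only [ofNat_succ, ofNat_zero]; infer_instance
instance : Feas P fun _ _ _ => ofNat 3 := by simp only [ofNat_succ, ofNat_zero]; infer_instance

instance : Feas P (nextV P) := by unfold nextV; infer_instance

/-- The program of the challenger, on a message and a state. -/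
def handlerV (n L : ℕ) (x : Val) : Val := node (answerV P n L x) (nextV P n L x)

instance feas_handlerV : Feas P (handlerV P) := by unfold handlerV; infer_instance

theorem Val.cond_eq_ite {c : Val} {p : Prop} [Decidable p] (h : c.toBool = true ↔ p) (a b : Val) :
    cond c a b = if p then a else b := if_congr h rfl rfl

variable {P} {n : ℕ} (T : Tab P n) (L : ℕ) (aux m : Val) (s : Full)

local notation "x₀" => node m (Tab.encState T L aux s)

theorem ωV_eq {c₁ : (P.grp T.d).Gh} (h : m.qc₁ = P.encGh T.d c₁) :
    ωV P n L x₀ = (P.grp T.d).encScalar (T.ω c₁ m.qaux.toBits) := by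
  have : ωV P n L x₀ = hash1.det P [ofNat n, P.descVal T.d, P.encKey1 n T.d T.κ₁, m.qc₁, m.qaux] :=
    rfl
  rw [this, h, det_hash1]
  rfl

theorem C₂V_eq (S : Val) : C₂V P L x₀ S = P.encG T.d (T.C₂ (S.toSet L)) :=
  prodV_eq L T.d S T.Tc T.cB

theorem toBool_validV {c₁ : (P.grp T.d).Gh} {c₂ : (P.grp T.d).G} (h₁ : m.qc₁ = P.encGh T.d c₁)
    (h₂ : m.qc₂ = P.encG T.d c₂) : (validV P n L x₀).toBool = true ↔
      T.Valid (m.qset L) (T.ω c₁ m.qaux.toBits) c₁ c₂ := by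
  have hF : FV P n L x₀ = P.encG T.d (T.F (m.qset L) (T.ω c₁ m.qaux.toBits)) := by
    have : FV P n L x₀ = prodV P L (P.descVal T.d) m.tl.hd
        (ofList ((List.range' 1 L).map fun j => P.encG T.d (T.TF j)))
        (mulG.det P [P.descVal T.d, powG.det P [P.descVal T.d, P.encG T.d T.AL, ωV P n L x₀],
          P.encG T.d T.B]) := rfl
    rw [this, ωV_eq T L aux m s h₁, det_powG, det_mulG, prodV_eq]
    rfl
  have : validV P n L x₀ = beq (pair.det P [P.descVal T.d, m.qc₂, P.encGh T.d T.gh])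
    (pair.det P [P.descVal T.d, FV P n L x₀, m.qc₁]) := rfl
  rw [this, hF, h₁, h₂, det_pair, det_pair, toBool_beq, (P.encGT_inj T.d).eq_iff]
  rfl

theorem decV_eq {c₁ : (P.grp T.d).Gh} {c₂ : (P.grp T.d).G} (h₁ : m.qc₁ = P.encGh T.d c₁)
    (h₂ : m.qc₂ = P.encG T.d c₂) : decV P n L x₀ = T.decAns L m c₁ c₂ := by
  have hans : ansV P n L x₀ =
      P.encGT T.d (T.ans (m.qset L) (T.ω c₁ m.qaux.toBits) c₁ c₂) := by
    have : ansV P n L x₀ = powGT.det P [P.descVal T.d, mulGT.det P [P.descVal T.d,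
        pair.det P [P.descVal T.d, m.qc₂, P.encGh T.d T.X],
        pair.det P [P.descVal T.d, prodV P L (P.descVal T.d) m.tl.hd
          (ofList ((List.range' 1 L).map fun j => P.encG T.d (T.Tq j))) (P.encG T.d T.q), m.qc₁]],
      scalarInv.det P [P.descVal T.d, scalarAdd.det P [P.descVal T.d,
        scalarMul.det P [P.descVal T.d, (P.grp T.d).encScalar T.u₁, ωV P n L x₀],
        (P.grp T.d).encScalar T.u₀]]] := rfl
    rw [this, ωV_eq T L aux m s h₁, h₁, h₂, prodV_eq, det_pair, det_pair, det_mulGT,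
      det_scalarMul, det_scalarAdd, det_scalarInv, det_powGT]
    rfl
  have : decV P n L x₀ = cond (validV P n L x₀) (node nil (hash2.det P [ofNat n,
    P.descVal T.d, P.encKey2 n T.d T.κ₂, ansV P n L x₀])) nil := rfl
  classical
  rw [this, hans, det_hash2, cond_eq_ite (toBool_validV T L aux m s h₁ h₂), Tab.decAns]

theorem partialInv_eq_some {α : Type} {f : α → Val} (hf : Function.Injective f) {v : Val} {a : α} :
    Function.partialInv f v = some a ↔ f a = v :=
  hf.isPartialInv a v

variable {T L m s} in
theorem Tab.query_eq_some {c₁ : (P.grp T.d).Gh} {c₂ : (P.grp T.d).G} :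
    T.query L s.core m = some (c₁, c₂) ↔ 2 ≤ s.core.ph ∧ m.hd.toBool = true ∧
      m.qc₁ = P.encGh T.d c₁ ∧ m.qc₂ = P.encG T.d c₂ ∧ m.qset L ⊆ s.core.S₀.toSet L ∧
      m.quser.len ∈ m.qset L ∧
      ¬ (2 < s.core.ph ∧ c₁ = T.C₁ ∧ c₂ = T.C₂ (s.core.S₁.toSet L)) := by
  rw [Tab.query]
  by_cases h : 2 ≤ s.core.ph ∧ m.hd.toBool = true
  · rw [if_pos h]
    have e₁ : ∀ a, P.encGh T.d a = m.qc₁ ↔ Function.partialInv (P.encGh T.d) m.qc₁ = some a :=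
      fun a => (partialInv_eq_some (P.encGh_inj T.d)).symm
    have e₂ : ∀ a, P.encG T.d a = m.qc₂ ↔ Function.partialInv (P.encG T.d) m.qc₂ = some a :=
      fun a => (partialInv_eq_some (P.encG_inj T.d)).symm
    rw [eq_comm (a := m.qc₁), eq_comm (a := m.qc₂), e₁, e₂]
    cases h₁ : Function.partialInv (P.encGh T.d) m.qc₁ with
    | none => simp
    | some a =>
      cases h₂ : Function.partialInv (P.encG T.d) m.qc₂ with
      | none => simp
      | some b =>
        simp only [Option.ite_none_right_eq_some, Option.some.injEq, Prod.mk.injEq]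
        constructor
        · rintro ⟨h₃, rfl, rfl⟩
          exact ⟨h.1, h.2, rfl, rfl, h₃⟩
        · rintro ⟨-, -, rfl, rfl, h₃⟩
          exact ⟨h₃, rfl, rfl⟩
  · rw [if_neg h]
    constructor
    · intro h; cases h
    · rintro ⟨h₁, h₂, -⟩
      exact absurd ⟨h₁, h₂⟩ h

theorem toBool_pos (v : Val) : v.toBool = true ↔ 1 ≤ v.len := by cases v <;> simp

theorem len_tl (v : Val) : v.tl.len = v.len - 1 := by cases v <;> simp

theorem admV_iff : (admV P L x₀).toBool = true ↔ (T.query L s.core m).isSome = true := by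
  have : admV P L x₀ = and (and (ofNat s.core.ph).tl m.hd)
    (and (and (isGh.det P [P.descVal T.d, m.qc₁]) (isG.det P [P.descVal T.d, m.qc₂]))
      (and (subset L m.tl.hd s.core.S₀) (and (memSet L m.quser m.tl.hd)
        (not (and (ofNat s.core.ph).tl.tl (and (beq m.qc₁ (P.encGh T.d T.C₁))
          (beq m.qc₂ (C₂V P L x₀ s.core.S₁)))))))) := rfl
  rw [this, C₂V_eq, det_isGh, det_isG]
  simp only [toBool_and, Bool.and_eq_true, toBool_ofBool, toBool_subset, toBool_memSet,
    toBool_not, Bool.not_eq_true', ← Bool.not_eq_true, toBool_beq]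
  simp only [toBool_pos (ofNat _).tl, toBool_pos (ofNat _).tl.tl, len_tl, len_ofNat]
  constructor
  · rintro ⟨⟨h₁, h₂⟩, ⟨h₃, h₄⟩, h₅, h₆, h₇⟩
    obtain ⟨c₁, h₃⟩ := Option.isSome_iff_exists.mp h₃
    obtain ⟨c₂, h₄⟩ := Option.isSome_iff_exists.mp h₄
    rw [partialInv_eq_some (P.encGh_inj _)] at h₃
    rw [partialInv_eq_some (P.encG_inj _)] at h₄
    rw [← h₃, ← h₄, (P.encGh_inj _).eq_iff, (P.encG_inj _).eq_iff] at h₇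
    exact Option.isSome_iff_exists.mpr ⟨(c₁, c₂), Tab.query_eq_some.mpr
      ⟨by omega, h₂, h₃.symm, h₄.symm, h₅, h₆, fun h => h₇ ⟨by omega, h.2⟩⟩⟩
  · intro h
    obtain ⟨⟨c₁, c₂⟩, h⟩ := Option.isSome_iff_exists.mp h
    obtain ⟨h₁, h₂, h₃, h₄, h₅, h₆, h₇⟩ := Tab.query_eq_some.mp h
    rw [h₃, h₄, (P.encGh_inj _).eq_iff, (P.encG_inj _).eq_iff]
    simp only [partialInv_encGh, partialInv_encG, Option.isSome_some, and_self, true_and]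
    exact ⟨⟨by omega, h₂⟩, h₅, h₆, fun h => h₇ ⟨by omega, h.2⟩⟩

theorem chalV_iff (hp : 2 ≤ s.core.ph) :
    (chalV L x₀).toBool = true ↔ Tab.Challenge L s.core m := by
  have : chalV L x₀ = and (not (ofNat s.core.ph).tl.tl) (and (not m.hd)
    (subset L m.tl s.core.S₀)) := rfl
  rw [this, Tab.Challenge]
  simp only [toBool_and, Bool.and_eq_true, toBool_subset, toBool_not, Bool.not_eq_true']
  rw [← Bool.not_eq_true (ofNat _).tl.tl.toBool, toBool_pos, len_tl, len_tl, len_ofNat]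
  refine and_congr ?_ Iff.rfl
  omega

theorem answerV_eq : answerV P n L x₀ = T.answer L s.core m := by
  have : answerV P n L x₀ = cond (not (ofNat s.core.ph)) T.ppV
    (cond (not (ofNat s.core.ph).tl)
      (build L (fun i => get L s.core.S₀ i)
        (fun i => get L (ofList ((List.range' 1 L).map T.upkV)) i) (ofNat L))
      (cond (chalV L x₀) (ofList [P.encGh T.d T.C₁, C₂V P L x₀ m.tl, T.ck])
        (cond (admV P L x₀) (decV P n L x₀) nil))) := rfl
  rw [this, Tab.answer]
  rcases h₀ : s.core.ph with _ | _ | k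
  · simp [Val.not]
  · simp only [ofNat_succ, ofNat_zero, Val.not, cond_node, tl_node, cond_nil]
    rw [if_neg (by omega), if_pos trivial, build_ofNat (by rw [cap]; omega)]
    congr 1
    have e : List.range' 1 L = (List.range L).map (1 + ·) := by
      rw [List.range'_eq_map_range]
    conv_rhs => rw [e, List.filter_map, List.map_map]
    refine (List.map_congr_left fun i hi => ?_).trans (congrArg _ (List.filter_congr fun i hi => ?_))
    · rw [List.mem_filter, List.mem_range] at hi
      rw [get_ofNat (by rw [cap]; omega), toList_ofList, getD_map_range' _ _ _ hi.1]
      rfl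
    · rw [List.mem_range] at hi
      have := toBool_get hi s.core.S₀
      rw [Bool.eq_iff_iff, this]
      simp [add_comm]
  · have hp : 2 ≤ s.core.ph := by omega
    simp only [ofNat_succ, Val.not, cond_node, tl_node, cond_nil]
    rw [if_neg (by omega), if_neg (by omega), C₂V_eq]
    classical
    rw [cond_eq_ite (chalV_iff T L aux m s hp)]
    refine ite_congr rfl (fun _ => rfl) fun _ => ?_
    rw [cond_def]
    have := admV_iff T L aux m s
    cases hq : T.query L s.core m with
    | none => rw [hq] at this; rw [if_neg (by simpa using this)]; rfl
    | some c =>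
      rw [hq] at this
      obtain ⟨-, -, h₃, h₄, -⟩ := Tab.query_eq_some.mp hq
      rw [if_pos (by simpa using this), decV_eq T L aux m s h₃ h₄]
      rfl

theorem nextV_eq : nextV P n L x₀ = T.encState L aux (T.next L s m) := by
  have : nextV P n L x₀ = node (T.enc L aux) (node
    (cond (not (ofNat s.core.ph)) (ofNat 1) (cond (not (ofNat s.core.ph).tl) (ofNat 2)
      (cond (chalV L x₀) (ofNat 3) (ofNat s.core.ph))))
    (node (cond (not (ofNat s.core.ph)) m s.core.S₀)
      (node (cond (and (ofNat s.core.ph).tl (chalV L x₀)) m.tl s.core.S₁)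
        (node (cond (and (admV P L x₀) (collV P n L x₀)) (node m.qc₁ m.qaux) s.rec₁)
          (cond (and (admV P L x₀) (and (hitV P n L x₀)
              (not (beq (cond (selV L x₀) (node nil nil) nil) (ofBool T.b)))))
            (node m.qc₂ (C₂V P L x₀ m.tl.hd)) s.rec₂))))) := rfl
  have e : T.encState L aux (T.next L s m) = node (T.enc L aux)
      (node (ofNat (Tab.nextCore L s.core m).ph) (node (Tab.nextCore L s.core m).S₀
        (node (Tab.nextCore L s.core m).S₁ (node (T.next L s m).rec₁ (T.next L s m).rec₂)))) := rfl
  rw [this, e]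
  have hcore : ∀ a b c : Val, (a = ofNat (Tab.nextCore L s.core m).ph ∧
      b = (Tab.nextCore L s.core m).S₀ ∧ c = (Tab.nextCore L s.core m).S₁) → ∀ d d' e e' : Val,
      d = d' → e = e' →
      node (T.enc L aux) (node a (node b (node c (node d e)))) = node (T.enc L aux)
      (node (ofNat (Tab.nextCore L s.core m).ph) (node (Tab.nextCore L s.core m).S₀
        (node (Tab.nextCore L s.core m).S₁ (node d' e')))) := by
    rintro _ _ _ ⟨rfl, rfl, rfl⟩ d d' e e' rfl rfl
    rfl
  classical
  refine hcore _ _ _ ?_ _ _ _ _ ?_ ?_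
  · rw [Tab.nextCore]
    rcases h₀ : s.core.ph with _ | _ | k
    · simp [Val.not, Val.and]
    · simp [Val.not, Val.and, ofNat_succ]
    · have hp : 2 ≤ s.core.ph := by omega
      have := chalV_iff T L aux m s hp
      rw [if_neg (by omega), if_neg (by omega)]
      simp only [ofNat_succ, Val.not, cond_node, tl_node, cond_nil, Val.and]
      classical
      rw [cond_eq_ite this, cond_eq_ite this]
      split_ifs <;> simp [h₀, ofNat_succ]
  · have := admV_iff T L aux m s
    simp only [Tab.next]
    cases hq : T.query L s.core m with
    | none =>
      rw [hq] at this
      rw [cond_def, toBool_and, if_neg (by simp_all)]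
      rfl
    | some c =>
      obtain ⟨-, -, h₃, h₄, -⟩ := Tab.query_eq_some.mp hq
      have e : collV P n L x₀ = and (beq (ωV P n L x₀) (hash1.det P [ofNat n, P.descVal T.d,
        P.encKey1 n T.d T.κ₁, P.encGh T.d T.C₁, nil]))
          (not (and (beq m.qc₁ (P.encGh T.d T.C₁)) (not m.qaux))) := rfl
      have hc : (collV P n L x₀).toBool = true ↔ T.Coll m c.1 := by
        rw [e, ωV_eq T L aux m s h₃, det_hash1, h₃]
        simp only [toBool_and, Bool.and_eq_true, toBool_beq, toBool_not, Bool.not_eq_true',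
          ← Bool.not_eq_true, (P.encGh_inj _).eq_iff, (BilinearGroup.encScalar_inj _).eq_iff,
          toBool_pos m.qaux, Tab.Coll, ← len_eq_zero (v := m.qaux)]
        refine and_congr Iff.rfl (not_congr (and_congr Iff.rfl ?_))
        omega
      have hA : (admV P L x₀).toBool = true := by rw [this, hq]; rfl
      rw [Option.elim_some]
      exact Val.cond_eq_ite (by rw [toBool_and, hA, Bool.true_and, hc]) _ _
  · have := admV_iff T L aux m s
    simp only [Tab.next]
    cases hq : T.query L s.core m with
    | none =>
      rw [hq] at this
      rw [cond_def, toBool_and, if_neg (by simp_all)]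
      rfl
    | some c =>
      obtain ⟨-, -, h₃, h₄, -⟩ := Tab.query_eq_some.mp hq
      have e : hitV P n L x₀ = and (and (beq m.qc₁ (P.encGh T.d T.C₁)) (not m.qaux))
          (validV P n L x₀) := rfl
      have hc : (hitV P n L x₀).toBool = true ↔ T.Hit L m c := by
        rw [e]
        simp only [toBool_and, Bool.and_eq_true, toBool_beq, toBool_not, Bool.not_eq_true',
          ← Bool.not_eq_true, toBool_pos m.qaux, Tab.Hit, toBool_validV T L aux m s h₃ h₄]
        rw [h₃, (P.encGh_inj _).eq_iff, ← len_eq_zero, and_assoc]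
        refine and_congr Iff.rfl (and_congr ?_ Iff.rfl)
        omega
      have hs : (selV L x₀).toBool = true ↔ T.k + 1 ∈ m.qset L := by
        have : selV L x₀ = memSet L (node nil (ofNat T.k)) m.tl.hd := rfl
        rw [this, toBool_memSet, len_node, len_ofNat]
        rfl
      have hb : (not (beq (cond (selV L x₀) (node nil nil) nil) (ofBool T.b))).toBool = true ↔
          decide (T.k + 1 ∈ m.qset L) ≠ T.b := by
        rw [toBool_not, Bool.not_eq_true', ← Bool.not_eq_true, toBool_beq, cond_eq_ite hs]
        have : ∀ p [Decidable p], (if p then node nil nil else nil) = ofBool (decide p) := by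
          intro p _
          by_cases hp : p <;> simp [hp, ofBool]
        rw [this]
        exact not_congr ⟨ofBool_inj, congrArg _⟩
      have hA : (admV P L x₀).toBool = true := by rw [this, hq]; rfl
      rw [Option.elim_some, C₂V_eq]
      exact Val.cond_eq_ite (by rw [toBool_and, hA, Bool.true_and, toBool_and, Bool.and_eq_true, hc,
        hb]) _ _

/-- The handler depends on the table only through its encoding. The same compiled program therefore
plays the real challenger and both simulators; a reduction only has to prepare the right initial
state. -/
theorem handlerV_eq :
    handlerV P n L x₀ = node (T.answer L s.core m) (T.encState L aux (T.next L s m)) := by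
  rw [handlerV, answerV_eq, nextV_eq]

end Handler

end DBE
end

noncomputable section
namespace DBE

/-! ## Changing the environment of an adversary -/

section Environments

variable {P : PairingSystem} {σ τ : Type} {h : σ → Val → PMF (Val × σ)}
  {h' : τ → Val → PMF (Val × τ)}

def Config.withEnv (s : Config σ) (t : τ) : Config τ := ⟨s.mem, t, s.time⟩

/-- The state of the environment is refined by the kernel `R`. -/
def refine (R : σ → PMF τ) (s : Config σ) : PMF (Config τ) := (R s.env).map s.withEnv

theorem refine_set (R : σ → PMF τ) (s : Config σ) (x : ℕ) (v : Val) :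
    refine R (s.set x v) = (refine R s).map fun s => s.set x v := by
  rw [refine, refine, PMF.map_comp]; rfl

theorem refine_bind {α : Type} (R : σ → PMF τ) (s : Config σ) (f : Config τ → PMF α) :
    (refine R s).bind f = (R s.env).bind fun t => f (s.withEnv t) := by
  rw [refine, PMF.bind_map]; rfl

theorem iterate_bind_comm {α β : Type} {f : α → PMF α} {g : β → PMF β} {φ : α → PMF β}
    (hf : ∀ a, (f a).bind φ = (φ a).bind g) (k : ℕ) (a : α) :
    (iterate f k a).bind φ = (φ a).bind (iterate g k) := by
  induction k generalizing a with
  | zero => simp only [iterate, PMF.pure_bind]; exact (PMF.bind_pure _).symm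
  | succ k ih =>
    simp only [iterate, PMF.bind_bind, ih]
    rw [← PMF.bind_bind, hf, PMF.bind_bind]

/-- The hypothesis is a commuting square for a single query: answering by `h` and then refining
equals refining and then answering by `h'`. A deterministic `R` translates or forgets parts of the
state; a random `R` expresses deferred sampling. -/
theorem run_refine (R : σ → PMF τ) (hR : ∀ s v, ((h s v).bind fun r =>
      (R r.2).map fun t => (r.1, t)) = (R s).bind fun t => h' t v) (c : Prog) (s : Config σ) :
    (c.run P h s).bind (refine R) = (refine R s).bind (c.run P h') := by
  induction c generalizing s with
  | skip => simp only [Prog.run, PMF.pure_bind, refine_bind]; rfl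
  | seq a b iha ihb => simp only [Prog.run, PMF.bind_bind, ihb]; rw [← PMF.bind_bind, iha,
      PMF.bind_bind]
  | clear x => simp only [Prog.run, PMF.pure_bind, refine_set, refine_bind]; rw [PMF.map, refine_bind]; rfl
  | copy x y => simp only [Prog.run, PMF.pure_bind, refine_set, refine_bind]; rw [PMF.map, refine_bind]; rfl
  | cons x y z => simp only [Prog.run, PMF.pure_bind, refine_set, refine_bind]; rw [PMF.map, refine_bind]; rfl
  | hd x y => simp only [Prog.run, PMF.pure_bind, refine_set, refine_bind]; rw [PMF.map, refine_bind]; rfl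
  | tl x y => simp only [Prog.run, PMF.pure_bind, refine_set, refine_bind]; rw [PMF.map, refine_bind]; rfl
  | eq x y z => simp only [Prog.run, PMF.pure_bind, refine_set, refine_bind]; rw [PMF.map, refine_bind]; rfl
  | flip x =>
    simp only [Prog.run, PMF.bind_map, refine_bind, Function.comp_def, refine_set]
    simp only [PMF.map, refine_bind]
    rw [PMF.bind_comm]
    rfl
  | call x f ys =>
    simp only [Prog.run, PMF.bind_map, refine_bind, Function.comp_def, refine_set]
    simp only [PMF.map, refine_bind]
    rw [PMF.bind_comm]
    rfl
  | query x y =>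
    have := congrArg (PMF.map fun r : Val × τ => (⟨(s.set x r.1).mem, r.2, (s.set x r.1).time⟩ :
      Config τ)) (hR s.env (s.mem y))
    simp only [PMF.map_bind, PMF.map_comp] at this
    simp only [Prog.run, PMF.bind_map, refine_bind]
    exact this
  | ite x a b iha ihb =>
    simp only [Prog.run, refine_bind]
    by_cases hx : (s.mem x).toBool = true
    · simp only [Config.withEnv, hx, if_true]
      exact (iha _).trans (refine_bind _ _ _)
    · simp only [Config.withEnv, hx]
      exact (ihb _).trans (refine_bind _ _ _)
  | loop x a ih =>
    simp only [Prog.run, refine_bind]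
    exact (iterate_bind_comm ih _ _).trans (refine_bind _ _ _)

theorem run_closed {D : σ → Prop} (hD : ∀ s v, D s → ∀ r ∈ (h s v).support, D r.2) (c : Prog) :
    ∀ s : Config σ, D s.env → ∀ s' ∈ (c.run P h s).support, D s'.env := by
  have pure : ∀ s s' : Config σ, D s'.env → ∀ t ∈ (PMF.pure s').support, D t.env := by
    intro s s' hs t ht
    rw [PMF.mem_support_pure_iff] at ht
    rwa [ht]
  induction c with
  | skip => intro s hs; exact pure s _ hs
  | seq a b iha ihb =>
    intro s hs s' hs'
    obtain ⟨s₁, h₁, h₂⟩ := (PMF.mem_support_bind_iff _ _ _).mp hs'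
    exact ihb s₁ (iha s hs s₁ h₁) s' h₂
  | clear x => intro s hs; exact pure s _ hs
  | copy x y => intro s hs; exact pure s _ hs
  | cons x y z => intro s hs; exact pure s _ hs
  | hd x y => intro s hs; exact pure s _ hs
  | tl x y => intro s hs; exact pure s _ hs
  | eq x y z => intro s hs; exact pure s _ hs
  | flip x =>
    intro s hs s' hs'
    obtain ⟨b, -, rfl⟩ := (PMF.mem_support_map_iff _ _ _).mp hs'
    exact hs
  | call x f ys =>
    intro s hs s' hs'
    obtain ⟨b, -, rfl⟩ := (PMF.mem_support_map_iff _ _ _).mp hs'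
    exact hs
  | query x y =>
    intro s hs s' hs'
    obtain ⟨r, hr, rfl⟩ := (PMF.mem_support_map_iff _ _ _).mp hs'
    exact hD _ _ hs r hr
  | ite x a b iha ihb =>
    intro s hs s' hs'
    simp only [Prog.run] at hs'
    split_ifs at hs'
    · exact iha s.tick hs s' hs'
    · exact ihb s.tick hs s' hs'
  | loop x a ih =>
    intro s hs s' hs'
    simp only [Prog.run] at hs'
    have : ∀ k (s : Config σ), D s.env → ∀ s' ∈ (iterate (a.run P h) k s).support, D s'.env := by
      intro k
      induction k with
      | zero => exact fun s hs => pure s _ hs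
      | succ k ihk =>
        intro s hs s' hs'
        obtain ⟨s₁, h₁, h₂⟩ := (PMF.mem_support_bind_iff _ _ _).mp hs'
        exact ihk s₁ (ih s hs s₁ h₁) s' h₂
    exact this _ s.tick hs s' hs'

/-- Two environments that behave in the same way until `D` or `D'` happens. -/
theorem run_until {G : σ → τ → Prop} {D : σ → Prop} {D' : τ → Prop}
    (hD : ∀ s v, D s → ∀ r ∈ (h s v).support, D r.2)
    (hD' : ∀ s v, D' s → ∀ r ∈ (h' s v).support, D' r.2)
    (hG : ∀ s t v, G s t → Coupled (fun r r' => (r.1 = r'.1 ∧ G r.2 r'.2) ∨ D r.2 ∨ D' r'.2)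
      (h s v) (h' t v)) (c : Prog) :
    ∀ (s : Config σ) (t : Config τ), (s.mem = t.mem ∧ G s.env t.env) ∨ D s.env ∨ D' t.env →
      Coupled (fun s t => (s.mem = t.mem ∧ G s.env t.env) ∨ D s.env ∨ D' t.env)
        (c.run P h s) (c.run P h' t) := by
  -- A failure event persists on the side where it happened, so after it the independent coupling is
  -- good enough.
  have bad : ∀ (c : Prog) (s : Config σ) (t : Config τ), D s.env ∨ D' t.env →
      Coupled (fun s t => (s.mem = t.mem ∧ G s.env t.env) ∨ D s.env ∨ D' t.env)
        (c.run P h s) (c.run P h' t) := by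
    intro c s t hst
    refine (Coupled.prod _ _).mono fun s' t' h' => Or.inr ?_
    exact hst.imp (fun hs => run_closed hD c s hs s' h'.1) (fun ht => run_closed hD' c t ht t' h'.2)
  have det : ∀ (s : Config σ) (t : Config τ) (x : ℕ) (v : Val), s.mem = t.mem ∧ G s.env t.env →
      ((s.set x v).mem = (t.set x v).mem ∧ G (s.set x v).env (t.set x v).env) := by
    intro s t x v hst
    exact ⟨by simp only [Config.set, hst.1], hst.2⟩
  induction c with
  | skip =>
    intro s t hst
    rcases hst with hst | hst
    · exact Coupled.pure (Or.inl hst)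
    · exact bad _ s t hst
  | seq a b iha ihb => intro s t hst; exact (iha s t hst).bind ihb
  | clear x =>
    intro s t hst
    rcases hst with hst | hst
    · exact Coupled.pure (Or.inl (det s t x _ hst))
    · exact bad (.clear x) s t hst
  | copy x y =>
    intro s t hst
    rcases hst with hst | hst
    · simp only [Prog.run, hst.1]
      exact Coupled.pure (Or.inl (det s t x _ hst))
    · exact bad (.copy x y) s t hst
  | cons x y z =>
    intro s t hst
    rcases hst with hst | hst
    · simp only [Prog.run, hst.1]
      exact Coupled.pure (Or.inl (det s t x _ hst))
    · exact bad (.cons x y z) s t hst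
  | hd x y =>
    intro s t hst
    rcases hst with hst | hst
    · simp only [Prog.run, hst.1]
      exact Coupled.pure (Or.inl (det s t x _ hst))
    · exact bad (.hd x y) s t hst
  | tl x y =>
    intro s t hst
    rcases hst with hst | hst
    · simp only [Prog.run, hst.1]
      exact Coupled.pure (Or.inl (det s t x _ hst))
    · exact bad (.tl x y) s t hst
  | eq x y z =>
    intro s t hst
    rcases hst with hst | hst
    · obtain ⟨sm, se, st⟩ := s
      obtain ⟨tm, te, tt⟩ := t
      obtain ⟨rfl : sm = tm, h₂⟩ := hst
      exact Coupled.pure (Or.inl (det _ _ x _ ⟨rfl, h₂⟩))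
    · exact bad (.eq x y z) s t hst
  | flip x =>
    intro s t hst
    rcases hst with hst | hst
    · refine (Coupled.refl _).map ?_
      rintro b _ ⟨rfl, -⟩
      exact Or.inl (det s t x _ hst)
    · exact bad (.flip x) s t hst
  | call x f ys =>
    intro s t hst
    rcases hst with hst | hst
    · simp only [Prog.run, hst.1]
      refine (Coupled.refl _).map ?_
      rintro b _ ⟨rfl, -⟩
      exact Or.inl (det s t x _ hst)
    · exact bad (.call x f ys) s t hst
  | query x y =>
    intro s t hst
    rcases hst with hst | hst
    · simp only [Prog.run, hst.1]
      refine (hG s.env t.env (t.mem y) hst.2).map ?_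
      rintro r r' (⟨h₁, h₂⟩ | h₃)
      · exact Or.inl ⟨by simp only [Config.set, hst.1, h₁], h₂⟩
      · exact Or.inr h₃
    · exact bad (.query x y) s t hst
  | ite x a b iha ihb =>
    intro s t hst
    rcases hst with hst | hst
    · simp only [Prog.run, hst.1]
      split_ifs
      · exact iha _ _ (Or.inl hst)
      · exact ihb _ _ (Or.inl hst)
    · exact bad (.ite x a b) s t hst
  | loop x a ih =>
    intro s t hst
    rcases hst with hst | hst
    · simp only [Prog.run, hst.1]
      exact Coupled.iterate (R := fun _ (s : Config σ) (t : Config τ) =>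
        (s.mem = t.mem ∧ G s.env t.env) ∨ D s.env ∨ D' t.env)
        (fun _ s t hst => ih s t hst) _ 0 s.tick t.tick (Or.inl hst)
    · exact bad (.loop x a) s t hst

end Environments

/-! ## The games of table-driven challengers -/

section Games

variable {P : PairingSystem} {n : ℕ} (T : Tab P n) (L : ℕ)

def Tab.handler (s : Full) (m : Val) : PMF (Val × Full) :=
  PMF.pure (T.answer L s.core m, T.next L s m)

/-- The interaction of an adversary with a table-driven challenger. -/
def Tab.game (A : Prog) : PMF (Config Full) :=
  A.run P (T.handler L) (Config.start n L Val.nil Full.init)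

theorem refine_pure {σ τ : Type} (f : σ → τ) (s : Config σ) :
    refine (fun s => PMF.pure (f s)) s = PMF.pure (s.withEnv (f s.env)) := PMF.pure_map _ _

/-- Encoding the state is a deterministic refinement, which forgets `ev`. -/
theorem run_handlerV {H : Fn} (hH : ∀ n L v, H.den P n L v = PMF.pure (handlerV P n L v))
    (A : Prog) (aux : Val) :
    A.run P (H.handler P n L) (Config.start n L Val.nil (T.encState L aux Full.init)) =
      (T.game L A).map fun s => s.withEnv (T.encState L aux s.env) := by
  have := run_refine (P := P) (h := T.handler L) (h' := H.handler P n L)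
    (fun s => PMF.pure (T.encState L aux s)) (fun s v => by
      simp only [Tab.handler, PMF.pure_bind, PMF.pure_map, Fn.handler, hH, handlerV_eq,
        Val.hd_node, Val.tl_node]) A (Config.start n L Val.nil Full.init)
  rw [refine_pure, PMF.pure_bind, funext (refine_pure _)] at this
  exact this.symm

end Games

end DBE
end

noncomputable section
namespace DBE

/-! ## Exponents in groups of prime order -/

/-- Exponents live in `ZMod p` and act through `val`. The class lets the laws for such exponents be
proved once for `G`, `Gh` and `GT`. -/
class ExpGroup (p : outParam ℕ) (X : Type) extends CommGroup X where
  pow_card : ∀ x : X, x ^ p = 1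
  pos : 0 < p

namespace BilinearGroup

variable (𝔹 : BilinearGroup)

instance : ExpGroup 𝔹.p 𝔹.G := ⟨fun x => by rw [← 𝔹.card_G]; exact pow_card_eq_one, 𝔹.prime.pos⟩
instance : ExpGroup 𝔹.p 𝔹.Gh :=
  ⟨fun x => by rw [← 𝔹.card_Gh]; exact pow_card_eq_one, 𝔹.prime.pos⟩
instance : ExpGroup 𝔹.p 𝔹.GT :=
  ⟨fun x => by rw [← 𝔹.card_GT]; exact pow_card_eq_one, 𝔹.prime.pos⟩
instance : Fact 𝔹.p.Prime := ⟨𝔹.prime⟩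

end BilinearGroup

section Exponents

variable {p : ℕ} {X : Type} [ExpGroup p X] (x : X)

theorem pow_val_natCast (k : ℕ) : x ^ (k : ZMod p).val = x ^ k := by
  rw [ZMod.val_natCast]
  exact (pow_eq_pow_mod k (ExpGroup.pow_card x)).symm

theorem pow_val_eq {a : ZMod p} {k : ℕ} (h : (k : ZMod p) = a) : x ^ a.val = x ^ k := by
  rw [← h, pow_val_natCast]

theorem ExpGroup.cast_val (X : Type) [ExpGroup p X] (a : ZMod p) : ((a.val : ℕ) : ZMod p) = a := by
  have : NeZero p := ⟨(ExpGroup.pos (X := X)).ne'⟩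
  exact ZMod.natCast_zmod_val a

theorem pow_val_add (a b : ZMod p) : x ^ (a + b).val = x ^ a.val * x ^ b.val := by
  rw [pow_val_eq x (k := a.val + b.val), pow_add]
  rw [Nat.cast_add, ExpGroup.cast_val X, ExpGroup.cast_val X]

theorem pow_val_mul (a b : ZMod p) : x ^ (a * b).val = (x ^ a.val) ^ b.val := by
  rw [pow_val_eq x (k := a.val * b.val), pow_mul]
  rw [Nat.cast_mul, ExpGroup.cast_val X, ExpGroup.cast_val X]

theorem pow_val_zero : x ^ (0 : ZMod p).val = 1 := by
  rw [pow_val_eq x (k := 0) (by simp), pow_zero]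

theorem pow_val_one : x ^ (1 : ZMod p).val = x := by
  rw [pow_val_eq x (k := 1) (by simp), pow_one]

theorem pow_val_neg (a : ZMod p) : x ^ (-a).val = (x ^ a.val)⁻¹ := by
  rw [eq_inv_iff_mul_eq_one, ← pow_val_add, neg_add_cancel, pow_val_zero]

theorem pow_val_sum {ι : Type} (S : Finset ι) (f : ι → ZMod p) :
    x ^ (∑ j ∈ S, f j).val = ∏ j ∈ S, x ^ (f j).val := by
  classical
  induction S using Finset.induction_on with
  | empty => simp
  | insert j S hj ih => rw [Finset.sum_insert hj, Finset.prod_insert hj, pow_val_add, ih]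

end Exponents

namespace BilinearGroup

variable (𝔹 : BilinearGroup)

theorem e_pow_left (g : 𝔹.G) (h : 𝔹.Gh) (k : ℕ) : 𝔹.e (g ^ k) h = 𝔹.e g h ^ k := by
  rw [map_pow, MonoidHom.pow_apply]

theorem e_pow_right (g : 𝔹.G) (h : 𝔹.Gh) (k : ℕ) : 𝔹.e g (h ^ k) = 𝔹.e g h ^ k := map_pow _ _ _

theorem e_pow_pow (g : 𝔹.G) (h : 𝔹.Gh) (a b : ZMod 𝔹.p) :
    𝔹.e (g ^ a.val) (h ^ b.val) = 𝔹.e g h ^ (a * b).val := by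
  rw [e_pow_left, e_pow_right, pow_val_mul, ← pow_mul, ← pow_mul, mul_comm]

theorem pow_surjective {X : Type} [ExpGroup 𝔹.p X] [Fintype X] (hX : Fintype.card X = 𝔹.p)
    {g : X} (hg : g ≠ 1) (x : X) : ∃ a : ZMod 𝔹.p, g ^ a.val = x := by
  have h := mem_powers_of_prime_card (p := 𝔹.p) (g := g) (g' := x)
    (by rw [Nat.card_eq_fintype_card]; exact hX) hg
  obtain ⟨k, hk⟩ := Submonoid.mem_powers_iff x g |>.mp h
  exact ⟨(k : ZMod 𝔹.p), by rw [pow_val_natCast]; exact hk⟩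

theorem pow_injective {X : Type} [ExpGroup 𝔹.p X] [Fintype X] (hX : Fintype.card X = 𝔹.p)
    {g : X} (hg : g ≠ 1) : Function.Injective fun a : ZMod 𝔹.p => g ^ a.val := by
  have h : Function.Surjective fun a : ZMod 𝔹.p => g ^ a.val := 𝔹.pow_surjective hX hg
  exact ((Fintype.bijective_iff_surjective_and_card _).mpr ⟨h, by rw [ZMod.card, hX]⟩).1

/-- Since `g` and `h` generate their groups, the value `1` would make the whole pairing trivial. -/
theorem e_ne_one {g : 𝔹.G} {h : 𝔹.Gh} (hg : g ≠ 1) (hh : h ≠ 1) : 𝔹.e g h ≠ 1 := by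
  obtain ⟨x, y, hxy⟩ := 𝔹.nondegenerate
  obtain ⟨a, rfl⟩ := 𝔹.pow_surjective 𝔹.card_G hg x
  obtain ⟨b, rfl⟩ := 𝔹.pow_surjective 𝔹.card_Gh hh y
  intro h1
  rw [e_pow_pow, h1, one_pow, orderOf_one] at hxy
  exact 𝔹.prime.one_lt.ne hxy

theorem e_left_injective {h : 𝔹.Gh} (hh : h ≠ 1) {x y : 𝔹.G} (hxy : 𝔹.e x h = 𝔹.e y h) :
    x = y := by
  by_contra hne
  apply 𝔹.e_ne_one (g := x * y⁻¹) (by rwa [Ne, mul_inv_eq_one]) hh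
  rw [map_mul, map_inv, MonoidHom.mul_apply, MonoidHom.inv_apply, hxy, mul_inv_cancel]

open Classical in
theorem mem_support_randGenerator {X : Type} [Group X] [Fintype X] {h : 1 < Fintype.card X}
    {x : X} (hx : x ∈ (randGenerator h).support) : x ≠ 1 := by
  rw [randGenerator, PMF.mem_support_uniformOfFinset_iff] at hx
  exact (Finset.mem_filter.mp hx).2

theorem randScalar_shift (c : ZMod 𝔹.p) : 𝔹.randScalar.map (· + c) = 𝔹.randScalar := by
  ext x
  rw [randScalar, PMF.map_apply, tsum_eq_single (x - c)]
  · simp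
  · intro y hy
    rw [if_neg]
    rintro rfl
    exact hy (by simp)

theorem randScalar_map_pow {X : Type} [ExpGroup 𝔹.p X] [Fintype X] (hX : Fintype.card X = 𝔹.p)
    {g : X} (hg : g ≠ 1) (hne : (Finset.univ : Finset X).Nonempty) :
    𝔹.randScalar.map (fun a => g ^ a.val) = PMF.uniformOfFinset Finset.univ hne := by
  ext x
  obtain ⟨a, rfl⟩ := 𝔹.pow_surjective hX hg x
  rw [randScalar, PMF.map_apply, tsum_eq_single a]
  · rw [PMF.uniformOfFinset_apply_of_mem _ (Finset.mem_univ _)]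
    simp [hX, ZMod.card]
  · intro y hy
    rw [if_neg]
    exact fun h => hy (𝔹.pow_injective hX hg h.symm)

end BilinearGroup

end DBE
end

noncomputable section
namespace DBE

/-! ## The experiment with all random choices made in advance -/

section Eager

variable {P : PairingSystem} {n L : ℕ}

/-- The random choices of `setup`. -/
structure Par (P : PairingSystem) (n : ℕ) where
  d : P.Desc
  g : (P.grp d).G
  gh : (P.grp d).Gh
  α : ZMod (P.grp d).p
  β : ZMod (P.grp d).p
  κ₁ : P.Key1 n d
  κ₂ : P.Key2 n d

/-- All random choices of the challenger. -/
structure Theta (P : PairingSystem) (n : ℕ) extends Par P n where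
  γ : ℕ → ZMod (P.grp d).p
  t : ZMod (P.grp d).p
  R : (P.grp d).GT

variable (L) in
def Par.A (x : Par P n) (k : ℕ) : (P.grp x.d).G :=
  if k = L + 2 then 1 else x.g ^ (x.α ^ k).val

variable (L) in
@[reducible] def Par.pp (x : Par P n) : PP P n L where
  d := x.d
  g := x.g
  gh := x.gh
  A := x.A L
  Ah := fun k => x.gh ^ (x.α ^ k).val
  B := x.g ^ x.β.val
  Bs := fun k => (x.g ^ (x.α ^ k).val) ^ x.β.val
  Ω := (P.grp x.d).e (x.g ^ (x.α ^ (L + 2)).val) x.gh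
  κ₁ := x.κ₁
  κ₂ := x.κ₂

variable (L) in
def Par.keys (x : Par P n) (i : ℕ) (γ : ZMod (P.grp x.d).p) :
    USK (P.grp x.d) × UPK (P.grp x.d) :=
  ({ K := x.A L (L + 2 - i) ^ γ.val },
   { V := x.g ^ γ.val
     Vh := x.gh ^ γ.val
     W := fun k => if k = L + 2 - i then 1 else x.A L k ^ γ.val })

def Theta.ω (x : Theta P n) : ZMod (P.grp x.d).p := P.H1 n x.d x.κ₁ (x.gh ^ x.t.val) []

variable (L) in
/-- The challenger of the experiment. -/
@[reducible] def Theta.real (x : Theta P n) (μ : Bool) : Tab P n where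
  d := x.d
  κ₁ := x.κ₁
  κ₂ := x.κ₂
  ppV := (x.pp L).enc
  upkV := fun j => (x.pp L).encUPK j (x.keys L j (x.γ j)).2
  AL := x.g ^ (x.α ^ (L + 1)).val
  B := x.g ^ x.β.val
  TF := fun j => x.g ^ (x.α ^ j + x.γ j).val
  gh := x.gh
  C₁ := x.gh ^ x.t.val
  cB := x.g ^ ((x.α ^ (L + 1) * x.ω + x.β) * x.t).val
  Tc := fun j => x.g ^ ((x.α ^ j + x.γ j) * x.t).val
  ck := Val.ofBits (P.H2 n x.d x.κ₂ (if μ then x.R else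
    (P.grp x.d).e x.g x.gh ^ (x.α ^ (L + 2) * x.t).val)).toList
  -- With this choice the general decryption formula becomes `e (g ^ α^(L+2)) C₁`; by `decaps_eq`
  -- that is what honest decryption returns on valid ciphertexts. The values of `k` and `b` only
  -- affect `rec₂` and are arbitrary here.
  X := 1
  q := x.g ^ (x.α ^ (L + 2)).val
  Tq := fun _ => 1
  u₁ := 0
  u₀ := 1
  k := 0
  b := false

variable (P n) in
def parDist : PMF (Par P n) := do
  let d ← P.gen n
  let g ← (P.grp d).randG
  let gh ← (P.grp d).randGh
  let α ← (P.grp d).randScalar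
  let β ← (P.grp d).randScalar
  let κ₁ ← P.genKey1 n d
  let κ₂ ← P.genKey2 n d
  PMF.pure ⟨d, g, gh, α, β, κ₁, κ₂⟩

/-- Independent random scalars with the listed indices. -/
def BilinearGroup.randFun (𝔹 : BilinearGroup) : List ℕ → PMF (ℕ → ZMod 𝔹.p)
  | [] => PMF.pure 0
  | i :: l => 𝔹.randScalar.bind fun x => (𝔹.randFun l).map fun f => Function.update f i x

variable (L) in
def Par.keyDist (x : Par P n) : PMF (ℕ → ZMod (P.grp x.d).p) :=
  (P.grp x.d).randFun (List.range' 1 L)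

def Par.encDist (x : Par P n) (γ : ℕ → ZMod (P.grp x.d).p) : PMF (Theta P n) :=
  (P.grp x.d).randScalar.bind fun t => (P.grp x.d).randGT.map fun R => ⟨x, γ, t, R⟩

variable (P n L) in
def thetaDist : PMF (Theta P n) :=
  (parDist P n).bind fun x => (x.keyDist L).bind fun γ => x.encDist γ

/-- Exponents may be drawn for all listed users and ignored outside the committed set. This removes
the dependence of the sampling on the set that the adversary chooses. -/
theorem genKeys_filter (x : Par P n) (Q : ℕ → Prop) [DecidablePred Q] (l : List ℕ) :
    genKeys (x.pp L) (l.filter Q) = ((P.grp x.d).randFun l).map fun γ j =>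
      if j ∈ l.filter Q then x.keys L j (γ j) else (⟨1⟩, ⟨1, 1, fun _ => 1⟩) := by
  induction l with
  | nil =>
    simp only [List.filter_nil, genKeys, BilinearGroup.randFun, PMF.pure_map, List.not_mem_nil,
      if_false]
  | cons i l ih =>
    simp only [BilinearGroup.randFun, PMF.map_bind, PMF.map_comp]
    by_cases hi : Q i
    · rw [List.filter_cons_of_pos (by simpa using hi), genKeys]
      have hk : genKey (x.pp L) i = (P.grp x.d).randScalar.map fun γ => x.keys L i γ := rfl
      rw [hk]
      refine (PMF.bind_map _ _ _).trans ?_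
      congr 1
      funext y
      show (genKeys (x.pp L) (l.filter Q)).bind _ = _
      rw [ih]
      refine (PMF.bind_map _ _ _).trans ?_
      show (_ : PMF _).bind _ = PMF.bind _ _
      congr 1
      funext γ
      refine congrArg PMF.pure (funext fun j => ?_)
      by_cases hj : j = i
      · subst hj
        refine (Function.update_self ..).trans ?_
        refine Eq.trans ?_ (if_pos List.mem_cons_self).symm
        exact (congrArg (x.keys L j) (Function.update_self j y γ)).symm
      · refine (Function.update_of_ne hj _ _).trans ?_
        simp [hj]
    · rw [List.filter_cons_of_neg (by simpa using hi), ih]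
      -- An excluded user contributes a scalar that is never read.
      conv_lhs => rw [← PMF.bind_const (P.grp x.d).randScalar (PMF.map _ _)]
      congr 1
      funext y
      congr 1
      funext γ j
      have : ∀ j, j ∈ l.filter Q → j ≠ i := by
        rintro j hj rfl
        simp only [List.mem_filter, decide_eq_true_eq] at hj
        exact hi hj.2
      simp only [Function.comp_apply]
      split_ifs with h
      · rw [Function.update_of_ne (this j h)]
      · rfl

theorem base_eq (x : Theta P n) (μ : Bool) {upk : ℕ → UPK (P.grp x.d)} {S : Finset ℕ}
    (hS : S ⊆ Finset.Icc 1 L) (hupk : ∀ j ∈ S, upk j = (x.keys L j (x.γ j)).2)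
    (ω : ZMod (P.grp x.d).p) : base (x.pp L) upk S ω = (x.real L μ).F S ω := by
  have h : ∀ j ∈ S, x.A L j * (upk j).V =
      x.g ^ (x.α ^ j + x.γ j).val := by
    intro j hj
    have := Finset.mem_Icc.mp (hS hj)
    rw [hupk j hj, pow_val_add]
    show (if j = L + 2 then 1 else x.g ^ (x.α ^ j).val) * x.g ^ (x.γ j).val = _
    rw [if_neg (by omega)]
  have h' : (∏ j ∈ S, x.A L j * (upk j).V) =
      ∏ j ∈ S, x.g ^ (x.α ^ j + x.γ j).val := Finset.prod_congr rfl h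
  show (if L + 1 = L + 2 then 1 else x.g ^ (x.α ^ (L + 1)).val) ^ ω.val * x.g ^ x.β.val *
    (∏ j ∈ S, x.A L j * (upk j).V) = _
  rw [if_neg (by omega), h']
  rfl

theorem F_eq (x : Theta P n) (μ : Bool) (S : Finset ℕ) (ω : ZMod (P.grp x.d).p) :
    (x.real L μ).F S ω =
      x.g ^ (x.α ^ (L + 1) * ω + x.β + ∑ j ∈ S, (x.α ^ j + x.γ j)).val := by
  rw [pow_val_add, pow_val_add, pow_val_mul, pow_val_sum]
  rfl

theorem ans_eq (x : Theta P n) (μ : Bool) (S : Finset ℕ) (ω : ZMod (P.grp x.d).p)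
    (c₁ : (P.grp x.d).Gh) (c₂ : (P.grp x.d).G) :
    (x.real L μ).ans S ω c₁ c₂ = (P.grp x.d).e x.g c₁ ^ (x.α ^ (L + 2)).val := by
  show ((P.grp x.d).e c₂ 1 * (P.grp x.d).e (x.g ^ (x.α ^ (L + 2)).val * ∏ j ∈ S, 1) c₁) ^
    ((0 * ω + 1 : ZMod (P.grp x.d).p)⁻¹).val = _
  rw [zero_mul, zero_add, inv_one, pow_val_one, map_one, one_mul, Finset.prod_const_one, mul_one,
    BilinearGroup.e_pow_left]

-- By validity `e(C₂, D̂₂) = e(F^(α^(L+2-i) + r), C₁)`. The factor `F^r` of `D₁` cancels `r`. In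
-- `α^(L+2-i)` times the exponent of `F`, the key `K_i` accounts for `γ_i`, `D₃` for `ω` and `β`,
-- and `D₄` for the users other than `i`; only `α^(L+2-i) α^i = α^(L+2)` survives. The answer thus
-- depends neither on `i` nor on `r`.
open Classical in
theorem decaps_eq (x : Theta P n) (μ : Bool) {upk : ℕ → UPK (P.grp x.d)} {S : Finset ℕ}
    (hS : S ⊆ Finset.Icc 1 L) (hupk : ∀ j ∈ S, upk j = (x.keys L j (x.γ j)).2) {i : ℕ}
    (hi : i ∈ S) (c : Header (P.grp x.d)) (au : List Bool) :
    decaps (x.pp L) upk S c i (x.keys L i (x.γ i)).1 au =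
      PMF.pure (if (x.real L μ).Valid S ((x.real L μ).ω c.C₁ au) c.C₁ c.C₂ then
        some (P.H2 n x.d x.κ₂ ((x.real L μ).ans S ((x.real L μ).ω c.C₁ au) c.C₁ c.C₂))
        else none) := by
  have hiL := Finset.mem_Icc.mp (hS hi)
  have hb := base_eq (L := L) x μ hS hupk (P.H1 n x.d x.κ₁ c.C₁ au)
  have hω : (x.real L μ).ω c.C₁ au = P.H1 n x.d x.κ₁ c.C₁ au := rfl
  rw [hω]
  unfold decaps
  rw [if_neg (not_not.mpr hi)]
  by_cases hv : (x.real L μ).Valid S (P.H1 n x.d x.κ₁ c.C₁ au) c.C₁ c.C₂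
  · have hv' : (P.grp x.d).e c.C₂ x.gh =
        (P.grp x.d).e ((x.real L μ).F S (P.H1 n x.d x.κ₁ c.C₁ au)) c.C₁ := hv
    rw [if_pos hv, if_neg (by rw [not_not]; exact hv'.trans (by rw [← hb]))]
    refine Eq.trans ?_ (PMF.bind_const (P.grp x.d).randScalar _)
    refine congrArg (PMF.bind (P.grp x.d).randScalar) ?_
    funext (r : ZMod (P.grp x.d).p)
    refine congrArg (fun z => PMF.pure (some (P.H2 n x.d x.κ₂ z))) ?_
    rw [F_eq] at hv'
    rw [ans_eq]
    have hb' : base (x.pp L) upk S (P.H1 n (x.pp L).d (x.pp L).κ₁ c.C₁ au) = _ := hb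
    rw [hb', F_eq]
    have hW : (∏ j ∈ S.erase i, x.A L (L + 2 - i + j) *
        (upk j).W (L + 2 - i)) =
        x.g ^ (∑ j ∈ S.erase i, x.α ^ (L + 2 - i) * (x.α ^ j + x.γ j)).val := by
      rw [pow_val_sum]
      refine Finset.prod_congr rfl fun j hj => ?_
      obtain ⟨hji, hj⟩ := Finset.mem_erase.mp hj
      have := Finset.mem_Icc.mp (hS hj)
      rw [hupk j hj]
      -- No default value is met: `i ≠ j`, and `L + 2 - i` lies between `2` and `L + 1`.
      show (if L + 2 - i + j = L + 2 then 1 else x.g ^ (x.α ^ (L + 2 - i + j)).val) *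
        (if L + 2 - i = L + 2 - j then 1 else
          (if L + 2 - i = L + 2 then 1 else x.g ^ (x.α ^ (L + 2 - i)).val) ^ (x.γ j).val) = _
      rw [if_neg (by omega), if_neg (by omega), if_neg (by omega), ← pow_val_mul, ← pow_val_add,
        mul_add, pow_add]
    have h₁ : x.α ^ (2 * L + 3 - i) = x.α ^ (L + 2 - i) * x.α ^ (L + 1) := by
      rw [← pow_add]; congr 1; omega
    have h₂ : x.α ^ (L + 2) = x.α ^ (L + 2 - i) * x.α ^ i := by
      rw [← pow_add]; congr 1; omega
    show (P.grp x.d).e c.C₂ (x.gh ^ (x.α ^ (L + 2 - i)).val * x.gh ^ r.val) *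
      ((P.grp x.d).e ((if L + 2 - i = L + 2 then 1 else x.g ^ (x.α ^ (L + 2 - i)).val) ^
          (x.γ i).val * (x.g ^ (x.α ^ (L + 1) * P.H1 n x.d x.κ₁ c.C₁ au + x.β + ∑ j ∈ S, (x.α ^ j + x.γ j)).val) ^
          r.val *
        ((if 2 * L + 3 - i = L + 2 then 1 else x.g ^ (x.α ^ (2 * L + 3 - i)).val) ^ (P.H1 n x.d x.κ₁ c.C₁ au).val *
          (x.g ^ (x.α ^ (L + 2 - i)).val) ^ x.β.val) *
        ∏ j ∈ S.erase i, x.A L (L + 2 - i + j) *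
          (upk j).W (L + 2 - i)) c.C₁)⁻¹ = _
    generalize P.H1 n x.d x.κ₁ c.C₁ au = ω at hv'
    rw [hW, if_neg (by omega), if_neg (by omega), map_mul, BilinearGroup.e_pow_right,
      BilinearGroup.e_pow_right, hv']
    simp only [BilinearGroup.e_pow_left, ← pow_val_mul, ← pow_val_add, ← pow_val_neg]
    congr 2
    have hs := Finset.add_sum_erase S (fun j => x.α ^ j + x.γ j) hi
    rw [← hs, ← Finset.mul_sum, h₁, h₂]
    ring
  · rw [if_neg hv, if_pos]
    intro h
    refine hv (h.trans ?_)
    rw [← hb]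

end Eager

end DBE
end

/-! ### Deferred sampling of keys and challenge randomness -/

noncomputable section
namespace DBE

section Lazy

variable {P : PairingSystem} {n L : ℕ}

theorem toSet_subset (v : Val) : v.toSet L ⊆ Finset.Icc 1 L := Finset.filter_subset _ _

open Classical in
theorem decryptionOracle_eq (x : Theta P n) (μ : Bool) (s : Core) (hs : 2 ≤ s.ph)
    (keys : ℕ → USK (P.grp x.d) × UPK (P.grp x.d))
    (hkeys : ∀ j ∈ s.S₀.toSet L, keys j = x.keys L j (x.γ j)) (m : Val)
    (hm : m.hd.toBool = true) (o : Option (Header (P.grp x.d)))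
    (ho : ∀ c : Header (P.grp x.d), o ≠ some c ↔
      ¬ (2 < s.ph ∧ c.C₁ = (x.real L μ).C₁ ∧ c.C₂ = (x.real L μ).C₂ (s.S₁.toSet L))) :
    decryptionOracle (s.S₀.toSet L) (x.pp L) keys o m.tl =
      PMF.pure (((x.real L μ).query L s m).elim Val.nil fun c =>
        (x.real L μ).decAns L m c.1 c.2) := by
  have hsome : ∀ {c₁ : (P.grp x.d).Gh} {c₂ : (P.grp x.d).G},
      (x.real L μ).query L s m = some (c₁, c₂) ↔ _ :=
    fun {c₁ c₂} => Tab.query_eq_some (T := x.real L μ) (s := ⟨s, Val.nil, Val.nil, none⟩)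
  have e₁ : ∀ a, m.qc₁ = P.encGh x.d a ↔ Function.partialInv (P.encGh x.d) m.qc₁ = some a :=
    fun a => by rw [eq_comm, ← partialInv_eq_some (P.encGh_inj x.d)]
  have e₂ : ∀ a, m.qc₂ = P.encG x.d a ↔ Function.partialInv (P.encG x.d) m.qc₂ = some a :=
    fun a => by rw [eq_comm, ← partialInv_eq_some (P.encG_inj x.d)]
  unfold decryptionOracle
  dsimp only
  split
  swap
  · rename_i h
    rcases hq : (x.real L μ).query L s m with _ | ⟨c₁, c₂⟩
    · rfl
    · obtain ⟨-, -, h₁, h₂, -⟩ := hsome.mp hq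
      exact (h c₁ c₂ ((e₁ _).mp h₁) ((e₂ _).mp h₂)).elim
  rename_i c₁ c₂ h₁ h₂
  change (P.grp x.d).Gh at c₁
  change (P.grp x.d).G at c₂
  have hf := ho ⟨c₁, c₂⟩
  by_cases hq : m.qset L ⊆ s.S₀.toSet L ∧ m.quser.len ∈ m.qset L ∧
      ¬ (2 < s.ph ∧ c₁ = (x.real L μ).C₁ ∧ c₂ = (x.real L μ).C₂ (s.S₁.toSet L))
  · refine (if_pos ⟨hq.1, hq.2.1, hf.mpr hq.2.2⟩).trans ?_
    rw [hsome.mpr ⟨hs, hm, (e₁ _).mpr h₁, (e₂ _).mpr h₂, hq⟩]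
    have := decaps_eq (L := L) x μ (upk := fun j => (keys j).2) (toSet_subset _)
      (fun j hj => by rw [hkeys j (hq.1 hj)]) hq.2.1 ⟨c₁, c₂⟩ m.qaux.toBits
    rw [← hkeys _ (hq.1 hq.2.1)] at this
    refine (congrArg (PMF.map _) this).trans ?_
    rw [PMF.pure_map]
    show PMF.pure (Val.ofOption (Option.map _ (if (x.real L μ).Valid (m.qset L)
      ((x.real L μ).ω c₁ m.qaux.toBits) c₁ c₂ then _ else _))) =
      PMF.pure ((x.real L μ).decAns L m c₁ c₂)
    unfold Tab.decAns
    split_ifs <;> rfl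
  · refine (if_neg fun h => hq ⟨h.1, h.2.1, hf.mp h.2.2⟩).trans ?_
    rcases hq' : (x.real L μ).query L s m with _ | ⟨a, b⟩
    · rfl
    · obtain ⟨-, -, h₁', h₂', h⟩ := hsome.mp hq'
      have ha := ((e₁ _).mp h₁').symm.trans h₁
      have hb := ((e₂ _).mp h₂').symm.trans h₂
      obtain rfl := Option.some.inj ha
      obtain rfl := Option.some.inj hb
      exact (hq h).elim

/-- State of a challenger that keeps its random choices. -/
inductive Lazy (P : PairingSystem) (n : ℕ) : Type
  | start
  | params (S₀ : Val) (x : Par P n)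
  | phase1 (S₀ : Val) (x : Par P n) (γ : ℕ → ZMod (P.grp x.d).p)
  | phase2 (S₀ S₁ : Val) (x : Theta P n)

/-- Answers given before the challenge do not involve `t` and `R`, so arbitrary values allow them to
be read from a table. -/
def Par.noChallenge (x : Par P n) (γ : ℕ → ZMod (P.grp x.d).p) : Theta P n := ⟨x, γ, 0, 1⟩

open Classical in
variable (L) in
def Lazy.handler (μ : Bool) : Lazy P n → Val → PMF (Val × Lazy P n)
  | .start, m => (parDist P n).map fun x => ((x.pp L).enc, .params m x)
  | .params S₀ x, m => (x.keyDist L).map fun γ =>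
      (((x.noChallenge γ).real L μ).answer L ⟨1, S₀, Val.nil⟩ m, .phase1 S₀ x γ)
  | .phase1 S₀ x γ, m =>
      if Tab.Challenge L ⟨2, S₀, Val.nil⟩ m then
        (x.encDist γ).map fun y =>
          ((y.real L μ).answer L ⟨2, S₀, Val.nil⟩ m, .phase2 S₀ m.tl y)
      else PMF.pure (((x.noChallenge γ).real L μ).answer L ⟨2, S₀, Val.nil⟩ m, .phase1 S₀ x γ)
  | .phase2 S₀ S₁ y, m => PMF.pure ((y.real L μ).answer L ⟨3, S₀, S₁⟩ m, .phase2 S₀ S₁ y)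

-- Draws whatever the state has not fixed yet. Applied to the initial state it is the full
-- distribution `thetaDist`; used as the kernel of `run_refine` it moves all sampling to the start.
variable (L) in
def Lazy.sample : Lazy P n → PMF (Theta P n × Core)
  | .start => (thetaDist P n L).map fun y => (y, Core.init)
  | .params S₀ x => ((x.keyDist L).bind x.encDist).map fun y => (y, ⟨1, S₀, Val.nil⟩)
  | .phase1 S₀ x γ => (x.encDist γ).map fun y => (y, ⟨2, S₀, Val.nil⟩)
  | .phase2 S₀ S₁ y => PMF.pure (y, ⟨3, S₀, S₁⟩)

variable (L) in
def Theta.handler (μ : Bool) (s : Theta P n × Core) (m : Val) : PMF (Val × (Theta P n × Core)) :=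
  PMF.pure ((s.1.real L μ).answer L s.2 m, (s.1, Tab.nextCore L s.2 m))

/-- The exclusion of the challenge header applies only to phases above `2`, and it is the only place
where `query` reads the challenge. -/
theorem Tab.query_phase2 (T : Tab P n) {s : Core} (hs : s.ph = 2)
    (C₁ : (P.grp T.d).Gh) (cB : (P.grp T.d).G) (Tc : ℕ → (P.grp T.d).G) (ck m : Val) :
    ({ T with C₁ := C₁, cB := cB, Tc := Tc, ck := ck } : Tab P n).query L s m = T.query L s m := by
  refine Option.ext fun c => ?_
  refine (Tab.query_eq_some (s := ⟨s, Val.nil, Val.nil, none⟩)).trans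
    (Iff.trans ?_ (Tab.query_eq_some (s := ⟨s, Val.nil, Val.nil, none⟩)).symm)
  simp only [hs, lt_irrefl, false_and]

theorem Theta.real_answer (x : Theta P n) {μ : Bool} {s : Core} (hs : s.ph = 2) {m : Val}
    (hm : ¬ Tab.Challenge L s m) (t : ZMod (P.grp x.d).p) (R : (P.grp x.d).GT) :
    (x.real L μ).answer L s m =
      (({ x with t := t, R := R } : Theta P n).real L μ).answer L s m := by
  have := (x.real L μ).query_phase2 (L := L) hs
    (({ x with t := t, R := R } : Theta P n).real L μ).C₁
    (({ x with t := t, R := R } : Theta P n).real L μ).cB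
    (({ x with t := t, R := R } : Theta P n).real L μ).Tc
    (({ x with t := t, R := R } : Theta P n).real L μ).ck m
  simp only [Tab.answer, hs, if_neg hm, OfNat.ofNat_ne_zero, OfNat.ofNat_ne_one, if_false]
  rw [← this]
  rfl

variable (L) in
theorem Lazy.handler_sample (μ : Bool) (s : Lazy P n) (m : Val) :
    ((s.handler L μ m).bind fun r => (r.2.sample L).map fun t => (r.1, t)) =
      (s.sample L).bind fun t => Theta.handler L μ t m := by
  have henc : ∀ (x : Par P n) (γ : ℕ → ZMod (P.grp x.d).p) (f g : Theta P n → PMF (Val × (Theta P n × Core))),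
      (∀ t R, f ⟨x, γ, t, R⟩ = g ⟨x, γ, t, R⟩) → (x.encDist γ).bind f = (x.encDist γ).bind g := by
    intro x γ f g h
    simp only [Par.encDist, PMF.bind_bind, PMF.bind_map, Function.comp_def, h]
  cases s with
  | start =>
    simp only [handler, sample, thetaDist, PMF.map_bind, PMF.bind_map, PMF.bind_bind,
      PMF.map_comp, Function.comp_def, Theta.handler, Core.init]
    congr 1
    funext x
    congr 1
    funext γ
    exact henc x γ _ _ fun t R => rfl
  | params S₀ x =>
    simp only [handler, sample, PMF.map_bind, PMF.bind_map, PMF.bind_bind,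
      PMF.map_comp, Function.comp_def, Theta.handler]
    congr 1
    funext γ
    exact henc x γ _ _ fun t R => rfl
  | phase1 S₀ x γ =>
    simp only [handler, sample]
    split_ifs with h
    · simp only [PMF.bind_map, Function.comp_def, PMF.pure_map]
      refine henc x γ _ _ fun t R => ?_
      simp only [Theta.handler, Tab.nextCore, if_pos h]
      rfl
    · simp only [PMF.bind_map, Function.comp_def, PMF.pure_bind, PMF.map_comp]
      refine henc x γ _ _ fun t R => ?_
      simp only [Theta.handler, Tab.nextCore, if_neg h, OfNat.ofNat_ne_zero, OfNat.ofNat_ne_one,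
        if_false]
      rw [(x.noChallenge γ).real_answer rfl h t R]
      rfl
  | phase2 S₀ S₁ y =>
    simp only [handler, sample, PMF.pure_bind, PMF.pure_map, Theta.handler]
    congr 2
    simp [Tab.nextCore, Tab.Challenge]

end Lazy

end DBE
end

/-! ### The challenger of the experiment equals the table-driven challenger -/

noncomputable section
namespace DBE

section Lazy

variable {P : PairingSystem} {n : ℕ} (L : ℕ)

theorem C₂_eq (x : Theta P n) (μ : Bool) (S : Finset ℕ) :
    (x.real L μ).C₂ S = (x.real L μ).F S x.ω ^ x.t.val := by
  rw [F_eq, ← pow_val_mul, add_mul, Finset.sum_mul, pow_val_add, pow_val_sum]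
  rfl

def Par.keysOn (x : Par P n) (S₀ : Val) (γ : ℕ → ZMod (P.grp x.d).p) (j : ℕ) :
    USK (P.grp x.d) × UPK (P.grp x.d) :=
  if j ∈ (List.range' 1 L).filter (· ∈ S₀.toSet L) then x.keys L j (γ j)
  else (⟨1⟩, ⟨1, 1, fun _ => 1⟩)

theorem Par.keysOn_eq (x : Par P n) (S₀ : Val) (γ : ℕ → ZMod (P.grp x.d).p) {j : ℕ}
    (hj : j ∈ S₀.toSet L) : x.keysOn L S₀ γ j = x.keys L j (γ j) := by
  have := Finset.mem_Icc.mp (toSet_subset S₀ hj)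
  rw [keysOn, if_pos]
  rw [List.mem_filter, List.mem_range'_1]
  exact ⟨by omega, by simpa using hj⟩

def Lazy.toChallenger (μ : Bool) : Lazy P n → Challenger P n L
  | .start => .start
  | .params S₀ x => .params (S₀.toSet L) (x.pp L)
  | .phase1 S₀ x γ => .phase1 (S₀.toSet L) (x.pp L) (x.keysOn L S₀ γ)
  | .phase2 S₀ S₁ y => .phase2 (S₀.toSet L) (y.pp L) (y.keysOn L S₀ y.γ)
      ⟨(y.real L μ).C₁, (y.real L μ).C₂ (S₁.toSet L)⟩

theorem setup_eq : setup P n L = (parDist P n).map (Par.pp L) := by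
  simp only [parDist, setup, bind, PMF.map_bind, PMF.pure_map]
  rfl

open Classical in
theorem Lazy.handler_toChallenger (μ : Bool) (s : Lazy P n) (m : Val) :
    ((s.handler L μ m).bind fun r => (PMF.pure (r.2.toChallenger L μ)).map fun t => (r.1, t)) =
      challenger μ (s.toChallenger L μ) m := by
  simp only [PMF.pure_map]
  cases s with
  | start =>
    simp only [handler, toChallenger, challenger, setup_eq, bind, PMF.bind_map]
    rfl
  | params S₀ x =>
    simp only [handler, PMF.bind_map]
    show _ = (genKeys (x.pp L) _).bind _
    rw [genKeys_filter, PMF.bind_map]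
    congr 1
    funext γ
    simp only [Function.comp_apply, toChallenger, Tab.answer, one_ne_zero, if_false, if_true]
    congr 2
    refine congrArg Val.ofList (List.map_congr_left fun j hj => ?_)
    rw [if_pos hj]
    rfl
  | phase1 S₀ x γ =>
    by_cases hc : m.hd.toBool = true
    · have h : ¬ Tab.Challenge L ⟨2, S₀, Val.nil⟩ m := by simp [Tab.Challenge, hc]
      simp only [handler, if_neg h, PMF.pure_bind, toChallenger, challenger, if_pos hc]
      have := decryptionOracle_eq (L := L) (x.noChallenge γ) μ ⟨2, S₀, Val.nil⟩ le_rfl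
        (x.keysOn L S₀ γ) (fun j hj => x.keysOn_eq L S₀ γ hj) m hc none (by simp)
      refine Eq.trans ?_ (congrArg (PMF.map _) this).symm
      simp only [PMF.pure_map, Tab.answer, if_neg h, OfNat.ofNat_ne_zero, OfNat.ofNat_ne_one,
        if_false]
    · simp only [toChallenger, challenger, if_neg hc, handler]
      by_cases hS : m.tl.toSet L ⊆ S₀.toSet L
      · have h : Tab.Challenge L ⟨2, S₀, Val.nil⟩ m := ⟨rfl, by simpa using hc, hS⟩
        simp only [if_pos h, if_pos hS, PMF.bind_map, Par.encDist, PMF.bind_bind, Tab.answer,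
          OfNat.ofNat_ne_zero, OfNat.ofNat_ne_one, if_false, encaps, bind, Function.comp_def,
          PMF.pure_bind]
        congr 1
        funext t
        congr 1
        funext R
        have hb := base_eq (L := L) (⟨x, γ, t, R⟩ : Theta P n) μ
          (upk := fun j => (x.keysOn L S₀ γ j).2) (S := m.tl.toSet L) (toSet_subset _)
          (fun j hj => by rw [x.keysOn_eq L S₀ γ (hS hj)])
        rw [hb, C₂_eq]
        congr 2
        · refine congrArg Val.ofList ?_
          refine congrArg₂ List.cons rfl (congrArg₂ List.cons rfl ?_)
          refine congrArg₂ List.cons (congrArg Val.ofBits ?_) rfl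
          cases μ
          · simp only [pow_val_mul, BilinearGroup.e_pow_left]
            rfl
          · rfl
      · have h : ¬ Tab.Challenge L ⟨2, S₀, Val.nil⟩ m := fun h => hS h.2.2
        simp only [if_neg h, if_neg hS, PMF.pure_bind, Tab.answer, Tab.query, hc,
          OfNat.ofNat_ne_zero, OfNat.ofNat_ne_one, if_false]
        rfl
  | phase2 S₀ S₁ y =>
    have h : ¬ Tab.Challenge L ⟨3, S₀, S₁⟩ m := by simp [Tab.Challenge]
    simp only [handler, PMF.pure_bind, toChallenger, challenger, Tab.answer, if_neg h,
      OfNat.ofNat_ne_zero, OfNat.ofNat_ne_one, if_false]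
    by_cases hc : m.hd.toBool = true
    · rw [if_pos hc]
      have := decryptionOracle_eq (L := L) y μ ⟨3, S₀, S₁⟩ (by norm_num)
        (y.keysOn L S₀ y.γ) (fun j hj => y.keysOn_eq L S₀ y.γ hj) m hc
        (some ⟨(y.real L μ).C₁, (y.real L μ).C₂ (S₁.toSet L)⟩) (by
          rintro ⟨a, b⟩
          simp only [Ne, Option.some_inj, Header.mk.injEq, eq_comm (a := a), eq_comm (a := b)]
          simp)
      refine Eq.trans ?_ (congrArg (PMF.map _) this).symm
      rw [PMF.pure_map]
    · simp only [Tab.query, hc]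
      rfl

/-- Three refinements are joined: the lazy challenger translates into the challenger of the
experiment; sampling its missing choices turns it into the one that draws everything at the start;
and the latter is the table-driven game without its records. Only the registers of the adversary are
compared, so the states of the environments drop out. -/
theorem run_challenger (μ : Bool) (A : Prog) :
    (A.run P (challenger (P := P) (n := n) (L := L) μ)
      (Config.start n L Val.nil Challenger.start)).map Config.mem =
    (thetaDist P n L).bind fun y => ((y.real L μ).game L A).map Config.mem := by
  have h₁ := run_refine (P := P) (h' := challenger (P := P) (n := n) (L := L) μ)
    (fun s => PMF.pure (Lazy.toChallenger (P := P) (n := n) L μ s))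
    (fun s v => (Lazy.handler_toChallenger L μ s v).trans
      (PMF.pure_bind _ fun t => challenger μ t v).symm) A
    (Config.start n L Val.nil Lazy.start)
  have h₂ := run_refine (P := P) _ (Lazy.handler_sample (P := P) (n := n) L μ) A
    (Config.start n L Val.nil Lazy.start)
  have h₃ := fun y : Theta P n => run_refine (P := P) (h := (y.real L μ).handler L)
    (h' := Theta.handler L μ) (fun s => PMF.pure (y, s.core)) (fun s v => by
      simp only [Tab.handler, Theta.handler, PMF.pure_bind, PMF.pure_map]
      rfl) A (Config.start n L Val.nil Full.init)
  have hmem : ∀ {σ τ : Type} (R : σ → PMF τ) (p : PMF (Config σ)),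
      (p.bind (refine R)).map Config.mem = p.map Config.mem := by
    intro σ τ R p
    rw [PMF.map_bind]
    refine congrArg (PMF.bind p) (funext fun s => ?_)
    rw [refine, PMF.map_comp]
    exact PMF.map_const _ _
  have h₁ := congrArg (PMF.map Config.mem) h₁
  have h₂ := congrArg (PMF.map Config.mem) h₂
  rw [hmem, refine_bind] at h₁ h₂
  rw [show (Config.start n L Val.nil (Lazy.start (P := P) (n := n))).env = Lazy.start from rfl,
    PMF.pure_bind] at h₁
  refine h₁.symm.trans (h₂.trans ?_)
  show PMF.map _ (((thetaDist P n L).map fun y => (y, Core.init)).bind _) = _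
  rw [PMF.bind_map, PMF.map_bind]
  refine congrArg (PMF.bind _) (funext fun y => ?_)
  have h₃ := congrArg (PMF.map Config.mem) (h₃ y)
  rw [hmem, refine_bind, PMF.pure_bind] at h₃
  exact h₃.symm

end Lazy

end DBE
end

noncomputable section
namespace DBE

/-! ## Comparison of games -/

section Hops

variable {P : PairingSystem} {n : ℕ} (L : ℕ)

theorem Tab.query_some_iff (T : Tab P n) {s : Core} {m : Val}
    {c : (P.grp T.d).Gh × (P.grp T.d).G} :
    T.query L s m = some c ↔ 2 ≤ s.ph ∧ m.hd.toBool = true ∧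
      m.qc₁ = P.encGh T.d c.1 ∧ m.qc₂ = P.encG T.d c.2 ∧ m.qset L ⊆ s.S₀.toSet L ∧
      m.quser.len ∈ m.qset L ∧
      ¬ (2 < s.ph ∧ c.1 = T.C₁ ∧ c.2 = T.C₂ (s.S₁.toSet L)) :=
  Tab.query_eq_some (s := ⟨s, Val.nil, Val.nil, none⟩)

theorem Tab.next_rec₁ (T : Tab P n) {s : Full} {m : Val} (h : s.rec₁ ≠ Val.nil) :
    (T.next L s m).rec₁ ≠ Val.nil := by
  rw [Tab.next]
  rcases T.query L s.core m with _ | c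
  · exact h
  · simp only [Option.elim_some]
    split_ifs
    · simp
    · exact h

theorem Tab.next_rec₂ (T : Tab P n) {s : Full} {m : Val} (h : s.rec₂ ≠ Val.nil) :
    (T.next L s m).rec₂ ≠ Val.nil := by
  rw [Tab.next]
  rcases T.query L s.core m with _ | c
  · exact h
  · simp only [Option.elim_some]
    split_ifs
    · simp
    · exact h

theorem Tab.next_ev (T : Tab P n) {s : Full} {m : Val} (h : s.ev ≠ none) :
    (T.next L s m).ev = s.ev := by
  rw [Tab.next]
  rcases T.query L s.core m with _ | c
  · rfl
  · simp [h]

theorem Tab.next_ev_of_hit (T : Tab P n) {s : Full} {m : Val}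
    {c : (P.grp T.d).Gh × (P.grp T.d).G} (hq : T.query L s.core m = some c) (h : T.Hit L m c)
    (hs : s.ev = none) : (T.next L s m).ev =
      some (m.qset L, if 2 < s.core.ph then some (s.core.S₁.toSet L) else none) := by
  simp [Tab.next, hq, h, hs]

theorem Tab.next_rec₁_of_coll (T : Tab P n) {s : Full} {m : Val}
    {c : (P.grp T.d).Gh × (P.grp T.d).G} (hq : T.query L s.core m = some c)
    (h : T.Coll m c.1) : (T.next L s m).rec₁ ≠ Val.nil := by
  simp [Tab.next, hq, h]

/-- The events under which the first simulation may decrypt wrongly: a recorded collision or a hit.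
-/
def Full.bad (s : Full) : Prop := s.rec₁ ≠ Val.nil ∨ s.ev ≠ none

theorem Tab.next_bad (T : Tab P n) {s : Full} {m : Val} (h : s.bad) : (T.next L s m).bad := by
  rcases h with h | h
  · exact Or.inl (T.next_rec₁ L h)
  · exact Or.inr (by rwa [T.next_ev L h])

/-- The challenger that does not know the private keys, nor the exponents of `B` and the
`V_j`. -/
@[reducible] def Theta.sim₁ (x : Theta P n) (μ : Bool) : Tab P n :=
  { x.real L μ with
    X := x.gh ^ x.α.val
    q := x.g ^ (-(x.α * (x.β + x.ω * x.α ^ (L + 1)))).val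
    Tq := fun j => x.g ^ (-(x.α * (x.γ j + x.α ^ j))).val
    u₁ := 1
    u₀ := -x.ω }

/-- In the masked exponents `β + ω* α^(L+1)` and `γ_j + α^j` the exponent of `F` reads `α^(L+1) (ω -
ω*)` plus a known term. Pairing `C₂` with `ĝ^α` raises this to `α^(L+2) (ω - ω*)` plus `α` times the
known term; `q` and `Tq` cancel the latter, and `ω ≠ ω*` allows the division. -/
theorem ans_sim₁ (x : Theta P n) (μ : Bool) {S : Finset ℕ} {ω : ZMod (P.grp x.d).p}
    {c₁ : (P.grp x.d).Gh} {c₂ : (P.grp x.d).G} (hv : (x.real L μ).Valid S ω c₁ c₂)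
    (hω : ω ≠ x.ω) : (x.sim₁ L μ).ans S ω c₁ c₂ = (x.real L μ).ans S ω c₁ c₂ := by
  have hv : (P.grp x.d).e c₂ x.gh = (P.grp x.d).e ((x.real L μ).F S ω) c₁ := hv
  rw [F_eq] at hv
  rw [ans_eq]
  have hω' : ω - x.ω ≠ 0 := sub_ne_zero.mpr hω
  show ((P.grp x.d).e c₂ (x.gh ^ x.α.val) *
    (P.grp x.d).e (x.g ^ (-(x.α * (x.β + x.ω * x.α ^ (L + 1)))).val *
      ∏ j ∈ S, x.g ^ (-(x.α * (x.γ j + x.α ^ j))).val) c₁) ^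
      ((1 * ω + -x.ω : ZMod (P.grp x.d).p)⁻¹).val = _
  rw [BilinearGroup.e_pow_right, hv, ← pow_val_sum]
  simp only [BilinearGroup.e_pow_left, ← pow_val_mul, ← pow_val_add, one_mul]
  congr 2
  have hs : ∑ j ∈ S, -(x.α * (x.γ j + x.α ^ j)) = -(x.α * ∑ j ∈ S, (x.α ^ j + x.γ j)) := by
    rw [Finset.sum_neg_distrib, ← Finset.mul_sum]
    simp only [add_comm]
  rw [hs, ← sub_eq_add_neg ω, mul_inv_eq_iff_eq_mul₀ hω']
  ring

theorem query_sim₁ (x : Theta P n) (μ : Bool) (s : Core) (m : Val) :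
    (x.real L μ).query L s m = (x.sim₁ L μ).query L s m :=
  Option.ext fun _ => (Tab.query_some_iff L _).trans (Tab.query_some_iff L (x.sim₁ L μ)).symm

theorem next_sim₁ (x : Theta P n) (μ : Bool) (s : Full) (m : Val) :
    (x.real L μ).next L s m = (x.sim₁ L μ).next L s m := by
  unfold Tab.next
  rw [← query_sim₁]
  rfl

/-- Both tables agree except in the data for decryption, so states evolve identically. An answer can
differ only for a valid ciphertext with `ω = ω*`, and such a query makes the next state bad. The
failure event is needed on the real side only. -/
theorem game_sim₁ (x : Theta P n) (μ : Bool) (A : Prog) :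
    Coupled (fun s t => s.mem = t.mem ∨ s.env.bad) ((x.real L μ).game L A)
      ((x.sim₁ L μ).game L A) := by
  have := run_until (P := P) (h := (x.real L μ).handler L) (h' := (x.sim₁ L μ).handler L)
    (G := fun s t => s = t) (D := Full.bad) (D' := fun _ => False) (by
      intro s m hs r hr
      rw [Tab.handler, PMF.mem_support_pure_iff] at hr
      rw [hr]
      exact Tab.next_bad L _ hs) (by simp) (by
      rintro s _ m rfl
      refine Coupled.pure ?_
      by_cases hb : ((x.real L μ).next L s m).bad
      · exact Or.inr (Or.inl hb)
      · refine Or.inl ⟨?_, next_sim₁ L x μ s m⟩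
        show (x.real L μ).answer L s.core m = (x.sim₁ L μ).answer L s.core m
        rcases hq : (x.real L μ).query L s.core m with _ | c
        · have hq' : (x.sim₁ L μ).query L s.core m = none :=
            (query_sim₁ L x μ _ m).symm.trans hq
          simp only [Tab.answer, hq, hq']
          rfl
        · have hq' : (x.sim₁ L μ).query L s.core m = some c :=
            (query_sim₁ L x μ _ m).symm.trans hq
          have hd : (x.real L μ).decAns L m c.1 c.2 = (x.sim₁ L μ).decAns L m c.1 c.2 := by
            by_cases hv : (x.real L μ).Valid (m.qset L) ((x.real L μ).ω c.1 m.qaux.toBits) c.1 c.2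
            -- Equality would mean either the arguments of the challenge, hence a hit by validity,
            -- or other arguments with the same hash, hence a collision.
            · have hω : (x.real L μ).ω c.1 m.qaux.toBits ≠ x.ω := by
                intro hω
                by_cases hc : c.1 = (x.real L μ).C₁ ∧ m.qaux = Val.nil
                · refine hb (Or.inr ?_)
                  by_cases he : s.ev = none
                  · rw [Tab.next_ev_of_hit L _ hq ⟨hc.1, hc.2, hv⟩ he]
                    simp
                  · rwa [Tab.next_ev L _ he]
                · exact hb (Or.inl (Tab.next_rec₁_of_coll L _ hq ⟨hω, hc⟩))
              have hv' : (x.sim₁ L μ).Valid (m.qset L) ((x.sim₁ L μ).ω c.1 m.qaux.toBits)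
                c.1 c.2 := hv
              rw [Tab.decAns, Tab.decAns, if_pos hv, if_pos hv']
              have := ans_sim₁ L x μ hv hω
              refine congrArg (fun z => Val.node Val.nil (Val.ofBits (P.H2 n x.d x.κ₂ z).toList)) ?_
              exact this.symm
            · have hv' : ¬ (x.sim₁ L μ).Valid (m.qset L) ((x.sim₁ L μ).ω c.1 m.qaux.toBits)
                c.1 c.2 := hv
              rw [Tab.decAns, Tab.decAns, if_neg hv, if_neg hv']
          simp only [Tab.answer, hq, hq', Option.elim_some, hd]
          rfl) A
    (Config.start n L Val.nil Full.init) (Config.start n L Val.nil Full.init) (Or.inl ⟨rfl, rfl⟩)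
  refine this.mono ?_
  rintro s t (h | h | h)
  · exact Or.inl h.1
  · exact Or.inr h
  · exact h.elim

end Hops

end DBE
end

/-! ### The second hop: embedding a secret at a guessed user -/

noncomputable section
namespace DBE

section Hops

variable {P : PairingSystem} {n : ℕ} (L : ℕ)

/-- The challenger whose challenge ciphertext is correct for sets `S` with
`k + 1 ∈ S ↔ b = true`. -/
@[reducible] def Theta.sim₂ (x : Theta P n) (a : ZMod (P.grp x.d).p) (k : ℕ) (b μ : Bool) :
    Tab P n :=
  { x.real L μ with
    cB := x.g ^ ((x.α ^ (L + 1) * x.ω + x.β) * x.t + if b then a * x.t else 0).val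
    Tc := fun j => x.g ^ ((x.α ^ j + x.γ j) * x.t + if j = k + 1 then -(a * x.t) else 0).val
    k := k
    b := b }

theorem sim₂_zero (x : Theta P n) (μ : Bool) : x.sim₂ L 0 0 false μ = x.real L μ := by
  simp [Theta.sim₂]

/-- The table uses the masked exponents `β + [b] a` and `γ_(k+1) - a` in place of the true ones. The
resulting error in the exponent is `a t ([b] - [k + 1 ∈ S])`, which vanishes exactly for sets that
agree with the guess, up to the degenerate case `a t = 0`. -/
theorem C₂_sim₂ (x : Theta P n) (a : ZMod (P.grp x.d).p) (k : ℕ) (b μ : Bool) (S : Finset ℕ) :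
    (x.sim₂ L a k b μ).C₂ S = (x.real L μ).C₂ S *
      x.g ^ ((if b then a * x.t else 0) + if k + 1 ∈ S then -(a * x.t) else 0).val := by
  have h₁ : (x.sim₂ L a k b μ).C₂ S =
      x.g ^ ((x.α ^ (L + 1) * x.ω + x.β) * x.t + if b then a * x.t else 0).val *
        ∏ j ∈ S, x.g ^ ((x.α ^ j + x.γ j) * x.t + if j = k + 1 then -(a * x.t) else 0).val := rfl
  have h₂ : (x.real L μ).C₂ S = x.g ^ ((x.α ^ (L + 1) * x.ω + x.β) * x.t).val *
      ∏ j ∈ S, x.g ^ ((x.α ^ j + x.γ j) * x.t).val := rfl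
  rw [h₁, h₂, ← pow_val_sum, ← pow_val_sum, ← pow_val_add, ← pow_val_add, ← pow_val_add,
    Finset.sum_add_distrib, Finset.sum_ite_eq']
  congr 2
  ring

theorem C₂_sim₂_eq (x : Theta P n) (a : ZMod (P.grp x.d).p) {k : ℕ} {b : Bool} (μ : Bool)
    {S : Finset ℕ} (h : decide (k + 1 ∈ S) = b) :
    (x.sim₂ L a k b μ).C₂ S = (x.real L μ).C₂ S := by
  rw [C₂_sim₂]
  have : ((if b then a * x.t else 0) + if k + 1 ∈ S then -(a * x.t) else 0) = 0 := by
    subst h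
    by_cases h : k + 1 ∈ S <;> simp [h]
  rw [this, pow_val_zero, mul_one]

/-- The first exceptional query distinguishes its set from the challenge set. -/
def Cons (k : ℕ) (b : Bool) (o : Option (Finset ℕ × Option (Finset ℕ))) : Prop :=
  ∃ S S', o = some (S, S') ∧ decide (k + 1 ∈ S) ≠ b ∧ ∀ T ∈ S', decide (k + 1 ∈ T) = b

theorem query_sim₂ (x : Theta P n) (a : ZMod (P.grp x.d).p) {k : ℕ} {b : Bool} (μ : Bool)
    {s : Core} (m : Val) (hs : 2 < s.ph → decide (k + 1 ∈ s.S₁.toSet L) = b) :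
    (x.real L μ).query L s m = (x.sim₂ L a k b μ).query L s m := by
  refine Option.ext fun c => (Tab.query_some_iff L _).trans
    (Iff.trans ?_ (Tab.query_some_iff L (x.sim₂ L a k b μ)).symm)
  by_cases h : 2 < s.ph
  · rw [C₂_sim₂_eq L x a μ (hs h)]
  · simp only [h, false_and]

/-- As long as the guess is consistent, the challenge is correct and the adversary sees the real
game up to the first hit. If that hit confirms the guess, the simulation records it. Nothing is
claimed about runs in which the guess fails, since `Cons` is then impossible. -/
theorem game_sim₂ (x : Theta P n) (a : ZMod (P.grp x.d).p) (k : ℕ) (b μ : Bool) (A : Prog) :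
    pr ((x.real L μ).game L A) (fun s => Cons k b s.env.ev) ≤
      pr ((x.sim₂ L a k b μ).game L A) (fun s => s.env.rec₂ ≠ Val.nil) := by
  have := run_until (P := P) (h := (x.real L μ).handler L)
    (h' := (x.sim₂ L a k b μ).handler L)
    (G := fun s t => s.core = t.core ∧ s.ev = none ∧
      (2 < s.core.ph → decide (k + 1 ∈ s.core.S₁.toSet L) = b))
    -- Failure of the guess: either the first hit does not satisfy `Cons`, or no hit has occurred
    -- and the challenge set already contradicts `b`. It persists because `ev` is written once and
    -- the challenge set is fixed in the last phase.
    (D := fun s => ¬ Cons k b s.ev ∧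
      (s.ev = none → 2 < s.core.ph ∧ decide (k + 1 ∈ s.core.S₁.toSet L) ≠ b))
    (D' := fun t => t.rec₂ ≠ Val.nil) (by
      intro s m hs r hr
      rw [Tab.handler, PMF.mem_support_pure_iff] at hr
      subst hr
      by_cases he : s.ev = none
      · obtain ⟨h₁, h₂⟩ := hs.2 he
        have hc : Tab.nextCore L s.core m = s.core := by
          rw [Tab.nextCore, if_neg (by omega), if_neg (by omega), if_neg]
          exact fun h => by have := h.1; omega
        refine ⟨?_, fun _ => ?_⟩
        · simp only [Tab.next]
          rcases (x.real L μ).query L s.core m with _ | c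
          · exact hs.1
          · rw [Option.elim_some]
            split_ifs
            · rintro ⟨S, S', hS, -, h₄⟩
              obtain ⟨rfl, rfl⟩ := Prod.mk.inj (Option.some.inj hS)
              exact h₂ (h₄ _ rfl)
            · exact hs.1
        · show 2 < (Tab.nextCore L s.core m).ph ∧ _ ≠ b
          rw [hc]
          exact ⟨h₁, by rw [Tab.next, hc]; exact h₂⟩
      · rw [Tab.next_ev L _ he]
        exact ⟨hs.1, fun h => (he h).elim⟩) (by
      intro s m hs r hr
      rw [Tab.handler, PMF.mem_support_pure_iff] at hr
      rw [hr]
      exact Tab.next_rec₂ L _ hs) (by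
      rintro ⟨c, r₁, r₂, e⟩ ⟨_, r₁', r₂', e'⟩ m ⟨rfl, rfl : e = none, hG : 2 < c.ph → _⟩
      refine Coupled.pure ?_
      have hq' := query_sim₂ L x a μ m hG
      rcases hq : (x.real L μ).query L c m with _ | ⟨c₁, c₂⟩
      · rw [hq] at hq'
        by_cases hc : Tab.Challenge L c m
        · have hn : Tab.nextCore L c m = ⟨3, c.S₀, m.tl⟩ := by
            have := hc.1
            rw [Tab.nextCore, if_neg (by omega), if_neg (by omega), if_pos hc]
          by_cases hS : decide (k + 1 ∈ m.tl.toSet L) = b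
          · refine Or.inl ⟨?_, rfl, ?_, ?_⟩
            · have := C₂_sim₂_eq L x a μ hS
              have h2 := hc.1
              show (x.real L μ).answer L c m = (x.sim₂ L a k b μ).answer L c m
              rw [Tab.answer, Tab.answer, if_neg (by omega), if_neg (by omega), if_pos hc,
                if_neg (by omega), if_neg (by omega), if_pos hc, this]
            · simp only [Tab.next, hq, Option.elim_none]
            · intro _
              simp only [Tab.next, hn]
              exact hS
          -- The challenge contradicts the guess. A later hit would carry this challenge set and so
          -- violate `Cons`.
          · refine Or.inr (Or.inl ⟨?_, fun _ => ?_⟩)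
            · simp only [Tab.next, hq, Option.elim_none]
              rintro ⟨S, S', hS, -⟩
              cases hS
            · simp only [Tab.next, hn]
              exact ⟨by norm_num, hS⟩
        · refine Or.inl ⟨?_, rfl, ?_, ?_⟩
          · show (x.real L μ).answer L c m = (x.sim₂ L a k b μ).answer L c m
            rw [Tab.answer, Tab.answer, if_neg hc, if_neg hc, hq, ← hq']
            rfl
          · simp only [Tab.next, hq, Option.elim_none]
          · have : 2 < (Tab.nextCore L c m).ph → Tab.nextCore L c m = c := by
              rw [Tab.nextCore, if_neg hc]
              split_ifs <;> simp
            show 2 < (Tab.nextCore L c m).ph → decide (k + 1 ∈ (Tab.nextCore L c m).S₁.toSet L) = b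
            intro h
            have e := this h
            rw [e] at h ⊢
            exact hG h
      · rw [hq] at hq'
        obtain ⟨h₁, h₂, -⟩ := (Tab.query_some_iff L _).mp hq
        have hc : ¬ Tab.Challenge L c m := fun h => by simp [h.2.1] at h₂
        have hn : Tab.nextCore L c m = c := by
          rw [Tab.nextCore, if_neg (by omega), if_neg (by omega), if_neg hc]
        by_cases hh : (x.real L μ).Hit L m (c₁, c₂)
        · by_cases hk : decide (k + 1 ∈ m.qset L) = b
          · refine Or.inr (Or.inl ?_)
            have := Tab.next_ev_of_hit (s := ⟨c, r₁, r₂, none⟩) L _ hq hh rfl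
            dsimp only
            rw [this]
            refine ⟨?_, by simp⟩
            rintro ⟨S, S', hS, h₃, -⟩
            obtain ⟨rfl, -⟩ := Prod.mk.inj (Option.some.inj hS)
            exact h₃ hk
          -- The hit distinguishes its set from the guessed bit, and the simulation writes it to
          -- `rec₂`.
          · refine Or.inr (Or.inr ?_)
            have hh' : (x.sim₂ L a k b μ).Hit L m (c₁, c₂) := hh
            simp only [Tab.next, ← hq', Option.elim_some]
            rw [if_pos ⟨hh', hk⟩]
            simp
        · refine Or.inl ⟨?_, rfl, ?_, ?_⟩
          · show (x.real L μ).answer L c m = (x.sim₂ L a k b μ).answer L c m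
            rw [Tab.answer, Tab.answer, if_neg hc, if_neg hc, hq, ← hq']
            rfl
          · simp only [Tab.next, hq, Option.elim_some]
            rw [if_neg (fun h => hh h.2)]
          · show 2 < (Tab.nextCore L c m).ph → decide (k + 1 ∈ (Tab.nextCore L c m).S₁.toSet L) = b
            rw [hn]
            exact hG) A
    (Config.start n L Val.nil Full.init) (Config.start n L Val.nil Full.init)
    (Or.inl ⟨rfl, rfl, rfl, fun h => by simp [Config.start, Full.init, Core.init] at h⟩)
  refine Coupled.pr_le this ?_
  rintro s t (⟨-, -, h, -⟩ | ⟨h, -⟩ | h) hs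
  · obtain ⟨S, S', hS, -⟩ := hs
    rw [h] at hS
    cases hS
  · exact (h hs).elim
  · exact h

theorem game_invariant (T : Tab P n) (A : Prog) {D : Full → Prop} (h₀ : D Full.init)
    (h : ∀ s m, D s → D (T.next L s m)) : ∀ s ∈ (T.game L A).support, D s.env := by
  refine run_closed (P := P) (h := T.handler L) ?_ A _ h₀
  intro s m hs r hr
  rw [Tab.handler, PMF.mem_support_pure_iff] at hr
  rw [hr]
  exact h s m hs

/-- The partner of the recorded argument is always the argument of the challenge, `C₁` with empty
auxiliary input. -/
theorem game_rec₁ (T : Tab P n) (A : Prog) : ∀ s ∈ (T.game L A).support, s.env.rec₁ ≠ Val.nil →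
    IsCollision P n T.d T.κ₁ (Val.node s.env.rec₁ (Val.node (P.encGh T.d T.C₁) Val.nil)) := by
  refine game_invariant L T A (D := fun s => s.rec₁ ≠ Val.nil →
    IsCollision P n T.d T.κ₁ (Val.node s.rec₁ (Val.node (P.encGh T.d T.C₁) Val.nil)))
    (fun h => (h rfl).elim) ?_
  intro s m hs
  simp only [Tab.next]
  rcases hq : T.query L s.core m with _ | ⟨c₁, c₂⟩
  · exact hs
  · rw [Option.elim_some]
    split_ifs with hc
    · intro _
      obtain ⟨-, -, h₁, -⟩ := (Tab.query_some_iff L _).mp hq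
      refine ⟨c₁, T.C₁, m.qaux.toBits, [], h₁, rfl, rfl, rfl, ?_, hc.1⟩
      rw [Ne, Prod.mk.injEq]
      refine fun h => hc.2 ⟨h.1, ?_⟩
      have := h.2
      revert this
      cases m.qaux <;> simp [Val.toBits, Val.toList]
    · exact hs

/-- Validity prescribes `e(C₂, ĝ)`, and `e(·, ĝ)` is injective; hence the second component is
determined by the set. -/
theorem hit_real {x : Theta P n} (hx : x.gh ≠ 1) {μ : Bool} {m : Val}
    {c : (P.grp x.d).Gh × (P.grp x.d).G} (h : (x.real L μ).Hit L m c) :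
    c.2 = (x.real L μ).C₂ (m.qset L) := by
  obtain ⟨h₁, h₂, h₃⟩ := h
  have hω : (x.real L μ).ω c.1 m.qaux.toBits = x.ω := by
    rw [h₁, h₂]
    rfl
  rw [hω, h₁] at h₃
  refine (P.grp x.d).e_left_injective hx ?_
  have h₃ : (P.grp x.d).e c.2 x.gh =
    (P.grp x.d).e ((x.real L μ).F (m.qset L) x.ω) (x.gh ^ x.t.val) := h₃
  rw [h₃, C₂_eq, BilinearGroup.e_pow_left, BilinearGroup.e_pow_right]

/-- After the challenge, a hit for the challenge set itself would be the excluded header, by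
`hit_real`; so the sets differ and some user separates them. Before the challenge the set is
nonempty because it contains the decrypting user, and any member works with `b = false`. -/
theorem game_ev {x : Theta P n} (hx : x.gh ≠ 1) (μ : Bool) (A : Prog) :
    ∀ s ∈ ((x.real L μ).game L A).support, s.env.ev ≠ none →
      ∃ k < L, ∃ b, Cons k b s.env.ev := by
  have := game_invariant L (x.real L μ) A (D := fun s => ∀ S S', s.ev = some (S, S') →
    S.Nonempty ∧ S ⊆ Finset.Icc 1 L ∧ ∀ T ∈ S', S ≠ T ∧ T ⊆ Finset.Icc 1 L)
    (fun _ _ h => by cases h) (by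
      intro s m hs
      simp only [Tab.next]
      rcases hq : (x.real L μ).query L s.core m with _ | ⟨c₁, c₂⟩
      · exact hs
      · rw [Option.elim_some]
        split_ifs with hc hp
        · obtain ⟨-, -, -, -, -, h₁, h₂⟩ := (Tab.query_some_iff L _).mp hq
          rintro S S' h
          obtain ⟨rfl, rfl⟩ := Prod.mk.inj (Option.some.inj h)
          refine ⟨⟨_, h₁⟩, toSet_subset _, ?_⟩
          rintro T hT
          obtain rfl := Option.some.inj hT
          refine ⟨fun hS => h₂ ⟨hp, hc.2.1, ?_⟩, toSet_subset _⟩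
          rw [← hS]
          exact hit_real L hx hc.2
        · obtain ⟨-, -, -, -, -, h₁, h₂⟩ := (Tab.query_some_iff L _).mp hq
          rintro S S' h
          obtain ⟨rfl, rfl⟩ := Prod.mk.inj (Option.some.inj h)
          exact ⟨⟨_, h₁⟩, toSet_subset _, fun T hT => by cases hT⟩
        · exact hs)
  intro s hs he
  obtain ⟨⟨S, S'⟩, hS⟩ := Option.ne_none_iff_exists'.mp he
  obtain ⟨h₁, h₂, h₃⟩ := this s hs S S' hS
  have hk : ∀ j ∈ Finset.Icc 1 L, j - 1 < L ∧ j - 1 + 1 = j := by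
    intro j hj
    have := Finset.mem_Icc.mp hj
    omega
  rcases S' with _ | T
  · obtain ⟨j, hj⟩ := h₁
    refine ⟨j - 1, (hk j (h₂ hj)).1, false, S, none, hS, ?_, fun T hT => by cases hT⟩
    rw [(hk j (h₂ hj)).2]
    simp [hj]
  · obtain ⟨hne, hT⟩ := h₃ T rfl
    obtain ⟨j, hj⟩ : ∃ j, ¬ (j ∈ S ↔ j ∈ T) := by
      by_contra h
      push Not at h
      exact hne (Finset.ext h)
    have hjL : j ∈ Finset.Icc 1 L := by
      by_cases h : j ∈ S
      · exact h₂ h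
      · exact hT (by tauto)
    refine ⟨j - 1, (hk j hjL).1, decide (j ∈ T), S, some T, hS, ?_, ?_⟩
    · rw [(hk j hjL).2]
      simpa using hj
    · intro U hU
      obtain rfl := Option.some.inj hU
      rw [(hk j hjL).2]

/-- The witness `y` is the component sent by the adversary. By `hit_real` it is the true one, and
the recorded partner is off by the error of `C₂_sim₂`; its sign is fixed by `b` because membership
differs from `b`. -/
theorem game_rec₂ {x : Theta P n} (hx : x.gh ≠ 1) (a : ZMod (P.grp x.d).p) (k : ℕ) (b μ : Bool)
    (A : Prog) : ∀ s ∈ ((x.sim₂ L a k b μ).game L A).support, s.env.rec₂ ≠ Val.nil →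
      ∃ y : (P.grp x.d).G, s.env.rec₂ = Val.node (P.encG x.d y) (P.encG x.d
        (y * x.g ^ (if b then a * x.t else -(a * x.t)).val)) := by
  refine game_invariant L (x.sim₂ L a k b μ) A (D := fun s => s.rec₂ ≠ Val.nil →
    ∃ y : (P.grp x.d).G, s.rec₂ = Val.node (P.encG x.d y) (P.encG x.d
        (y * x.g ^ (if b then a * x.t else -(a * x.t)).val)))
    (fun h => (h rfl).elim) ?_
  intro s m hs
  simp only [Tab.next]
  rcases hq : (x.sim₂ L a k b μ).query L s.core m with _ | ⟨c₁, c₂⟩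
  · exact hs
  · rw [Option.elim_some]
    by_cases hc : (x.sim₂ L a k b μ).Hit L m (c₁, c₂) ∧ decide (k + 1 ∈ m.qset L) ≠ b
    · rw [if_pos hc]
      intro _
      obtain ⟨-, -, -, h₁, -⟩ := (Tab.query_some_iff L _).mp hq
      have hh : (x.real L μ).Hit L m (c₁, c₂) := hc.1
      refine ⟨c₂, ?_⟩
      rw [h₁, C₂_sim₂, ← hit_real L hx hh]
      have h₂ := hc.2
      congr 5
      by_cases hk : k + 1 ∈ m.qset L <;> cases b <;> simp_all
    · rw [if_neg hc]
      exact hs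

end Hops

end DBE
end

noncomputable section
namespace DBE

/-! ## Tools for the reductions -/

namespace Val

def one : Val := node nil nil

theorem build_filter {L a k : ℕ} (hk : k ≤ cap L) {p f : Val → Val} {q : ℕ → Prop}
    [DecidablePred q] {h : ℕ → Val} (hp : ∀ i < k, (p (ofNat i)).toBool = true ↔ q (a + i))
    (hf : ∀ i < k, q (a + i) → f (ofNat i) = h (a + i)) :
    build L p f (ofNat k) = ofList (((List.range' a k).filter q).map h) := by
  rw [build_ofNat hk, List.range'_eq_map_range, List.filter_map, List.map_map]
  have : (List.range k).filter (fun i => (p (ofNat i)).toBool) =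
      (List.range k).filter ((fun i => decide (q i)) ∘ fun i => a + i) := by
    refine List.filter_congr fun i hi => ?_
    rw [Bool.eq_iff_iff, hp i (List.mem_range.mp hi)]
    simp
  rw [this]
  refine congrArg ofList (List.map_congr_left fun i hi => ?_)
  rw [List.mem_filter, List.mem_range] at hi
  exact hf i hi.1 (by simpa using hi.2)

theorem build_map {L a k : ℕ} (hk : k ≤ cap L) {f : Val → Val} {h : ℕ → Val}
    (hf : ∀ i < k, f (ofNat i) = h (a + i)) :
    build L (fun _ => one) f (ofNat k) = ofList ((List.range' a k).map h) := by
  rw [build_filter (q := fun _ => True) (h := h) hk (by simp [one]) fun i hi _ => hf i hi]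
  simp

theorem get_map {L a k i : ℕ} (hi : i < k) (hk : k ≤ cap L) (h : ℕ → Val) :
    get L (ofList ((List.range' a k).map h)) (ofNat i) = h (a + i) := by
  rw [get_ofNat (by omega), toList_ofList, getD_map_range' _ _ _ hi]

/-- Entry `k + 1` of a list indexed by `1, …, 2 * L + 2` without `L + 2`. -/
def getSkip (L : ℕ) (v k : Val) : Val := get L v (cond (dropBy L (ofNat L) k) k.tl k)

theorem filter_range'_ne (L : ℕ) : (List.range' 1 (2 * L + 2)).filter (· ≠ L + 2) =
    List.range' 1 (L + 1) ++ List.range' (L + 3) L := by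
  have h₁ : List.range' 1 (2 * L + 2) = List.range' 1 (L + 1) ++ (L + 2) :: List.range' (L + 3) L := by
    have h₂ : (L + 2) :: List.range' (L + 3) L = List.range' (1 + (L + 1)) (L + 1) := by
      rw [List.range'_succ, show 1 + (L + 1) = L + 2 by ring]
    rw [h₂, List.range'_append_1]
    congr 1
    ring
  rw [h₁, List.filter_append, List.filter_cons_of_neg (by simp)]
  congr 1 <;> rw [List.filter_eq_self] <;> intro j hj <;> rw [List.mem_range'_1] at hj <;>
    simp <;> omega

theorem getSkip_eq {L k : ℕ} (h₁ : k ≤ 2 * L + 1) (h₂ : k ≠ L + 1) (h : ℕ → Val) :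
    getSkip L (ofList (((List.range' 1 (2 * L + 2)).filter (· ≠ L + 2)).map h)) (ofNat k) =
      h (k + 1) := by
  rw [getSkip, dropBy_eq (by rw [len_ofNat, cap]; omega), len_ofNat, tl_iterate_ofNat,
    filter_range'_ne, List.map_append]
  by_cases hk : k ≤ L
  · rw [show k - L = 0 by omega]
    show get L _ (ofNat k) = _
    rw [get_ofNat (by rw [cap]; omega), toList_ofList, List.getD_append _ _ _ _ (by simp; omega),
      getD_map_range' _ _ _ (by omega), add_comm]
  · obtain ⟨j, rfl⟩ : ∃ j, k = L + 2 + j := ⟨k - (L + 2), by omega⟩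
    rw [show L + 2 + j - L = j + 1 + 1 by omega, ofNat_succ, cond_node,
      show L + 2 + j = L + 1 + j + 1 by ring, ofNat_succ, tl_node,
      get_ofNat (by rw [cap]; omega), toList_ofList, List.getD_append_right _ _ _ _ (by simp),
      List.length_map, List.length_range', show L + 1 + j - (L + 1) = j by omega,
      getD_map_range' _ _ _ (by omega)]
    congr 1
    ring

end Val

instance Feas.getSkip {P : PairingSystem} {a b : ℕ → ℕ → Val → Val} [Feas P a] [Feas P b] :
    Feas P fun n L v => Val.getSkip L (a n L v) (b n L v) := by
  unfold Val.getSkip; infer_instance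

instance Feas.one {P : PairingSystem} : Feas P fun _ _ _ => Val.one := by
  unfold Val.one; infer_instance

namespace BilinearGroup

variable (𝔹 : BilinearGroup)

theorem encScalar_zero : 𝔹.encScalar 0 = Val.nil := by
  simp [encScalar, Val.ofBits]

theorem encScalar_one : 𝔹.encScalar 1 = Val.node Val.one Val.nil := by
  simp [encScalar, ZMod.val_one, Val.ofBits, Val.ofList, Val.ofBool, Val.one]

theorem randFun_cons_comm (i j : ℕ) (h : i ≠ j) (l : List ℕ) :
    𝔹.randFun (i :: j :: l) = 𝔹.randFun (j :: i :: l) := by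
  simp only [randFun, PMF.map_bind, PMF.map_comp]
  rw [PMF.bind_comm]
  congr 1
  funext x
  congr 1
  funext y
  congr 1
  funext f
  exact Function.update_comm h.symm _ _ _

/-- `randListV` conses its samples and thereby draws them in reverse order. Without repeated indices
the updates commute. -/
theorem randFun_perm {l l' : List ℕ} (h : l.Perm l') (hl : l.Nodup) :
    𝔹.randFun l = 𝔹.randFun l' := by
  induction h with
  | nil => rfl
  | cons x h ih => rw [randFun, randFun, ih (List.nodup_cons.mp hl).2]
  | swap x y l =>
    refine 𝔹.randFun_cons_comm y x ?_ l
    have := List.nodup_cons.mp hl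
    intro h
    exact this.1 (by simp [h])
  | trans h₁ h₂ ih₁ ih₂ => exact (ih₁ hl).trans (ih₂ (h₁.nodup_iff.mp hl))

theorem randScalar_bind_shift {α : Type} (c : ZMod 𝔹.p) (f : ZMod 𝔹.p → PMF α) :
    (𝔹.randScalar.bind fun x => f (x + c)) = 𝔹.randScalar.bind f := by
  conv_rhs => rw [← 𝔹.randScalar_shift c, PMF.bind_map]
  rfl

/-- Uniform exponents absorb any fixed offset. This is why keys with an embedded secret have the
distribution of honest keys. -/
theorem randFun_shift (l : List ℕ) (c : ℕ → ZMod 𝔹.p) :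
    (𝔹.randFun l).map (fun f j => if j ∈ l then f j + c j else f j) = 𝔹.randFun l := by
  induction l with
  | nil =>
    rw [randFun, PMF.pure_map]
    simp only [List.not_mem_nil, if_false]
  | cons i l ih =>
    rw [randFun, PMF.map_bind]
    conv_rhs => rw [← 𝔹.randScalar_bind_shift (c i), ← ih]
    congr 1
    funext x
    rw [PMF.map_comp, PMF.map_comp]
    congr 1
    funext f j
    simp only [Function.comp_apply]
    by_cases hj : j = i
    · subst hj; simp
    · simp [hj]

end BilinearGroup

section RandomList

variable {P : PairingSystem}

/-- A list of `L` random scalars, with the group description in front. -/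
def randListV (P : PairingSystem) (L : ℕ) (D : Val) : PMF Val :=
  iterate (fun v => (Prim.scalarRand.eval P [v.hd]).map fun z => Val.node v.hd (Val.node z v.tl)) L
    (Val.node D Val.nil)

instance {f : ℕ → ℕ → Val → Val} [Feas P f] : FeasR P fun n L v => randListV P L (f n L v) :=
  FeasR.iterate (f := fun _ _ v => (Prim.scalarRand.eval P [v.hd]).map fun z =>
    Val.node v.hd (Val.node z v.tl)) (a := fun n L v => Val.node (f n L v) Val.nil)
    inferInstance inferInstance

theorem randListV_eq (L : ℕ) (d : P.Desc) : randListV P L (P.descVal d) =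
    ((P.grp d).randFun (List.range' 1 L)).map fun γ => Val.node (P.descVal d)
      (Val.ofList ((List.range' 1 L).map fun j => (P.grp d).encScalar (γ j))) := by
  rw [(P.grp d).randFun_perm (List.reverse_perm _).symm (List.nodup_range' ..)]
  have : ∀ (k : ℕ) (l : List Val), iterate (fun v => (Prim.scalarRand.eval P [v.hd]).map fun z =>
      Val.node v.hd (Val.node z v.tl)) k (Val.node (P.descVal d) (Val.ofList l)) =
      ((P.grp d).randFun (List.range' 1 k).reverse).map fun γ => Val.node (P.descVal d)
        (Val.ofList ((List.range' 1 k).map (fun j => (P.grp d).encScalar (γ j)) ++ l)) := by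
    intro k
    induction k with
    | zero => intro l; simp [iterate, BilinearGroup.randFun, PMF.pure_map]
    | succ k ih =>
      intro l
      rw [iterate, Val.hd_node, eval_scalarRand, PMF.map_comp, PMF.bind_map]
      rw [List.range'_1_concat, List.reverse_append, List.reverse_singleton,
        List.singleton_append, BilinearGroup.randFun, PMF.map_bind]
      congr 1
      funext x
      have h := ih ((P.grp d).encScalar x :: l)
      rw [PMF.map_comp]
      refine h.trans ?_
      congr 1
      funext f
      simp only [Function.comp_apply, List.map_append, List.append_assoc]
      refine congrArg (Val.node _) (congrArg Val.ofList ?_)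
      congr 1
      · refine List.map_congr_left fun j hj => ?_
        rw [List.mem_range'_1] at hj
        rw [Function.update_of_ne (by omega)]
      · simp
  have := this L []
  simpa [randListV] using this

/-- One step of the choice of a random index below a power of two. -/
def doubleV (L : ℕ) (v b : Val) : Val :=
  Val.cond (Val.dropBy L v.tl (Val.ofNat L))
    (.node (Val.cond b (Val.uadd L v.tl v.hd) v.hd) (Val.uadd L v.tl v.tl)) v

/-- A random index, in unary; all indices below `L` are reasonably likely. -/
def randIndex (L : ℕ) : PMF Val :=
  (iterate (fun v => ((PMF.uniformOfFintype Bool).map Val.ofBool).bind fun b =>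
    PMF.pure (doubleV L v b)) L (.node Val.nil Val.one)).map Val.hd

instance : FeasR P fun _ L _ => randIndex L := by
  have := FeasR.iterate (P := P) (f := fun _ L v =>
    ((PMF.uniformOfFintype Bool).map Val.ofBool).bind fun b => PMF.pure (doubleV L v b))
    (by unfold doubleV; infer_instance) (a := fun _ _ _ => .node Val.nil Val.one) inferInstance
  unfold randIndex
  infer_instance

theorem two_mul_pr_flip {α : Type} (g : Bool → PMF α) (A : α → Prop) :
    2 * pr ((PMF.uniformOfFintype Bool).bind g) A = pr (g false) A + pr (g true) A := by
  rw [pr_bind, tsum_bool, PMF.uniformOfFintype_apply, PMF.uniformOfFintype_apply, ← mul_add,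
    ← mul_assoc, Fintype.card_bool, Nat.cast_ofNat, ENNReal.mul_inv_cancel (by simp) (by simp),
    one_mul]

-- While `s` doubles, the index stays uniform below `s`; it ends at `K` if after each doubling it
-- equals `K mod s`, which fixes one coin per doubling. Doubling stops at the first power of two
-- that is at least `L`, hence below `2 L`, so no value below `L` has probability less than
-- `1/(2L)`.
open scoped ENNReal in
theorem randIndex_ge {L K : ℕ} (hK : K < L) :
    1 ≤ 2 * (L : ℝ≥0∞) * pr (randIndex L) (fun v => v = Val.ofNat K) := by
  have key : ∀ r k s : ℕ, 1 ≤ s → s ≤ 2 * L → L ≤ s * 2 ^ r → k = K % s →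
      (s : ℝ≥0∞) ≤ 2 * (L : ℝ≥0∞) * pr (iterate (fun v =>
        ((PMF.uniformOfFintype Bool).map Val.ofBool).bind fun b => PMF.pure (doubleV L v b)) r
          (.node (Val.ofNat k) (Val.ofNat s))) (fun v => v.hd = Val.ofNat K) := by
    intro r
    induction r with
    | zero =>
      intro k s h₁ h₂ h₃ hk
      rw [pow_zero, mul_one] at h₃
      rw [Nat.mod_eq_of_lt (by omega)] at hk
      subst hk
      classical
      rw [iterate, pr_pure, if_pos (Val.hd_node _ _), mul_one]
      exact_mod_cast h₂
    | succ r ih =>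
      intro k s h₁ h₂ h₃ hk
      have hd : Val.dropBy L (Val.ofNat s) (Val.ofNat L) = Val.ofNat (L - s) := by
        rw [Val.dropBy_eq (by rw [Val.len_ofNat, cap]; omega), Val.len_ofNat,
          Val.tl_iterate_ofNat]
      by_cases hs : L ≤ s
      · have hstay : ∀ b, doubleV L (.node (Val.ofNat k) (Val.ofNat s)) b =
            .node (Val.ofNat k) (Val.ofNat s) := by
          intro b
          rw [doubleV, Val.tl_node, hd, Nat.sub_eq_zero_of_le hs]
          rfl
        rw [iterate]
        simp only [hstay, PMF.bind_const, PMF.pure_bind]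
        exact ih k s h₁ h₂ (hs.trans (Nat.le_mul_of_pos_right _ (by positivity))) hk
      · have hstep : ∀ b : Bool, doubleV L (.node (Val.ofNat k) (Val.ofNat s)) (Val.ofBool b) =
            .node (Val.ofNat (if b then s + k else k)) (Val.ofNat (s + s)) := by
          intro b
          obtain ⟨j, hj⟩ : ∃ j, L - s = j + 1 := ⟨L - s - 1, by omega⟩
          rw [doubleV, Val.tl_node, Val.hd_node, hd, hj, Val.ofNat_succ, Val.cond_node,
            Val.uadd_ofNat (by rw [cap]; omega), Val.uadd_ofNat (by rw [cap]; omega)]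
          cases b <;> rfl
        rw [iterate, PMF.bind_bind, PMF.bind_map]
        simp only [Function.comp_def, PMF.pure_bind, hstep]
        obtain ⟨b, hb⟩ : ∃ b : Bool, (if b then s + k else k) = K % (s + s) := by
          have := Nat.mod_mul (a := s) (b := 2) (x := K)
          rw [← two_mul, mul_comm 2, this, ← hk]
          rcases Nat.mod_two_eq_zero_or_one (K / s) with h | h
          · exact ⟨false, by simp [h]⟩
          · exact ⟨true, by simp [h, add_comm]⟩
        have h := ih _ (s + s) (by omega) (by omega) (by rw [pow_succ] at h₃; linarith) hb
        have h2 : (2 : ℝ≥0∞) ≠ 0 := by simp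
        rw [← ENNReal.mul_le_mul_iff_right h2 (by simp), mul_left_comm, two_mul_pr_flip]
        refine le_trans (by push_cast; rw [two_mul]) (h.trans ?_)
        gcongr
        cases b
        · exact le_self_add
        · exact le_add_self
  -- `L` rounds suffice because `L ≤ 2 ^ L`.
  have := key L 0 1 le_rfl (by omega) (by rw [one_mul]; exact Nat.lt_two_pow_self.le)
    (by rw [Nat.mod_one])
  rw [randIndex, pr_map]
  exact_mod_cast this

end RandomList

end DBE
end

noncomputable section
namespace DBE

/-! ## The first simulation -/

section Preparation

variable (P : PairingSystem)

open Prim Val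

/-- Inverses in `G` and `Gh`. -/
def invG (D x : Val) : Val := powG.det P [D, x, scalarNeg.det P [D, .node one .nil]]
def invGh (D x : Val) : Val := powGh.det P [D, x, scalarNeg.det P [D, .node one .nil]]

variable {P} in
@[simp] theorem invG_eq (d : P.Desc) (x : (P.grp d).G) :
    invG P (P.descVal d) (P.encG d x) = P.encG d x⁻¹ := by
  rw [invG, ← (P.grp d).encScalar_one, det_scalarNeg, det_powG, pow_val_neg, pow_val_one]

variable {P} in
@[simp] theorem invGh_eq (d : P.Desc) (x : (P.grp d).Gh) :
    invGh P (P.descVal d) (P.encGh d x) = P.encGh d x⁻¹ := by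
  rw [invGh, ← (P.grp d).encScalar_one, det_scalarNeg, det_powGh, pow_val_neg, pow_val_one]

instance Feas.invG {a b : ℕ → ℕ → Val → Val} [Feas P a] [Feas P b] :
    Feas P fun n L v => DBE.invG P (a n L v) (b n L v) := by
  unfold DBE.invG; infer_instance

instance Feas.invGh {a b : ℕ → ℕ → Val → Val} [Feas P a] [Feas P b] :
    Feas P fun n L v => DBE.invGh P (a n L v) (b n L v) := by
  unfold DBE.invGh; infer_instance

namespace Sim₁

/-- The input consists of a BDHE challenge, the hash keys, `β'` and the `γ'`. -/
def input {n : ℕ} (L : ℕ) (x : Theta P n) (Z : (P.grp x.d).GT) : Val :=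
  .node (ofList [P.descVal x.d, P.encG x.d x.g,
    ofList (((List.range' 1 (2 * L + 2)).filter (· ≠ L + 2)).map
      fun k => P.encG x.d (x.g ^ (x.α ^ k).val)),
    P.encG x.d (x.g ^ x.t.val), P.encGh x.d x.gh,
    ofList ((List.range' 1 (L + 1)).map fun k => P.encGh x.d (x.gh ^ (x.α ^ k).val)),
    P.encGh x.d (x.gh ^ x.t.val), P.encGT x.d Z])
  (.node (P.encKey1 n x.d x.κ₁) (.node (P.encKey2 n x.d x.κ₂)
    (.node ((P.grp x.d).encScalar (x.β + x.ω * x.α ^ (L + 1)))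
      (ofList ((List.range' 1 L).map fun j => (P.grp x.d).encScalar (x.γ j + x.α ^ j))))))

def D (w : Val) : Val := w.hd.hd
def g (w : Val) : Val := w.hd.tl.hd
def As (w : Val) : Val := w.hd.tl.tl.hd
def gc (w : Val) : Val := w.hd.tl.tl.tl.hd
def gh (w : Val) : Val := w.hd.tl.tl.tl.tl.hd
def Ahs (w : Val) : Val := w.hd.tl.tl.tl.tl.tl.hd
def ghc (w : Val) : Val := w.hd.tl.tl.tl.tl.tl.tl.hd
def Z (w : Val) : Val := w.hd.tl.tl.tl.tl.tl.tl.tl.hd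
def κ₁ (w : Val) : Val := w.tl.hd
def κ₂ (w : Val) : Val := w.tl.tl.hd
def β (w : Val) : Val := w.tl.tl.tl.hd
def γ (w : Val) : Val := w.tl.tl.tl.tl

instance {f : ℕ → ℕ → Val → Val} [Feas P f] : Feas P fun n L v => D (f n L v) := by
  unfold D; infer_instance
instance {f : ℕ → ℕ → Val → Val} [Feas P f] : Feas P fun n L v => g (f n L v) := by
  unfold g; infer_instance
instance {f : ℕ → ℕ → Val → Val} [Feas P f] : Feas P fun n L v => As (f n L v) := by
  unfold As; infer_instance
instance {f : ℕ → ℕ → Val → Val} [Feas P f] : Feas P fun n L v => gc (f n L v) := by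
  unfold gc; infer_instance
instance {f : ℕ → ℕ → Val → Val} [Feas P f] : Feas P fun n L v => gh (f n L v) := by
  unfold gh; infer_instance
instance {f : ℕ → ℕ → Val → Val} [Feas P f] : Feas P fun n L v => Ahs (f n L v) := by
  unfold Ahs; infer_instance
instance {f : ℕ → ℕ → Val → Val} [Feas P f] : Feas P fun n L v => ghc (f n L v) := by
  unfold ghc; infer_instance
instance {f : ℕ → ℕ → Val → Val} [Feas P f] : Feas P fun n L v => Z (f n L v) := by
  unfold Z; infer_instance
instance {f : ℕ → ℕ → Val → Val} [Feas P f] : Feas P fun n L v => κ₁ (f n L v) := by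
  unfold κ₁; infer_instance
instance {f : ℕ → ℕ → Val → Val} [Feas P f] : Feas P fun n L v => κ₂ (f n L v) := by
  unfold κ₂; infer_instance
instance {f : ℕ → ℕ → Val → Val} [Feas P f] : Feas P fun n L v => β (f n L v) := by
  unfold β; infer_instance
instance {f : ℕ → ℕ → Val → Val} [Feas P f] : Feas P fun n L v => γ (f n L v) := by
  unfold γ; infer_instance

def ω (n _L : ℕ) (w : Val) : Val := hash1.det P [ofNat n, D w, κ₁ w, ghc w, nil]

instance : Feas P (ω P) := by unfold ω; infer_instance

instance {f : ℕ → ℕ → Val → Val} [Feas P f] : Feas P fun n L v => ω P n L (f n L v) :=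
  Feas.comp' (f := ω P) inferInstance inferInstance

/-- This is `g^(β' - ω* α^(L+1))`; position `L` of the list holds `A_{L+1}`. -/
def B (n L : ℕ) (w : Val) : Val :=
  mulG.det P [D w, powG.det P [D w, g w, β w],
    powG.det P [D w, getSkip L (As w) (ofNat L), scalarNeg.det P [D w, ω P n L w]]]

instance : Feas P (B P) := by unfold B; infer_instance

def Bs (n L : ℕ) (w : Val) : Val := build L (fun _ => one) (fun i =>
  mulG.det P [D w, powG.det P [D w, getSkip L (As w) (.node nil i), β w],
    powG.det P [D w, getSkip L (As w) (uadd L (ofNat L) (.node nil (.node nil i))),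
      scalarNeg.det P [D w, ω P n L w]]]) (ofNat L)

instance : Feas P (Bs P) := by unfold Bs; infer_instance

/-- The entry for `A_k` is `A_k^(γ'_j) / A_{k+j}`. The omitted index `k = L + 2 - j` is exactly the
one for which the denominator is missing from the challenge. -/
def Ws (_n L : ℕ) (x : Val) : Val := build L
  (fun m => not (beq (.node nil (uadd L x.tl m)) (ofNat L)))
  (fun m => mulG.det P [D x.hd, powG.det P [D x.hd, getSkip L (As x.hd) (.node nil m),
      get L (γ x.hd) x.tl],
    invG P (D x.hd) (getSkip L (As x.hd) (uadd L x.tl (.node nil (.node nil m))))]) (ofNat L)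

instance {f : ℕ → ℕ → Val → Val} [Feas P f] : Feas P fun n L v => Ws P n L (f n L v) :=
  Feas.comp' (f := Ws P) (by unfold Ws; infer_instance) inferInstance

def upks (n L : ℕ) (w : Val) : Val := build L (fun _ => one) (fun i => ofList [
    .node nil i,
    mulG.det P [D w, powG.det P [D w, g w, get L (γ w) i], invG P (D w) (getSkip L (As w) i)],
    mulGh.det P [D w, powGh.det P [D w, gh w, get L (γ w) i], invGh P (D w) (get L (Ahs w) i)],
    Ws P n L (.node w i)]) (ofNat L)

instance : Feas P (upks P) := by unfold upks; infer_instance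

def pows (_n L : ℕ) (x : Val) : Val :=
  build L (fun _ => one) (fun i => powG.det P [D x.hd, x.tl, get L (γ x.hd) i]) (ofNat L)

instance {f : ℕ → ℕ → Val → Val} [Feas P f] : Feas P fun n L v => pows P n L (f n L v) :=
  Feas.comp' (f := pows P) (by unfold pows; infer_instance) inferInstance

/-- The initial state of the challenger. -/
def state (n L : ℕ) (w : Val) : Val :=
  .node (ofList [D w, κ₁ w, κ₂ w,
    ofList [D w, g w, gh w, As w, Ahs w, B P n L w, Bs P n L w,
      pair.det P [D w, getSkip L (As w) (ofNat L), (Ahs w).hd], κ₁ w, κ₂ w],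
    upks P n L w, getSkip L (As w) (ofNat L), B P n L w, pows P n L (.node w (g w)),
    gh w, ghc w, powG.det P [D w, gc w, β w], pows P n L (.node w (gc w)),
    hash2.det P [ofNat n, D w, κ₂ w, Z w], (Ahs w).hd,
    invG P (D w) (powG.det P [D w, getSkip L (As w) nil, β w]),
    pows P n L (.node w (invG P (D w) (getSkip L (As w) nil))),
    .node one nil, scalarNeg.det P [D w, ω P n L w], nil, nil, nil])
  (.node nil (.node nil (.node nil (.node nil nil))))

set_option synthInstance.maxHeartbeats 100000 in
set_option synthInstance.maxSize 1000 in
instance : Feas P (state P) := by unfold state; infer_instance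

end Sim₁

end Preparation

end DBE
end

/-! ### The state prepared by the first simulation -/

noncomputable section
namespace DBE

section Preparation

variable {P : PairingSystem}

open Prim Val

namespace Sim₁

variable {n : ℕ} (L : ℕ) (x : Theta P n) (Z' : (P.grp x.d).GT)

@[simp] theorem D_input : D (input P L x Z') = P.descVal x.d := rfl
@[simp] theorem g_input : g (input P L x Z') = P.encG x.d x.g := rfl
@[simp] theorem gc_input : gc (input P L x Z') = P.encG x.d (x.g ^ x.t.val) := rfl
@[simp] theorem gh_input : gh (input P L x Z') = P.encGh x.d x.gh := rfl
@[simp] theorem ghc_input : ghc (input P L x Z') = P.encGh x.d (x.gh ^ x.t.val) := rfl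
@[simp] theorem Z_input : Z (input P L x Z') = P.encGT x.d Z' := rfl
@[simp] theorem κ₁_input : κ₁ (input P L x Z') = P.encKey1 n x.d x.κ₁ := rfl
@[simp] theorem κ₂_input : κ₂ (input P L x Z') = P.encKey2 n x.d x.κ₂ := rfl
@[simp] theorem β_input : β (input P L x Z') =
    (P.grp x.d).encScalar (x.β + x.ω * x.α ^ (L + 1)) := rfl

theorem As_input {k : ℕ} (h₁ : k ≤ 2 * L + 1) (h₂ : k ≠ L + 1) :
    getSkip L (As (input P L x Z')) (ofNat k) = P.encG x.d (x.g ^ (x.α ^ (k + 1)).val) :=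
  getSkip_eq h₁ h₂ _

theorem Ahs_input {i : ℕ} (hi : i < L + 1) :
    get L (Ahs (input P L x Z')) (ofNat i) = P.encGh x.d (x.gh ^ (x.α ^ (1 + i)).val) :=
  get_map hi (by rw [cap]; omega) _

@[simp] theorem hd_Ahs_input :
    (Ahs (input P L x Z')).hd = P.encGh x.d (x.gh ^ x.α.val) := by
  have : (Ahs (input P L x Z')).hd = P.encGh x.d (x.gh ^ (x.α ^ 1).val) := rfl
  rw [this, pow_one]

theorem γ_input {i : ℕ} (hi : i < L) : get L (γ (input P L x Z')) (ofNat i) =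
    (P.grp x.d).encScalar (x.γ (1 + i) + x.α ^ (1 + i)) :=
  get_map hi (by rw [cap]; omega) fun j => (P.grp x.d).encScalar (x.γ j + x.α ^ j)

@[simp] theorem ω_input : ω P n L (input P L x Z') = (P.grp x.d).encScalar x.ω := by
  rw [ω, D_input, κ₁_input, ghc_input, det_hash1]
  rfl

@[simp] theorem B_input : B P n L (input P L x Z') = P.encG x.d (x.g ^ x.β.val) := by
  rw [B, ω_input, D_input, g_input, β_input, As_input L x Z' (by omega) (by omega)]
  simp only [det_scalarNeg, det_powG, det_mulG, ← pow_val_mul, ← pow_val_add]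
  congr 3
  ring

theorem Bs_input : Bs P n L (input P L x Z') = ofList ((List.range' 2 L).map fun k =>
    P.encG x.d ((x.g ^ (x.α ^ k).val) ^ x.β.val)) := by
  refine build_map (by rw [cap]; omega) fun i hi => ?_
  rw [← ofNat_succ, ← ofNat_succ, uadd_ofNat (by rw [cap]; omega), ω_input, D_input, β_input,
    As_input L x Z' (by omega) (by omega), As_input L x Z' (by omega) (by omega)]
  simp only [det_scalarNeg, det_powG, det_mulG, ← pow_val_mul, ← pow_val_add]
  congr 3
  ring

theorem Ws_input {i : ℕ} (hi : i < L) : Ws P n L (.node (input P L x Z') (ofNat i)) =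
    ofList (((List.range' 2 L).filter (· ≠ L + 2 - (1 + i))).map fun k =>
      P.encG x.d ((x.keys L (1 + i) (x.γ (1 + i))).2.W k)) := by
  refine build_filter (q := fun k => k ≠ L + 2 - (1 + i)) (by rw [cap]; omega)
    (fun m hm => ?_) fun m hm hq => ?_
  · rw [tl_node, uadd_ofNat (by rw [cap]; omega), ← ofNat_succ, beq, Val.not, cond_def, toBool_ofBool]
    by_cases h : i + m + 1 = L
    · simp [h]
      omega
    · have h' : ¬ ofNat (i + m + 1) = ofNat L := fun h' => h (ofNat_inj h')
      simp [h']
      omega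
  · rw [tl_node, hd_node, ← ofNat_succ, ← ofNat_succ, uadd_ofNat (by rw [cap]; omega), D_input,
      As_input L x Z' (by omega) (by omega), As_input L x Z' (by omega) (by omega),
      γ_input L x Z' hi]
    have : (x.keys L (1 + i) (x.γ (1 + i))).2.W (2 + m) =
        (x.g ^ (x.α ^ (2 + m)).val) ^ (x.γ (1 + i)).val := by
      show (if 2 + m = L + 2 - (1 + i) then 1 else
        (if 2 + m = L + 2 then 1 else x.g ^ (x.α ^ (2 + m)).val) ^ (x.γ (1 + i)).val) = _
      rw [if_neg hq, if_neg (by omega)]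
    rw [this, det_powG, invG_eq, det_mulG]
    simp only [← pow_val_mul, ← pow_val_add, ← pow_val_neg]
    congr 3
    ring

theorem upks_input : upks P n L (input P L x Z') = ofList ((List.range' 1 L).map fun j =>
    (x.pp L).encUPK j (x.keys L j (x.γ j)).2) := by
  refine build_map (by rw [cap]; omega) fun i hi => ?_
  rw [Ws_input L x Z' hi, ← ofNat_succ, D_input, g_input, gh_input, γ_input L x Z' hi,
    As_input L x Z' (by omega) (by omega), Ahs_input L x Z' (by omega)]
  have h₁ : x.g ^ (x.γ (1 + i) + x.α ^ (1 + i)).val * (x.g ^ (x.α ^ (i + 1)).val)⁻¹ =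
      x.g ^ (x.γ (1 + i)).val := by
    rw [← pow_val_neg, ← pow_val_add, add_comm i, add_neg_cancel_right]
  have h₂ : x.gh ^ (x.γ (1 + i) + x.α ^ (1 + i)).val * (x.gh ^ (x.α ^ (1 + i)).val)⁻¹ =
      x.gh ^ (x.γ (1 + i)).val := by
    rw [← pow_val_neg, ← pow_val_add, add_neg_cancel_right]
  rw [det_powG, invG_eq, det_mulG, det_powGh, invGh_eq, det_mulGh, h₁, h₂, add_comm i]
  rfl

theorem pows_input (y : (P.grp x.d).G) : pows P n L (.node (input P L x Z') (P.encG x.d y)) =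
    ofList ((List.range' 1 L).map fun j => P.encG x.d (y ^ (x.γ j + x.α ^ j).val)) := by
  refine build_map (by rw [cap]; omega) fun i hi => ?_
  rw [tl_node, hd_node, D_input, γ_input L x Z' hi, det_powG]

theorem state_input (μ : Bool) :
    state P n L (input P L x (if μ then x.R else
      (P.grp x.d).e x.g x.gh ^ (x.α ^ (L + 2) * x.t).val)) =
    (x.sim₁ L μ).encState L nil Full.init := by
  generalize hZ : (if μ then x.R else
      (P.grp x.d).e x.g x.gh ^ (x.α ^ (L + 2) * x.t).val) = Z'
  have h₀ : getSkip L (As (input P L x Z')) nil = P.encG x.d (x.g ^ x.α.val) := by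
    have := As_input L x Z' (k := 0) (by omega) (by omega)
    rwa [zero_add, pow_one] at this
  rw [state, h₀, As_input L x Z' (by omega) (by omega), B_input, Bs_input, upks_input]
  simp only [D_input, invG_eq, g_input, gc_input, pows_input, β_input, det_powG, hd_Ahs_input,
    κ₁_input, κ₂_input, gh_input, ghc_input, ω_input, det_scalarNeg, Z_input, det_hash2, det_pair,
    ← pow_val_mul, ← pow_val_neg]
  have hA : As (input P L x Z') = ofList (((List.range' 1 (2 * L + 2)).filter (· ≠ L + 2)).map
      fun k => P.encG x.d (x.A L k)) := by
    refine congrArg ofList (List.map_congr_left fun k hk => ?_)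
    have hk : k ≠ L + 2 := by simpa using (List.mem_filter.mp hk).2
    rw [Par.A, if_neg hk]
  have hΩ : (P.grp x.d).e (x.g ^ (x.α ^ (L + 1)).val) (x.gh ^ x.α.val) =
      (P.grp x.d).e (x.g ^ (x.α ^ (L + 2)).val) x.gh := by
    rw [BilinearGroup.e_pow_right, BilinearGroup.e_pow_left, BilinearGroup.e_pow_left,
      ← pow_val_mul, ← pow_succ]
  have hcB : x.t * (x.β + x.ω * x.α ^ (L + 1)) = (x.α ^ (L + 1) * x.ω + x.β) * x.t := by ring
  have hTc : ∀ j, x.t * (x.γ j + x.α ^ j) = (x.α ^ j + x.γ j) * x.t := fun j => by ring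
  have hTF : ∀ j, x.γ j + x.α ^ j = x.α ^ j + x.γ j := fun j => add_comm _ _
  have hTq : ∀ j, -x.α * (x.γ j + x.α ^ j) = -(x.α * (x.γ j + x.α ^ j)) := fun j => neg_mul _ _
  have hBs : ∀ k, x.g ^ (x.α ^ k * x.β).val = (x.g ^ (x.α ^ k).val) ^ x.β.val :=
    fun k => pow_val_mul _ _ _
  simp only [hTq, hBs]
  rw [hΩ, hcB, hA]
  simp only [hTc]
  rw [← hZ]
  have e₁ : ofList ((List.range' 1 L).map fun j => P.encG x.d (x.g ^ (x.γ j + x.α ^ j).val)) =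
      ofList ((List.range' 1 L).map fun j => P.encG x.d (x.g ^ (x.α ^ j + x.γ j).val)) := by
    simp only [hTF]
  rw [e₁, ← (P.grp x.d).encScalar_one]
  rfl

end Sim₁

end Preparation

end DBE
end

/-! ### The distribution of the first simulation -/

noncomputable section
namespace DBE

section Preparation

open Prim Val

/-- The independent samples are permuted so that `t` and the hash key, and with them `ω*`, are fixed
before `β`. -/
theorem PMF.bind_reorder {α₁ α₂ α₃ α₄ α₅ α₆ β : Type} (p₁ : PMF α₁) (p₂ : PMF α₂) (p₃ : PMF α₃)
    (p₄ : PMF α₄) (p₅ : PMF α₅) (p₆ : PMF α₆) (f : α₁ → α₂ → α₃ → α₄ → α₅ → α₆ → PMF β) :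
    (p₁.bind fun a₁ => p₂.bind fun a₂ => p₃.bind fun a₃ => p₄.bind fun a₄ => p₅.bind fun a₅ =>
      p₆.bind fun a₆ => f a₁ a₂ a₃ a₄ a₅ a₆) =
    p₅.bind fun a₅ => p₆.bind fun a₆ => p₂.bind fun a₂ => p₃.bind fun a₃ => p₁.bind fun a₁ =>
      p₄.bind fun a₄ => f a₁ a₂ a₃ a₄ a₅ a₆ := by
  simp only [PMF.bind_comm p₄ p₅, PMF.bind_comm p₃ p₅, PMF.bind_comm p₂ p₅, PMF.bind_comm p₁ p₅,
    PMF.bind_comm p₄ p₆, PMF.bind_comm p₃ p₆, PMF.bind_comm p₂ p₆, PMF.bind_comm p₁ p₆,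
    PMF.bind_comm p₁ p₂, PMF.bind_comm p₁ p₃]

/-- The first simulation: keys and randomness are added to a BDHE challenge. -/
def prep₁ (P : PairingSystem) (n L : ℕ) (x : Val) : PMF Val :=
  (genKey1.eval P [ofNat n, x.hd]).bind fun κ₁ => (genKey2.eval P [ofNat n, x.hd]).bind fun κ₂ =>
    (scalarRand.eval P [x.hd]).bind fun β => (randListV P L x.hd).map fun γ =>
      Sim₁.state P n L (.node x (.node κ₁ (.node κ₂ (.node β γ.tl))))

variable (P : PairingSystem)

instance {f : ℕ → ℕ → Val → Val} [Feas P f] : Feas P fun n L v => Sim₁.state P n L (f n L v) :=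
  Feas.comp' (f := Sim₁.state P) inferInstance inferInstance

instance feasR_prep₁ : FeasR P (prep₁ P) := by unfold prep₁; infer_instance

variable {P} {n : ℕ} (L : ℕ)

theorem bdheChallenge_eq (b : Bool) : bdheChallenge P n (L + 1) b = (P.gen n).bind fun d => (P.grp d).randG.bind fun g =>
      (P.grp d).randGh.bind fun gh => (P.grp d).randScalar.bind fun α =>
      (P.grp d).randScalar.bind fun c => (P.grp d).randScalar.bind fun w => PMF.pure (ofList [
    P.descVal d, P.encG d g,
    ofList (((List.range' 1 (2 * L + 2)).filter (· ≠ L + 2)).map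
      fun k => P.encG d (g ^ (α ^ k).val)),
    P.encG d (g ^ c.val), P.encGh d gh,
    ofList ((List.range' 1 (L + 1)).map fun k => P.encGh d (gh ^ (α ^ k).val)),
    P.encGh d (gh ^ c.val),
    P.encGT d ((P.grp d).e g gh ^ (if b then w else α ^ (L + 2) * c).val)]) := rfl

theorem thetaDist_eq : thetaDist P n L = (P.gen n).bind fun d => (P.grp d).randG.bind fun g =>
      (P.grp d).randGh.bind fun gh => (P.grp d).randScalar.bind fun α =>
      (P.grp d).randScalar.bind fun β => (P.genKey1 n d).bind fun κ₁ => (P.genKey2 n d).bind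
      fun κ₂ => ((P.grp d).randFun (List.range' 1 L)).bind fun γ => (P.grp d).randScalar.bind
      fun t => (P.grp d).randGT.bind fun R => PMF.pure ⟨⟨d, g, gh, α, β, κ₁, κ₂⟩, γ, t, R⟩ := by
  rw [thetaDist]
  have : parDist P n = (P.gen n).bind fun d => (P.grp d).randG.bind fun g =>
    (P.grp d).randGh.bind fun gh => (P.grp d).randScalar.bind fun α =>
    (P.grp d).randScalar.bind fun β => (P.genKey1 n d).bind fun κ₁ => (P.genKey2 n d).bind
    fun κ₂ => PMF.pure ⟨d, g, gh, α, β, κ₁, κ₂⟩ := rfl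
  rw [this]
  simp only [PMF.bind_bind, PMF.pure_bind]
  rfl

/-- The secrets `a` and `c` of the challenge become `α` and `t`, and `w` becomes the discrete
logarithm of `R`. The uniform `β'` and `γ'_j` differ from `β` and `γ_j` by offsets that are fixed
when they are drawn, so the simulated parameters are distributed as in the experiment. -/
theorem bind_prep₁ (μ : Bool) : (bdheChallenge P n (L + 1) μ).bind (prep₁ P n L) =
    (thetaDist P n L).map fun y => (y.sim₁ L μ).encState L nil Full.init := by
  rw [bdheChallenge_eq, thetaDist_eq]
  simp only [PMF.bind_bind, PMF.map_bind, PMF.pure_bind, PMF.pure_map]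
  congr 1
  funext d
  refine bind_congr_support _ fun g hg => bind_congr_support _ fun gh hgh => ?_
  have hg := BilinearGroup.mem_support_randGenerator hg
  have hgh := BilinearGroup.mem_support_randGenerator hgh
  congr 1
  funext α
  -- `e g gh` generates `GT`, so a uniform `R` is a uniform power of it.
  have hT : (P.grp d).randGT = (P.grp d).randScalar.map fun a => (P.grp d).e g gh ^ a.val :=
    ((P.grp d).randScalar_map_pow (P.grp d).card_GT ((P.grp d).e_ne_one hg hgh) _).symm
  rw [PMF.bind_reorder, hT]
  simp only [PMF.bind_map]
  congr 1
  funext c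
  congr 1
  funext w
  have hd : ∀ l, (ofList (P.descVal d :: l)).hd = P.descVal d := fun _ => rfl
  simp only [prep₁, hd, eval_genKey1, eval_genKey2, eval_scalarRand, randListV_eq, PMF.bind_map,
    PMF.map_comp, Function.comp_def]
  congr 1
  funext κ₁
  congr 1
  funext κ₂
  -- The offset `ω* α^(L+1)` depends only on `α`, `c`, `gh` and the hash key, all of them drawn
  -- already.
  refine ((P.grp d).randScalar_bind_shift (P.H1 n d κ₁ (gh ^ c.val) [] * α ^ (L + 1)) _).symm.trans
    ?_
  congr 1
  funext β
  refine (congrArg (PMF.map _) ((P.grp d).randFun_shift _ fun j => α ^ j).symm).trans ?_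
  rw [PMF.map_comp]
  show PMF.map _ _ = PMF.map _ _
  congr 1
  funext γ
  have := Sim₁.state_input L ⟨⟨d, g, gh, α, β, κ₁, κ₂⟩, γ, c, (P.grp d).e g gh ^ w.val⟩ μ
  refine Eq.trans ?_ this
  have hγ : ∀ j ∈ List.range' 1 L, (P.grp d).encScalar
      (if j ∈ List.range' 1 L then γ j + α ^ j else γ j) = (P.grp d).encScalar (γ j + α ^ j) :=
    fun j hj => by rw [if_pos hj]
  have hw : (P.grp d).e g gh ^ (if μ then w else α ^ (L + 2) * c).val = if μ then
      (P.grp d).e g gh ^ w.val else (P.grp d).e g gh ^ (α ^ (L + 2) * c).val := by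
    cases μ <;> rfl
  rw [hw, Function.comp_apply, List.map_congr_left hγ]
  rfl

end Preparation

end DBE
end

noncomputable section
namespace DBE

/-! ## The second simulation -/

section Preparation

open Prim Val

namespace Sim₂

variable (P : PairingSystem)

/-- The part of the input that does not depend on the challenger's own choices: the group with
`g, g^a, g^t, ĝ, ĝ^a, ĝ^t`, the key of `H₁`, the guess, and auxiliary data. -/
def base {n : ℕ} {d : P.Desc} (g : (P.grp d).G) (gh : (P.grp d).Gh) (κ₁ : P.Key1 n d)
    (a t : ZMod (P.grp d).p) (k : ℕ) (b : Bool) (aux : Val) : Val :=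
  ofList [P.descVal d, P.encG d g, P.encG d (g ^ a.val), P.encG d (g ^ t.val),
    P.encGh d gh, P.encGh d (gh ^ a.val), P.encGh d (gh ^ t.val),
    P.encKey1 n d κ₁, ofNat k, ofBool b, aux]

/-- The challenger's own choices. -/
def own {n : ℕ} (L : ℕ) (x : Theta P n) (a : ZMod (P.grp x.d).p) (k : ℕ) (b μ : Bool)
    (w : ZMod (P.grp x.d).p) : Val :=
  ofList [P.encKey2 n x.d x.κ₂, (P.grp x.d).encScalar x.α,
    (P.grp x.d).encScalar (x.β + if b then a else 0),
    ofList ((List.range' 1 L).map fun j =>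
      (P.grp x.d).encScalar (x.γ j + if j = k + 1 then -a else 0)),
    ofBool μ, (P.grp x.d).encScalar w]

def input {n : ℕ} (L : ℕ) (x : Theta P n) (a : ZMod (P.grp x.d).p) (k : ℕ) (b μ : Bool)
    (w : ZMod (P.grp x.d).p) (aux : Val) : Val :=
  .node (base P x.g x.gh x.κ₁ a x.t k b aux) (own P L x a k b μ w)

def D (w : Val) : Val := w.hd.fld 0
def g (w : Val) : Val := w.hd.fld 1
def ga (w : Val) : Val := w.hd.fld 2
def gc (w : Val) : Val := w.hd.fld 3
def gh (w : Val) : Val := w.hd.fld 4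
def gha (w : Val) : Val := w.hd.fld 5
def ghc (w : Val) : Val := w.hd.fld 6
def κ₁ (w : Val) : Val := w.hd.fld 7
def k (w : Val) : Val := w.hd.fld 8
def b (w : Val) : Val := w.hd.fld 9
def κ₂ (w : Val) : Val := w.tl.fld 0
def α (w : Val) : Val := w.tl.fld 1
def β (w : Val) : Val := w.tl.fld 2
def γ (L : ℕ) (w i : Val) : Val := get L (w.tl.fld 3) i

/-- `α ^ (i + 1)` -/
def αpow (L : ℕ) (w i : Val) : Val :=
  fold (cap L) (fun _ acc => scalarMul.det P [D w, acc, α w]) i (α w)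

def A (L : ℕ) (w i : Val) : Val := powG.det P [D w, g w, αpow P L w i]

/-- The scalars `β` and `γ` read here are the masked ones. Dividing `B` by `g^a` and multiplying the
key of user `k + 1` by `g^a` restores the true values, and `a` cancels in the base for every set
that agrees with `b`. -/
def B (w : Val) : Val := cond (b w)
  (mulG.det P [D w, powG.det P [D w, g w, β w], invG P (D w) (ga w)])
  (powG.det P [D w, g w, β w])

def V (L : ℕ) (w i : Val) : Val := cond (beq i (k w))
  (mulG.det P [D w, powG.det P [D w, g w, γ L w i], ga w])
  (powG.det P [D w, g w, γ L w i])

def Vh (L : ℕ) (w i : Val) : Val := cond (beq i (k w))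
  (mulGh.det P [D w, powGh.det P [D w, gh w, γ L w i], gha w])
  (powGh.det P [D w, gh w, γ L w i])

def ω (n : ℕ) (w : Val) : Val := hash1.det P [ofNat n, D w, κ₁ w, ghc w, nil]

def W (L : ℕ) (x m : Val) : Val :=
  powG.det P [D x.hd, V P L x.hd x.tl, αpow P L x.hd (.node nil m)]

def upk (L : ℕ) (w i : Val) : Val := ofList [.node nil i, V P L w i, Vh P L w i,
  build L (fun m => not (beq (.node nil (uadd L i m)) (ofNat L))) (fun m => W P L (.node w i) m)
    (ofNat L)]

def pp (L : ℕ) (w : Val) : Val := ofList [D w, g w, gh w,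
  build L (fun m => not (beq m (.node nil (ofNat L)))) (fun m => A P L w m)
    (uadd L (ofNat L) (.node nil (.node nil (ofNat L)))),
  build L (fun _ => one) (fun m => powGh.det P [D w, gh w, αpow P L w m]) (.node nil (ofNat L)),
  B P w,
  build L (fun _ => one) (fun m => powG.det P [D w, B P w, αpow P L w (.node nil m)]) (ofNat L),
  pair.det P [D w, A P L w (.node nil (ofNat L)), gh w], κ₁ w, κ₂ w]

def ck (n L : ℕ) (w : Val) : Val := hash2.det P [ofNat n, D w, κ₂ w, cond (w.tl.fld 4)
  (powGT.det P [D w, pair.det P [D w, g w, gh w], w.tl.fld 5])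
  (powGT.det P [D w, pair.det P [D w, gc w, gh w], αpow P L w (.node nil (ofNat L))])]

/-- The initial state of the challenger. -/
def state (n L : ℕ) (w : Val) : Val :=
  .node (ofList [D w, κ₁ w, κ₂ w, pp P L w,
    build L (fun _ => one) (fun i => upk P L w i) (ofNat L), A P L w (ofNat L), B P w,
    build L (fun _ => one) (fun i => mulG.det P [D w, A P L w i, V P L w i]) (ofNat L),
    gh w, ghc w,
    powG.det P [D w, gc w, scalarAdd.det P [D w,
      scalarMul.det P [D w, αpow P L w (ofNat L), ω P n w], β w]],
    build L (fun _ => one) (fun i => powG.det P [D w, gc w,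
      scalarAdd.det P [D w, αpow P L w i, γ L w i]]) (ofNat L),
    ck P n L w, powGh.det P [D w, gh w, nil], A P L w (.node nil (ofNat L)),
    build L (fun _ => one) (fun _ => powG.det P [D w, g w, nil]) (ofNat L),
    nil, .node one nil, k w, b w, w.hd.fld 10])
  (.node nil (.node nil (.node nil (.node nil nil))))

section Instances

variable {P} {f i : ℕ → ℕ → Val → Val} [Feas P f] [Feas P i]

instance : Feas P fun n L v => D (f n L v) := by unfold D; infer_instance
instance : Feas P fun n L v => g (f n L v) := by unfold g; infer_instance
instance : Feas P fun n L v => ga (f n L v) := by unfold ga; infer_instance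
instance : Feas P fun n L v => gc (f n L v) := by unfold gc; infer_instance
instance : Feas P fun n L v => gh (f n L v) := by unfold gh; infer_instance
instance : Feas P fun n L v => gha (f n L v) := by unfold gha; infer_instance
instance : Feas P fun n L v => ghc (f n L v) := by unfold ghc; infer_instance
instance : Feas P fun n L v => κ₁ (f n L v) := by unfold κ₁; infer_instance
instance : Feas P fun n L v => k (f n L v) := by unfold k; infer_instance
instance : Feas P fun n L v => b (f n L v) := by unfold b; infer_instance
instance : Feas P fun n L v => κ₂ (f n L v) := by unfold κ₂; infer_instance
instance : Feas P fun n L v => α (f n L v) := by unfold α; infer_instance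
instance : Feas P fun n L v => β (f n L v) := by unfold β; infer_instance
instance : Feas P fun n L v => γ L (f n L v) (i n L v) := by unfold γ; infer_instance

instance : Feas P fun n L v => αpow P L (f n L v) (i n L v) := by
  have : Feas P fun n L x => αpow P L x.hd x.tl := by unfold αpow; infer_instance
  exact Feas.comp' this (g := fun n L v => .node (f n L v) (i n L v)) inferInstance

instance : Feas P fun n L v => A P L (f n L v) (i n L v) := by unfold A; infer_instance
instance : Feas P fun n L v => B P (f n L v) := by unfold B; infer_instance
instance : Feas P fun n L v => V P L (f n L v) (i n L v) := by unfold V; infer_instance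
instance : Feas P fun n L v => Vh P L (f n L v) (i n L v) := by unfold Vh; infer_instance
instance : Feas P fun n L v => ω P n (f n L v) := by unfold ω; infer_instance
instance : Feas P fun n L v => W P L (f n L v) (i n L v) := by unfold W; infer_instance

instance : Feas P fun n L v => upk P L (f n L v) (i n L v) := by
  have : Feas P fun n L x => upk P L x.hd x.tl := by unfold upk; infer_instance
  exact Feas.comp' this (g := fun n L v => .node (f n L v) (i n L v)) inferInstance

instance : Feas P fun n L v => pp P L (f n L v) := by
  have : Feas P fun n L x => pp P L x := by unfold pp; infer_instance
  exact Feas.comp' this inferInstance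

instance : Feas P (ck P) := by unfold ck; infer_instance

set_option synthInstance.maxHeartbeats 100000 in
set_option synthInstance.maxSize 1000 in
instance : Feas P fun n L v => state P n L (f n L v) := by
  have : Feas P fun n L x => state P n L x := by unfold state; infer_instance
  exact Feas.comp' this inferInstance

end Instances

end Sim₂

end Preparation

end DBE
end

/-! ### The state prepared by the second simulation -/

noncomputable section
namespace DBE

section Preparation

open Prim Val

namespace Sim₂

variable {P : PairingSystem} {n : ℕ} (L : ℕ) (x : Theta P n) (a : ZMod (P.grp x.d).p) (k' : ℕ)
  (b' μ : Bool) (w' : ZMod (P.grp x.d).p) (aux : Val)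

local notation "w₀" => input P L x a k' b' μ w' aux

theorem D_input : D w₀ = P.descVal x.d := rfl
theorem g_input : g w₀ = P.encG x.d x.g := rfl
theorem ga_input : ga w₀ = P.encG x.d (x.g ^ a.val) := rfl
theorem gc_input : gc w₀ = P.encG x.d (x.g ^ x.t.val) := rfl
theorem gh_input : gh w₀ = P.encGh x.d x.gh := rfl
theorem gha_input : gha w₀ = P.encGh x.d (x.gh ^ a.val) := rfl
theorem ghc_input : ghc w₀ = P.encGh x.d (x.gh ^ x.t.val) := rfl
theorem κ₁_input : κ₁ w₀ = P.encKey1 n x.d x.κ₁ := rfl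
theorem κ₂_input : κ₂ w₀ = P.encKey2 n x.d x.κ₂ := rfl
theorem k_input : k w₀ = ofNat k' := rfl
theorem b_input : b w₀ = ofBool b' := rfl
theorem α_input : α w₀ = (P.grp x.d).encScalar x.α := rfl
theorem β_input : β w₀ = (P.grp x.d).encScalar (x.β + if b' then a else 0) := rfl

theorem γ_input {i : ℕ} (hi : i < L) : γ L w₀ (ofNat i) =
    (P.grp x.d).encScalar (x.γ (1 + i) + if 1 + i = k' + 1 then -a else 0) :=
  get_map hi (by rw [cap]; omega) fun j =>
    (P.grp x.d).encScalar (x.γ j + if j = k' + 1 then -a else 0)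

theorem αpow_input {i : ℕ} (hi : i ≤ cap L) : αpow P L w₀ (ofNat i) =
    (P.grp x.d).encScalar (x.α ^ (i + 1)) := by
  rw [αpow, fold_const _ (by rwa [len_ofNat]), len_ofNat, α_input, D_input]
  clear hi
  induction i with
  | zero => rw [Function.iterate_zero_apply, zero_add, pow_one]
  | succ i ih => rw [Function.iterate_succ_apply', ih, det_scalarMul, pow_succ _ (i + 1)]

theorem A_input {i : ℕ} (hi : i ≤ cap L) : A P L w₀ (ofNat i) =
    P.encG x.d (x.g ^ (x.α ^ (i + 1)).val) := by
  rw [A, αpow_input L x a k' b' μ w' aux hi, D_input, g_input, det_powG]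

theorem B_input : B P w₀ = P.encG x.d (x.g ^ x.β.val) := by
  rw [B, b_input, D_input, g_input, ga_input, β_input]
  cases b'
  · simp
    rfl
  · simp only [if_true, det_powG, invG_eq, det_mulG, ofBool, cond_node]
    rw [← pow_val_neg, ← pow_val_add, add_neg_cancel_right]

theorem beq_k {i : ℕ} : (beq (ofNat i) (k w₀)).toBool = decide (1 + i = k' + 1) := by
  rw [k_input, beq, toBool_ofBool]
  congr 1
  rw [add_comm, Nat.succ_inj, eq_iff_iff]
  exact ⟨ofNat_inj, congrArg ofNat⟩

theorem V_input {i : ℕ} (hi : i < L) : V P L w₀ (ofNat i) =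
    P.encG x.d (x.g ^ (x.γ (1 + i)).val) := by
  rw [V, cond_def, beq_k, D_input, g_input, ga_input, γ_input L x a k' b' μ w' aux hi]
  by_cases h : 1 + i = k' + 1
  · simp only [h, decide_true, if_true, det_powG, det_mulG, ← pow_val_add, neg_add_cancel_right]
  · simp [h]

theorem Vh_input {i : ℕ} (hi : i < L) : Vh P L w₀ (ofNat i) =
    P.encGh x.d (x.gh ^ (x.γ (1 + i)).val) := by
  rw [Vh, cond_def, beq_k, D_input, gh_input, gha_input, γ_input L x a k' b' μ w' aux hi]
  by_cases h : 1 + i = k' + 1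
  · simp only [h, decide_true, if_true, det_powGh, det_mulGh, ← pow_val_add, neg_add_cancel_right]
  · simp [h]

theorem upk_input {i : ℕ} (hi : i < L) : upk P L w₀ (ofNat i) =
    (x.pp L).encUPK (1 + i) (x.keys L (1 + i) (x.γ (1 + i))).2 := by
  have hW : build L (fun m => not (beq (.node nil (uadd L (ofNat i) m)) (ofNat L)))
      (fun m => W P L (.node w₀ (ofNat i)) m) (ofNat L) =
      ofList (((List.range' 2 L).filter (· ≠ L + 2 - (1 + i))).map fun k =>
        P.encG x.d ((x.keys L (1 + i) (x.γ (1 + i))).2.W k)) := by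
    refine build_filter (q := fun k => k ≠ L + 2 - (1 + i)) (by rw [cap]; omega)
      (fun m hm => ?_) fun m hm hq => ?_
    · rw [uadd_ofNat (by rw [cap]; omega), ← ofNat_succ, toBool_not, beq, toBool_ofBool]
      have h : ofNat (i + m + 1) = ofNat L ↔ i + m + 1 = L := ⟨ofNat_inj, congrArg ofNat⟩
      simp only [h]
      simp
      omega
    · rw [W, hd_node, tl_node, ← ofNat_succ, D_input, V_input L x a k' b' μ w' aux hi,
        αpow_input L x a k' b' μ w' aux (by rw [cap]; omega), det_powG]
      have : (x.keys L (1 + i) (x.γ (1 + i))).2.W (2 + m) =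
          (x.g ^ (x.α ^ (2 + m)).val) ^ (x.γ (1 + i)).val := by
        show (if 2 + m = L + 2 - (1 + i) then 1 else
          (if 2 + m = L + 2 then 1 else x.g ^ (x.α ^ (2 + m)).val) ^ (x.γ (1 + i)).val) = _
        rw [if_neg hq, if_neg (by omega)]
      rw [this]
      simp only [← pow_val_mul]
      congr 3
      ring
  rw [upk, hW, V_input L x a k' b' μ w' aux hi, Vh_input L x a k' b' μ w' aux hi, ← ofNat_succ,
    add_comm i]
  rfl

theorem pp_input : pp P L w₀ = (x.pp L).enc := by
  have h₁ : build L (fun m => not (beq m (.node nil (ofNat L)))) (fun m => A P L w₀ m)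
      (uadd L (ofNat L) (.node nil (.node nil (ofNat L)))) =
      ofList (((List.range' 1 (2 * L + 2)).filter (· ≠ L + 2)).map fun k =>
        P.encG x.d (x.A L k)) := by
    rw [← ofNat_succ, ← ofNat_succ, uadd_ofNat (by rw [cap]; omega),
      show L + (L + 1 + 1) = 2 * L + 2 by ring]
    refine build_filter (q := fun k => k ≠ L + 2) (by rw [cap]; omega)
      (fun m hm => ?_) fun m hm hq => ?_
    · rw [toBool_not, beq, toBool_ofBool]
      have h : ofNat m = ofNat (L + 1) ↔ m = L + 1 := ⟨ofNat_inj, congrArg ofNat⟩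
      simp only [h]
      simp
      omega
    · rw [A_input L x a k' b' μ w' aux (by rw [cap]; omega), Par.A, if_neg hq, add_comm]
  have h₂ : build L (fun _ => one) (fun m => powGh.det P [D w₀, gh w₀, αpow P L w₀ m])
      (.node nil (ofNat L)) = ofList ((List.range' 1 (L + 1)).map fun k =>
        P.encGh x.d (x.gh ^ (x.α ^ k).val)) := by
    rw [← ofNat_succ]
    refine build_map (by rw [cap]; omega) fun i hi => ?_
    rw [αpow_input L x a k' b' μ w' aux (by rw [cap]; omega), D_input, gh_input, det_powGh,
      add_comm]
  have h₃ : build L (fun _ => one) (fun m => powG.det P [D w₀, B P w₀, αpow P L w₀ (.node nil m)])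
      (ofNat L) = ofList ((List.range' 2 L).map fun k =>
        P.encG x.d ((x.g ^ (x.α ^ k).val) ^ x.β.val)) := by
    refine build_map (by rw [cap]; omega) fun i hi => ?_
    rw [← ofNat_succ, αpow_input L x a k' b' μ w' aux (by rw [cap]; omega), D_input, B_input,
      det_powG]
    simp only [← pow_val_mul]
    congr 3
    ring
  rw [pp, h₁, h₂, h₃, ← ofNat_succ, A_input L x a k' b' μ w' aux (by rw [cap]; omega), B_input,
    D_input, gh_input, det_pair]
  rfl

theorem ck_input (hR : x.R = (P.grp x.d).e x.g x.gh ^ w'.val) : ck P n L w₀ =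
    ofBits (P.H2 n x.d x.κ₂ (if μ then x.R else
      (P.grp x.d).e x.g x.gh ^ (x.α ^ (L + 2) * x.t).val)).toList := by
  have h : Val.fld (Val.tl w₀) 4 = ofBool μ := rfl
  have h' : Val.fld (Val.tl w₀) 5 = (P.grp x.d).encScalar w' := rfl
  rw [ck, h, h', D_input, g_input, gh_input, gc_input, κ₂_input, ← ofNat_succ,
    αpow_input L x a k' b' μ w' aux (by rw [cap]; omega), det_pair, det_pair, det_powGT,
    det_powGT, BilinearGroup.e_pow_left, ← pow_val_mul, mul_comm x.t]
  cases μ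
  · exact det_hash2 ..
  · rw [if_pos rfl, hR]
    exact det_hash2 ..

theorem state_input (hR : x.R = (P.grp x.d).e x.g x.gh ^ w'.val) :
    state P n L w₀ = (x.sim₂ L a k' b' μ).encState L aux Full.init := by
  have h₀ : Val.fld (Val.hd w₀) 10 = aux := rfl
  have hω : ω P n w₀ = (P.grp x.d).encScalar x.ω := by
    rw [ω, D_input, κ₁_input, ghc_input, det_hash1]
    rfl
  have h₁ : build L (fun _ => one) (fun i => upk P L w₀ i) (ofNat L) =
      ofList ((List.range' 1 L).map (x.real L μ).upkV) :=
    build_map (by rw [cap]; omega) fun i hi => upk_input L x a k' b' μ w' aux hi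
  have h₂ : build L (fun _ => one) (fun i => mulG.det P [D w₀, A P L w₀ i, V P L w₀ i])
      (ofNat L) = ofList ((List.range' 1 L).map fun j => P.encG x.d ((x.real L μ).TF j)) := by
    refine build_map (by rw [cap]; omega) fun i hi => ?_
    rw [D_input, A_input L x a k' b' μ w' aux (by rw [cap]; omega),
      V_input L x a k' b' μ w' aux hi, det_mulG, ← pow_val_add, add_comm i]
  have h₃ : build L (fun _ => one) (fun i => powG.det P [D w₀, gc w₀,
      scalarAdd.det P [D w₀, αpow P L w₀ i, γ L w₀ i]]) (ofNat L) =
      ofList ((List.range' 1 L).map fun j => P.encG x.d ((x.sim₂ L a k' b' μ).Tc j)) := by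
    refine build_map (by rw [cap]; omega) fun i hi => ?_
    rw [D_input, gc_input, αpow_input L x a k' b' μ w' aux (by rw [cap]; omega),
      γ_input L x a k' b' μ w' aux hi, det_scalarAdd, det_powG, ← pow_val_mul, add_comm i]
    refine congrArg (P.encG x.d) (congrArg (fun z : ZMod (P.grp x.d).p => x.g ^ z.val) ?_)
    split_ifs <;> ring
  have h₄ : build L (fun _ => one) (fun _ => powG.det P [D w₀, g w₀, nil]) (ofNat L) =
      ofList ((List.range' 1 L).map fun j => P.encG x.d ((x.real L μ).Tq j)) := by
    refine build_map (by rw [cap]; omega) fun i hi => ?_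
    rw [D_input, g_input, ← (P.grp x.d).encScalar_zero, det_powG, pow_val_zero]
  have hcB : x.t * (x.α ^ (L + 1) * x.ω + (x.β + if b' then a else 0)) =
      (x.α ^ (L + 1) * x.ω + x.β) * x.t + if b' then a * x.t else 0 := by
    split_ifs <;> ring
  have hX : powGh.det P [P.descVal x.d, P.encGh x.d x.gh, nil] = P.encGh x.d 1 := by
    rw [← (P.grp x.d).encScalar_zero, det_powGh, pow_val_zero]
  have hu : (P.grp x.d).encScalar (x.sim₂ L a k' b' μ).u₁ = nil := (P.grp x.d).encScalar_zero
  have hu' : (P.grp x.d).encScalar (x.sim₂ L a k' b' μ).u₀ = node one nil :=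
    (P.grp x.d).encScalar_one
  rw [state, pp_input, h₁, h₂, h₃, h₄, ck_input L x a k' b' μ w' aux hR, h₀, hω, ← ofNat_succ,
    A_input L x a k' b' μ w' aux (by rw [cap]; omega),
    A_input L x a k' b' μ w' aux (by rw [cap]; omega),
    αpow_input L x a k' b' μ w' aux (by rw [cap]; omega), D_input, B_input, gc_input, β_input,
    gh_input, det_scalarMul, det_scalarAdd, det_powG, ← pow_val_mul, hcB, hX, Tab.encState,
    Tab.enc, hu, hu']
  rfl

end Sim₂

end Preparation

end DBE

/-! ### The distribution of the second simulation -/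

noncomputable section
namespace DBE

section Preparation

open Prim Val

/-- The second simulation: the challenger's own choices are added. -/
def prep₂ (P : PairingSystem) (n L : ℕ) (v : Val) : PMF Val :=
  (scalarRand.eval P [v.hd]).bind fun α => (scalarRand.eval P [v.hd]).bind fun β =>
    (genKey2.eval P [ofNat n, v.hd]).bind fun κ₂ => (randListV P L v.hd).bind fun γ =>
    (scalarRand.eval P [v.hd]).bind fun w => ((PMF.uniformOfFintype Bool).map ofBool).map fun μ =>
      Sim₂.state P n L (.node v (ofList [κ₂, α, β, γ.tl, μ, w]))

instance feasR_prep₂ (P : PairingSystem) {f : ℕ → ℕ → Val → Val} [Feas P f] :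
    FeasR P fun n L v => prep₂ P n L (f n L v) := by
  have : FeasR P (prep₂ P) := by unfold prep₂; infer_instance
  exact FeasR.comp this inferInstance

/-- Preparation of the search for collisions. -/
def prepColl (P : PairingSystem) (n L : ℕ) (v : Val) : PMF Val :=
  (randG.eval P [v.hd]).bind fun g => (randGh.eval P [v.hd]).bind fun gh =>
    (scalarRand.eval P [v.hd]).bind fun t => prep₂ P n L (ofList [v.hd, g,
      powG.det P [v.hd, g, nil], powG.det P [v.hd, g, t], gh, powGh.det P [v.hd, gh, nil],
      powGh.det P [v.hd, gh, t], v.tl, nil, nil, nil])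

/-- Preparation of the attack that guesses a user. -/
def prepGuess (P : PairingSystem) (n L : ℕ) (v : Val) : PMF Val :=
  (genKey1.eval P [ofNat n, v.hd]).bind fun κ₁ => (randIndex L).bind fun k =>
    ((PMF.uniformOfFintype Bool).map ofBool).bind fun b => prep₂ P n L (ofList [v.hd, v.fld 1,
      getSkip L (v.fld 2) nil, v.fld 3, v.fld 4, (v.fld 5).hd, v.fld 6, κ₁, k, b,
      .node (get L (v.fld 5) (ofNat L)) (v.fld 7)])

variable (P : PairingSystem)

instance feasR_prepColl : FeasR P (prepColl P) := by unfold prepColl; infer_instance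

set_option synthInstance.maxHeartbeats 100000 in
set_option synthInstance.maxSize 1000 in
instance feasR_prepGuess : FeasR P (prepGuess P) := by unfold prepGuess; infer_instance

variable {P} {n : ℕ} (L : ℕ)

/-- The masks are absorbed by the uniform `β` and `γ`, so the true parameters are independent of
`a`, `k` and `b`. These enter only through the challenge ciphertext and the record. -/
theorem prep₂_base {d : P.Desc} {g : (P.grp d).G} {gh : (P.grp d).Gh} (hg : g ≠ 1) (hgh : gh ≠ 1)
    (κ₁ : P.Key1 n d) (a t : ZMod (P.grp d).p) (k : ℕ) (b : Bool) (aux : Val) :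
    prep₂ P n L (Sim₂.base P g gh κ₁ a t k b aux) =
      (P.grp d).randScalar.bind fun α => (P.grp d).randScalar.bind fun β =>
      (P.genKey2 n d).bind fun κ₂ => ((P.grp d).randFun (List.range' 1 L)).bind fun γ =>
      (P.grp d).randGT.bind fun R => (PMF.uniformOfFintype Bool).map fun μ =>
      ((⟨⟨d, g, gh, α, β, κ₁, κ₂⟩, γ, t, R⟩ : Theta P n).sim₂ L a k b μ).encState L aux
        Full.init := by
  have hT : (P.grp d).randGT = (P.grp d).randScalar.map fun a => (P.grp d).e g gh ^ a.val :=
    ((P.grp d).randScalar_map_pow (P.grp d).card_GT ((P.grp d).e_ne_one hg hgh) _).symm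
  have hd : (Sim₂.base P g gh κ₁ a t k b aux).hd = P.descVal d := rfl
  simp only [prep₂, hd, eval_genKey2, eval_scalarRand, randListV_eq, PMF.bind_map,
    PMF.map_comp, Function.comp_def, hT]
  congr 1
  funext α
  refine ((P.grp d).randScalar_bind_shift (if b then a else 0) _).symm.trans ?_
  congr 1
  funext β
  congr 1
  funext κ₂
  refine (congrArg (fun p => PMF.bind p _) ((P.grp d).randFun_shift _
    fun j => if j = k + 1 then -a else 0).symm).trans ?_
  rw [PMF.bind_map]
  congr 1
  funext γ
  simp only [Function.comp_apply]
  congr 1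
  funext w
  congr 1
  funext μ
  refine Eq.trans ?_ (Sim₂.state_input L ⟨⟨d, g, gh, α, β, κ₁, κ₂⟩, γ, t,
    (P.grp d).e g gh ^ w.val⟩ a k b μ w aux rfl)
  have hγ : ∀ j ∈ List.range' 1 L, (P.grp d).encScalar
      (if j ∈ List.range' 1 L then γ j + (if j = k + 1 then -a else 0) else γ j) =
      (P.grp d).encScalar (γ j + if j = k + 1 then -a else 0) :=
    fun j hj => by rw [if_pos hj]
  rw [List.map_congr_left hγ]
  rfl

theorem PMF.bind_reorder_coll {α₁ α₂ α₃ α₄ α₅ α₆ α₇ α₈ β : Type} (κ₁ : PMF α₁) (t : PMF α₂)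
    (α : PMF α₃) (b : PMF α₄) (κ₂ : PMF α₅) (γ : PMF α₆) (R : PMF α₇) (μ : PMF α₈)
    (f : α₁ → α₂ → α₃ → α₄ → α₅ → α₆ → α₇ → α₈ → PMF β) :
    (κ₁.bind fun a₁ => t.bind fun a₂ => α.bind fun a₃ => b.bind fun a₄ => κ₂.bind fun a₅ =>
      γ.bind fun a₆ => R.bind fun a₇ => μ.bind fun a₈ => f a₁ a₂ a₃ a₄ a₅ a₆ a₇ a₈) =
    α.bind fun a₃ => b.bind fun a₄ => κ₁.bind fun a₁ => κ₂.bind fun a₅ =>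
      γ.bind fun a₆ => t.bind fun a₂ => R.bind fun a₇ => μ.bind fun a₈ =>
      f a₁ a₂ a₃ a₄ a₅ a₆ a₇ a₈ := by
  simp only [PMF.bind_comm t α, PMF.bind_comm t b, PMF.bind_comm t κ₂, PMF.bind_comm t γ,
    PMF.bind_comm κ₁ α, PMF.bind_comm κ₁ b]

theorem PMF.bind_reorder_guess {α₁ α₂ α₃ α₄ α₅ α₆ α₇ α₈ α₉ β₁ β₂ β₃ β : Type} (κ₁ : PMF α₁)
    (t : PMF α₂) (α : PMF α₃) (b : PMF α₄) (κ₂ : PMF α₅) (γ : PMF α₆) (R : PMF α₇) (μ : PMF α₈)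
    (a : PMF α₉) (w : PMF β₁) (k : PMF β₂) (c : PMF β₃)
    (f : α₁ → α₂ → α₃ → α₄ → α₅ → α₆ → α₇ → α₈ → α₉ → β₁ → β₂ → β₃ → PMF β) :
    (a.bind fun a₉ => t.bind fun a₂ => w.bind fun b₁ => κ₁.bind fun a₁ => k.bind fun b₂ =>
      c.bind fun b₃ => α.bind fun a₃ => b.bind fun a₄ => κ₂.bind fun a₅ => γ.bind fun a₆ =>
      R.bind fun a₇ => μ.bind fun a₈ => f a₁ a₂ a₃ a₄ a₅ a₆ a₇ a₈ a₉ b₁ b₂ b₃) =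
    α.bind fun a₃ => b.bind fun a₄ => κ₁.bind fun a₁ => κ₂.bind fun a₅ => γ.bind fun a₆ =>
      t.bind fun a₂ => R.bind fun a₇ => a.bind fun a₉ => k.bind fun b₂ => c.bind fun b₃ =>
      μ.bind fun a₈ => w.bind fun b₁ => f a₁ a₂ a₃ a₄ a₅ a₆ a₇ a₈ a₉ b₁ b₂ b₃ := by
  simp only [PMF.bind_comm a t, PMF.bind_comm a κ₁, PMF.bind_comm a α, PMF.bind_comm a b,
    PMF.bind_comm a κ₂, PMF.bind_comm a γ, PMF.bind_comm a R, PMF.bind_comm t κ₁,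
    PMF.bind_comm t α, PMF.bind_comm t b, PMF.bind_comm t κ₂, PMF.bind_comm t γ,
    PMF.bind_comm w κ₁, PMF.bind_comm w k, PMF.bind_comm w c, PMF.bind_comm w α,
    PMF.bind_comm w b, PMF.bind_comm w κ₂, PMF.bind_comm w γ, PMF.bind_comm w R,
    PMF.bind_comm w μ, PMF.bind_comm κ₁ α, PMF.bind_comm κ₁ b, PMF.bind_comm k α,
    PMF.bind_comm k b, PMF.bind_comm k κ₂, PMF.bind_comm k γ, PMF.bind_comm k R,
    PMF.bind_comm c α, PMF.bind_comm c b, PMF.bind_comm c κ₂, PMF.bind_comm c γ,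
    PMF.bind_comm c R]

/-- A random index, as a number. -/
def randIdx (L : ℕ) : PMF ℕ := (randIndex L).map len

theorem randIndex_eq : randIndex L = (randIdx L).map ofNat := by
  -- The bound keeps the unary additions within `cap L`; the summand `1` covers the start `s = 1`
  -- when `L = 0`.
  have key : ∀ r k s : ℕ, s ≤ 2 * L + 1 → ∀ v ∈ (iterate (fun v =>
      ((PMF.uniformOfFintype Bool).map ofBool).bind fun b => PMF.pure (doubleV L v b)) r
        (.node (ofNat k) (ofNat s))).support, ∃ i, v.hd = ofNat i := by
    intro r
    induction r with
    | zero =>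
      intro k s _ v hv
      rw [iterate, PMF.mem_support_pure_iff] at hv
      exact ⟨k, by rw [hv, hd_node]⟩
    | succ r ih =>
      intro k s hs v hv
      rw [iterate, PMF.bind_bind, PMF.bind_map] at hv
      simp only [Function.comp_def, PMF.pure_bind] at hv
      obtain ⟨b, -, hv⟩ := (PMF.mem_support_bind_iff _ _ _).mp hv
      have hd : dropBy L (ofNat s) (ofNat L) = ofNat (L - s) := by
        rw [dropBy_eq (by rw [len_ofNat, cap]; omega), len_ofNat, tl_iterate_ofNat]
      rw [doubleV, tl_node, hd_node, hd, uadd_ofNat (by rw [cap]; omega),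
        uadd_ofNat (by rw [cap]; omega)] at hv
      by_cases h : L ≤ s
      · rw [Nat.sub_eq_zero_of_le h] at hv
        exact ih k s hs v hv
      · obtain ⟨j, hj⟩ : ∃ j, L - s = j + 1 := ⟨L - s - 1, by omega⟩
        rw [hj, ofNat_succ, cond_node] at hv
        cases b
        · exact ih k (s + s) (by omega) v hv
        · exact ih (s + k) (s + s) (by omega) v hv
  rw [randIdx, PMF.map_comp]
  conv_lhs => rw [← PMF.map_id (randIndex L)]
  refine bind_congr_support _ fun v hv => congrArg PMF.pure ?_
  rw [randIndex, PMF.mem_support_map_iff] at hv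
  obtain ⟨u, hu, rfl⟩ := hv
  obtain ⟨i, hi⟩ := key L 0 1 (by omega) u hu
  rw [hi, Function.comp_apply, len_ofNat]
  rfl

/-- With `a = 0` the second simulation is the real challenger. The collision finder chooses
everything itself except the group and the hash key, including the coin. -/
theorem bind_prepColl {β : Type} (K : ∀ d, P.Key1 n d → Val → PMF β) :
    ((P.gen n).bind fun d => (P.genKey1 n d).bind fun κ₁ =>
      (prepColl P n L (.node (P.descVal d) (P.encKey1 n d κ₁))).bind (K d κ₁)) =
    (thetaDist P n L).bind fun y => (PMF.uniformOfFintype Bool).bind fun μ =>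
      K y.d y.κ₁ ((y.real L μ).encState L nil Full.init) := by
  rw [thetaDist_eq]
  simp only [PMF.bind_bind, PMF.pure_bind]
  congr 1
  funext d
  simp only [prepColl, hd_node, tl_node, eval_randG, eval_randGh, eval_scalarRand, PMF.bind_map,
    Function.comp_def, PMF.bind_bind]
  rw [PMF.bind_comm]
  refine bind_congr_support _ fun g hg => ?_
  rw [PMF.bind_comm]
  refine bind_congr_support _ fun gh hgh => ?_
  have hg := BilinearGroup.mem_support_randGenerator hg
  have hgh := BilinearGroup.mem_support_randGenerator hgh
  have h : ∀ κ₁ t, ofList [P.descVal d, P.encG d g, powG.det P [P.descVal d, P.encG d g, nil],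
      powG.det P [P.descVal d, P.encG d g, (P.grp d).encScalar t], P.encGh d gh,
      powGh.det P [P.descVal d, P.encGh d gh, nil],
      powGh.det P [P.descVal d, P.encGh d gh, (P.grp d).encScalar t], P.encKey1 n d κ₁, nil, nil,
      nil] = Sim₂.base P g gh κ₁ 0 t 0 false nil := by
    intro κ₁ t
    have h₁ := det_powG d g 0
    have h₂ := det_powGh d gh 0
    rw [(P.grp d).encScalar_zero] at h₁ h₂
    rw [h₁, h₂, det_powG, det_powGh]
    rfl
  simp only [h, prep₂_base L hg hgh, PMF.bind_bind, PMF.bind_map, Function.comp_def]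
  rw [PMF.bind_reorder_coll]
  simp only [sim₂_zero]

/-- `a` and `t` come from the challenge, while `α` is a fresh scalar. The auxiliary data
`ĝ^(a^(L+1))` and `Z` are carried along for the final test and do not influence the game. -/
theorem bind_prepGuess (b' : Bool) : (bdheChallenge P n (L + 1) b').bind (prepGuess P n L) =
    (thetaDist P n L).bind fun y => (P.grp y.d).randScalar.bind fun a => (randIdx L).bind fun k =>
      (PMF.uniformOfFintype Bool).bind fun b => (PMF.uniformOfFintype Bool).bind fun μ =>
      (P.grp y.d).randScalar.map fun w => (y.sim₂ L a k b μ).encState L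
        (.node (P.encGh y.d (y.gh ^ (a ^ (L + 1)).val)) (P.encGT y.d
          ((P.grp y.d).e y.g y.gh ^ (if b' then w else a ^ (L + 2) * y.t).val))) Full.init := by
  rw [bdheChallenge_eq, thetaDist_eq]
  simp only [PMF.bind_bind, PMF.pure_bind]
  congr 1
  funext d
  refine bind_congr_support _ fun g hg => bind_congr_support _ fun gh hgh => ?_
  have hg := BilinearGroup.mem_support_randGenerator hg
  have hgh := BilinearGroup.mem_support_randGenerator hgh
  have h : ∀ a c w κ₁ k b, prep₂ P n L (ofList [P.descVal d, P.encG d g,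
      getSkip L (ofList (((List.range' 1 (2 * L + 2)).filter (· ≠ L + 2)).map
        fun k => P.encG d (g ^ (a ^ k).val))) nil, P.encG d (g ^ c.val), P.encGh d gh,
      (ofList ((List.range' 1 (L + 1)).map fun k => P.encGh d (gh ^ (a ^ k).val))).hd,
      P.encGh d (gh ^ c.val), P.encKey1 n d κ₁, ofNat k, ofBool b,
      .node (get L (ofList ((List.range' 1 (L + 1)).map fun k => P.encGh d (gh ^ (a ^ k).val)))
        (ofNat L)) w]) = prep₂ P n L (Sim₂.base P g gh κ₁ a c k b
          (.node (P.encGh d (gh ^ (a ^ (L + 1)).val)) w)) := by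
    intro a c w κ₁ k b
    have h₁ := getSkip_eq (L := L) (k := 0) (by omega) (by omega)
      fun k => P.encG d (g ^ (a ^ k).val)
    have h₂ := get_map (L := L) (a := 1) (k := L + 1) (i := L) (by omega) (by rw [cap]; omega)
      fun k => P.encGh d (gh ^ (a ^ k).val)
    have h₃ : (ofList ((List.range' 1 (L + 1)).map fun k => P.encGh d (gh ^ (a ^ k).val))).hd =
      P.encGh d (gh ^ (a ^ 1).val) := rfl
    rw [zero_add, pow_one, ofNat_zero] at h₁
    rw [pow_one] at h₃
    rw [h₁, h₂, h₃, add_comm 1 L]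
    rfl
  have hp : ∀ a c Z, prepGuess P n L (ofList [
      P.descVal d, P.encG d g,
      ofList (((List.range' 1 (2 * L + 2)).filter (· ≠ L + 2)).map
        fun k => P.encG d (g ^ (a ^ k).val)),
      P.encG d (g ^ c.val), P.encGh d gh,
      ofList ((List.range' 1 (L + 1)).map fun k => P.encGh d (gh ^ (a ^ k).val)),
      P.encGh d (gh ^ c.val), Z]) = (P.genKey1 n d).bind fun κ₁ => (randIdx L).bind fun k =>
        (PMF.uniformOfFintype Bool).bind fun b => prep₂ P n L (Sim₂.base P g gh κ₁ a c k b
          (.node (P.encGh d (gh ^ (a ^ (L + 1)).val)) Z)) := by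
    intro a c Z
    have hd : ∀ l, (ofList (P.descVal d :: l)).hd = P.descVal d := fun _ => rfl
    simp only [prepGuess, hd, eval_genKey1, randIndex_eq, PMF.bind_map, Function.comp_def]
    refine congrArg (PMF.bind _) (funext fun κ₁ => congrArg (PMF.bind _) (funext fun k =>
      congrArg (PMF.bind _) (funext fun b => ?_)))
    exact h a c Z κ₁ k b
  have hm : ∀ {α β : Type} (p : PMF α) (f : α → β), p.map f = p.bind fun a => PMF.pure (f a) :=
    fun _ _ => rfl
  simp only [hp, prep₂_base L hg hgh, hm]
  rw [PMF.bind_reorder_guess]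

end Preparation

end DBE

noncomputable section
namespace DBE

/-! ## The bound -/

section Bound

open Val

open scoped ENNReal

theorem pr_add_pr_not {α : Type} (p : PMF α) (A : α → Prop) : pr p A + pr p (fun a => ¬ A a) = 1 := by
  classical
  have h : ∀ B : α → Prop, pr p B = ∑' a, p a * if B a then 1 else 0 := by
    intro B
    conv_lhs => rw [← PMF.bind_pure p]
    rw [pr_bind]
    simp only [pr_pure]
  rw [h, h, ← ENNReal.tsum_add, ← p.tsum_coe]
  refine tsum_congr fun a => ?_
  by_cases ha : A a <;> simp [ha]

theorem pr_bind_le_mul {α β γ : Type} {p : PMF α} {f : α → PMF β} {g : α → PMF γ} {A : β → Prop}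
    {B : γ → Prop} (c : ℝ≥0∞) (h : ∀ a ∈ p.support, pr (f a) A ≤ c * pr (g a) B) :
    pr (p.bind f) A ≤ c * pr (p.bind g) B := by
  rw [pr_bind, pr_bind, ← ENNReal.tsum_mul_left]
  refine ENNReal.tsum_le_tsum fun a => ?_
  rw [mul_left_comm]
  by_cases ha : a ∈ p.support
  · gcongr; exact h a ha
  · simp [(PMF.apply_eq_zero_iff p a).mpr ha]

theorem pr_toReal_add_pr_not {α : Type} (p : PMF α) (A : α → Prop) :
    (pr p A).toReal + (pr p (fun a => ¬ A a)).toReal = 1 := by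
  rw [← ENNReal.toReal_add (pr_ne_top _ _) (pr_ne_top _ _), pr_add_pr_not, ENNReal.toReal_one]

variable {P : PairingSystem}

/-- `K` is everything after the preparation, and it does not depend on the table. A reduction is
thus specified by the distribution of its initial state and by what it reads off at the end. -/
theorem exists_reduction {L : ℕ → ℕ} {q : Polynomial ℕ} (hq : ∀ n, L n ≤ q.eval n) {A : Prog}
    (hA : PPT P L A) {prep : ℕ → ℕ → Val → PMF Val} (hp : FeasR P prep)
    {fin : ℕ → ℕ → Val → Val} (hf : Feas P fin) :
    ∃ B : Prog, PPT P L B ∧ ∃ K : ℕ → Val → PMF Val,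
      (∀ n v, B.output P n (L n) v = (prep n (L n) v).bind (K n)) ∧
      ∀ n (T : Tab P n) (aux : Val), K n (T.encState (L n) aux Full.init) =
        (T.game (L n) A).map fun s =>
          fin n (L n) (node (s.mem 0) (T.encState (L n) aux s.env)) := by
  obtain ⟨I, hI⟩ := hp
  obtain ⟨F, hF⟩ := hf
  obtain ⟨H, hH⟩ := feas_handlerV (P := P)
  refine ⟨reduction A I H F, PPT.reduction hq hA I H F, fun n st =>
    (A.run P (H.handler P n (L n)) (Config.start n (L n) Val.nil st)).map fun s =>
      fin n (L n) (node (s.mem 0) s.env), fun n v => ?_, fun n T aux => ?_⟩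
  · rw [output_reduction, reductionOutput, hI, PMF.map_bind]
    congr 1
    funext st
    rw [PMF.map_bind]
    refine congrArg (PMF.bind _) (funext fun s => ?_)
    rw [hF, PMF.pure_map, PMF.pure_map]
    rfl
  · simp only
    rw [run_handlerV (T := T) (hH := hH), PMF.map_comp]
    rfl

theorem bdheProb_eq (L : ℕ → ℕ) (c : Prog) (n : ℕ) (b : Bool) : bdheProb P L c n b =
    (pr ((bdheChallenge P n (L n + 1) b).bind fun x => c.output P n (L n) x)
      fun v => v.toBool = false).toReal := by
  rw [bdheProb, ← pr_singleton, ← PMF.map_bind, pr_map]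

/-- The algorithm passes on the adversary's guess; the kind of `Z` plays the role of the coin. -/
theorem bdheProb_sim₁ {L : ℕ → ℕ} {q : Polynomial ℕ} (hq : ∀ n, L n ≤ q.eval n) {A : Prog}
    (hA : PPT P L A) : ∃ B : Prog, PPT P L B ∧ ∀ n b, bdheProb P L B n b =
      (pr ((thetaDist P n (L n)).bind fun y => (y.sim₁ (L n) b).game (L n) A)
        fun s => (s.mem 0).toBool = false).toReal := by
  obtain ⟨B, hB, K, h₁, h₂⟩ := exists_reduction hq hA (feasR_prep₁ P)
    (fin := fun _ _ v => v.hd) inferInstance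
  refine ⟨B, hB, fun n b => ?_⟩
  rw [bdheProb_eq]
  simp only [h₁]
  rw [← PMF.bind_bind, bind_prep₁, PMF.bind_map]
  simp only [Function.comp_def, h₂, hd_node]
  rw [← PMF.map_bind, pr_map]

theorem thetaDist_gh {n L : ℕ} {y : Theta P n} (hy : y ∈ (thetaDist P n L).support) :
    y.g ≠ 1 ∧ y.gh ≠ 1 := by
  rw [thetaDist_eq] at hy
  simp only [PMF.mem_support_bind_iff, PMF.mem_support_pure_iff] at hy
  obtain ⟨d, -, g, hg, gh, hgh, α, -, β, -, κ₁, -, κ₂, -, γ, -, t, -, R, -, rfl⟩ := hy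
  exact ⟨BilinearGroup.mem_support_randGenerator hg, BilinearGroup.mem_support_randGenerator hgh⟩

-- The collisions are counted in the real game, which the finder runs perfectly.
open Classical in
theorem crAdv_ge {L : ℕ → ℕ} {q : Polynomial ℕ} (hq : ∀ n, L n ≤ q.eval n) {A : Prog}
    (hA : PPT P L A) : ∃ B : Prog, PPT P L B ∧ ∀ n,
      (pr ((thetaDist P n (L n)).bind fun y => (PMF.uniformOfFintype Bool).bind fun μ =>
        (y.real (L n) μ).game (L n) A) fun s => s.env.rec₁ ≠ nil).toReal ≤ crAdv P L B n := by
  obtain ⟨B, hB, K, h₁, h₂⟩ := exists_reduction hq hA (feasR_prepColl P)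
    -- The pair consists of `rec₁` and of `C₁`, entry `9` of the table, with empty auxiliary input.
    (fin := fun _ _ v => .node v.tl.tl.tl.tl.tl.hd (.node (v.tl.hd.fld 9) nil)) inferInstance
  refine ⟨B, hB, fun n => ?_⟩
  have hcr : crAdv P L B n = (pr ((P.gen n).bind fun d => (P.genKey1 n d).bind fun κ =>
      (prepColl P n (L n) (.node (P.descVal d) (P.encKey1 n d κ))).bind fun st =>
      (K n st).map fun v => decide (IsCollision P n d κ v)) fun b => b = true).toReal := by
    rw [pr_singleton, crAdv]
    simp only [h₁]
    show ENNReal.toReal ((P.gen n).bind (fun d => (P.genKey1 n d).bind fun κ => PMF.bind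
      (PMF.bind _ _) _) true) = _
    simp only [PMF.bind_bind]
    rfl
  rw [hcr, bind_prepColl (L n) fun d κ st => (K n st).map fun v => decide (IsCollision P n d κ v)]
  refine ENNReal.toReal_mono (pr_ne_top _ _) (pr_bind_mono _ fun y _ => pr_bind_mono _ fun μ _ => ?_)
  rw [h₂, pr_map, pr_map]
  refine pr_mono _ fun s hs h => ?_
  rw [decide_eq_true_iff]
  exact game_rec₁ (L n) _ A s hs h

end Bound

end DBE

/-! ### Deciding BDHE from a recorded hit -/

noncomputable section
namespace DBE

section Guess

open Val Prim

open scoped ENNReal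

variable (P : PairingSystem)

/-- The last step of the attack that guesses a user: the bit 0 if the recorded query confirms
the challenge. -/
def finGuess (v : Val) : Val :=
  let e := v.tl.hd
  let r := v.tl.tl.tl.tl.tl.tl
  cond r (not (beq
    (pair.det P [e.fld 0, cond (e.fld 19) r.tl r.hd, (e.fld 20).hd])
    (mulGT.det P [e.fld 0, (e.fld 20).tl,
      pair.det P [e.fld 0, cond (e.fld 19) r.hd r.tl, (e.fld 20).hd]]))) one

instance : Feas P fun _ _ v => finGuess P v := by unfold finGuess; infer_instance

variable {P} {n : ℕ} (L : ℕ)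

/-- The two recorded elements differ by `g^(±a t)`, so their pairings with `ĝ^(a^(L+1))` differ by
`e(g, ĝ)^(±a^(L+2) t)`. The bit `b` tells the sign, hence the side of the equation on which `Z`
belongs. -/
theorem finGuess_eq {x : Theta P n} (hx : x.gh ≠ 1) (a : ZMod (P.grp x.d).p) (k : ℕ)
    (b μ : Bool) (A : Prog) (Z : (P.grp x.d).GT) :
    ∀ s ∈ ((x.sim₂ L a k b μ).game L A).support,
      ((finGuess P (.node (s.mem 0) ((x.sim₂ L a k b μ).encState L
        (.node (P.encGh x.d (x.gh ^ (a ^ (L + 1)).val)) (P.encGT x.d Z)) s.env))).toBool = false ↔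
      s.env.rec₂ ≠ nil ∧ Z = (P.grp x.d).e x.g x.gh ^ (a ^ (L + 2) * x.t).val) := by
  intro s hs
  set h := x.gh ^ (a ^ (L + 1)).val
  have hv : finGuess P (.node (s.mem 0) ((x.sim₂ L a k b μ).encState L
        (.node (P.encGh x.d h) (P.encGT x.d Z)) s.env)) = cond s.env.rec₂ (Val.not (beq
      (pair.det P [P.descVal x.d, cond (ofBool b) s.env.rec₂.tl s.env.rec₂.hd, P.encGh x.d h])
      (mulGT.det P [P.descVal x.d, P.encGT x.d Z, pair.det P [P.descVal x.d,
        cond (ofBool b) s.env.rec₂.hd s.env.rec₂.tl, P.encGh x.d h]]))) one := rfl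
  rw [hv]
  by_cases hr : s.env.rec₂ = nil
  · rw [hr]
    simp [one, cond_def]
  · obtain ⟨y, hy⟩ := game_rec₂ L hx a k b μ A s hs hr
    have he : ∀ z : ZMod (P.grp x.d).p, (P.grp x.d).e (y * x.g ^ z.val) h =
        (P.grp x.d).e y h * (P.grp x.d).e x.g x.gh ^ (z * a ^ (L + 1)).val := by
      intro z
      rw [map_mul, MonoidHom.mul_apply, BilinearGroup.e_pow_pow]
    have hz : a * x.t * a ^ (L + 1) = a ^ (L + 2) * x.t := by ring
    rw [hy, cond_node, toBool_not, beq, toBool_ofBool, hd_node, tl_node]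
    simp only [Bool.not_eq_false', decide_eq_true_iff]
    have hne : Val.node (P.encG x.d y)
        (P.encG x.d (y * x.g ^ (if b then a * x.t else -(a * x.t)).val)) ≠ nil := by
      intro h
      cases h
    rw [and_iff_right hne]
    cases b
    · have : ∀ u v, cond (ofBool false) u v = v := fun _ _ => rfl
      rw [this, this, det_pair, det_pair, det_mulGT, (P.encGT_inj x.d).eq_iff]
      simp only [Bool.false_eq_true, if_false]
      rw [he, neg_mul, hz, pow_val_neg, mul_comm, mul_assoc, eq_comm, mul_eq_left, inv_mul_eq_one,
        eq_comm]
    · have : ∀ u v, cond (ofBool true) u v = u := fun _ _ => rfl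
      rw [this, this, det_pair, det_pair, det_mulGT, (P.encGT_inj x.d).eq_iff]
      simp only [if_true]
      rw [he, hz, mul_comm, mul_left_inj, eq_comm]

variable {L}

/-- The experiment in which a user and a bit are guessed. -/
def guessDist (P : PairingSystem) (n L : ℕ) (A : Prog) : PMF (Config Full) :=
  (thetaDist P n L).bind fun y => (P.grp y.d).randScalar.bind fun a => (randIdx L).bind fun k =>
    (PMF.uniformOfFintype Bool).bind fun b => (PMF.uniformOfFintype Bool).bind fun μ =>
    (y.sim₂ L a k b μ).game L A

/-- A uniform scalar takes a given value with probability `1/p`, and `p ≥ 2`. -/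
theorem two_mul_pr_randScalar {α : Type} (𝔹 : BilinearGroup) (v : ZMod 𝔹.p) (D : PMF α)
    (B : α → Prop) : 2 * pr (𝔹.randScalar.bind fun w => D.map fun s => (w = v, s))
      (fun r => r.1 ∧ B r.2) ≤ pr D B := by
  have h : ∀ w, pr (D.map fun s => (w = v, s)) (fun r => r.1 ∧ B r.2) =
      if w = v then pr D B else 0 := by
    intro w
    rw [pr_map]
    split_ifs with hw
    · simp [hw]
    · simp only [hw, false_and]
      rw [pr]
      simp
  have hp : (2 : ℝ≥0∞) ≤ 𝔹.p := by exact_mod_cast 𝔹.prime.two_le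
  rw [pr_bind]
  simp only [h]
  rw [tsum_eq_single v (fun w hw => by rw [if_neg hw, mul_zero]), if_pos rfl,
    BilinearGroup.randScalar, PMF.uniformOfFintype_apply, ZMod.card, ← mul_assoc]
  refine mul_le_of_le_one_left' ?_
  rw [← div_eq_mul_inv]
  exact ENNReal.div_le_of_le_mul (by rwa [one_mul])

/-- For the true `Z` the output is `0` exactly if a hit is recorded. For random `Z` the exponent
`w`, which the game does not use, must in addition equal `a^(L+2) t`. So the probability at least
halves, and the advantage is at least half of that of recording a hit. -/
theorem bdheAdv_guess {L : ℕ → ℕ} {q : Polynomial ℕ} (hq : ∀ n, L n ≤ q.eval n) {A : Prog}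
    (hA : PPT P L A) : ∃ B : Prog, PPT P L B ∧ ∀ n,
      (pr (guessDist P n (L n) A) fun s => s.env.rec₂ ≠ nil).toReal ≤ 2 * bdheAdv P L B n := by
  obtain ⟨B, hB, K, h₁, h₂⟩ := exists_reduction hq hA (feasR_prepGuess P)
    (fin := fun _ _ v => finGuess P v) inferInstance
  refine ⟨B, hB, fun n => ?_⟩
  have hb : ∀ b', bdheProb P L B n b' = (pr ((thetaDist P n (L n)).bind fun y =>
      (P.grp y.d).randScalar.bind fun a => (randIdx (L n)).bind fun k =>
      (PMF.uniformOfFintype Bool).bind fun b => (PMF.uniformOfFintype Bool).bind fun μ =>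
      (P.grp y.d).randScalar.bind fun w => ((y.sim₂ (L n) a k b μ).game (L n) A).map fun s =>
        ((if b' then w else a ^ (L n + 2) * y.t) = a ^ (L n + 2) * y.t, s))
      fun r => r.1 ∧ r.2.env.rec₂ ≠ nil).toReal := by
    intro b'
    rw [bdheProb_eq]
    simp only [h₁]
    rw [← PMF.bind_bind, bind_prepGuess]
    simp only [PMF.bind_bind, PMF.bind_map, Function.comp_def, h₂]
    congr 1
    have hc : ∀ y ∈ (thetaDist P n (L n)).support, ∀ a k b μ w,
        pr (((y.sim₂ (L n) a k b μ).game (L n) A).map fun s => finGuess P (.node (s.mem 0)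
          ((y.sim₂ (L n) a k b μ).encState (L n) (.node (P.encGh y.d (y.gh ^ (a ^ (L n + 1)).val))
          (P.encGT y.d ((P.grp y.d).e y.g y.gh ^
            (if b' then w else a ^ (L n + 2) * y.t).val))) s.env)))
          (fun v => v.toBool = false) =
        pr (((y.sim₂ (L n) a k b μ).game (L n) A).map fun s =>
          ((if b' then w else a ^ (L n + 2) * y.t) = a ^ (L n + 2) * y.t, s))
          (fun r => r.1 ∧ r.2.env.rec₂ ≠ nil) := by
      intro y hy a k b μ w
      obtain ⟨hg, hgh⟩ := thetaDist_gh hy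
      rw [pr_map, pr_map]
      refine pr_congr _ fun s hs => (finGuess_eq (L n) hgh a k b μ A _ s hs).trans ?_
      rw [and_comm]
      refine and_congr_left fun _ => ?_
      have := (P.grp y.d).pow_injective (P.grp y.d).card_GT ((P.grp y.d).e_ne_one hg hgh)
      exact ⟨fun h => this h, fun h => by rw [h]⟩
    refine le_antisymm ?_ ?_ <;>
    exact pr_bind_mono _ fun y hy => pr_bind_mono _ fun a _ => pr_bind_mono _ fun k _ =>
      pr_bind_mono _ fun b _ => pr_bind_mono _ fun μ _ => pr_bind_mono _ fun w _ => by
        rw [hc y hy a k b μ w]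
  have h₀ : bdheProb P L B n false =
      (pr (guessDist P n (L n) A) fun s => s.env.rec₂ ≠ nil).toReal := by
    rw [hb, guessDist]
    congr 1
    refine le_antisymm ?_ ?_ <;>
    exact pr_bind_mono _ fun y _ => pr_bind_mono _ fun a _ => pr_bind_mono _ fun k _ =>
      pr_bind_mono _ fun b _ => pr_bind_mono _ fun μ _ => by
        simp only [Bool.false_eq_true, if_false, PMF.bind_const, pr_map, true_and, le_refl]
  have h₃ : 2 * bdheProb P L B n true ≤
      (pr (guessDist P n (L n) A) fun s => s.env.rec₂ ≠ nil).toReal := by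
    rw [hb, guessDist, ← ENNReal.toReal_ofNat 2, ← ENNReal.toReal_mul]
    refine ENNReal.toReal_mono (pr_ne_top _ _) ?_
    exact mul_pr_bind_mono _ _ fun y _ => mul_pr_bind_mono _ _ fun a _ =>
      mul_pr_bind_mono _ _ fun k _ => mul_pr_bind_mono _ _ fun b _ =>
      mul_pr_bind_mono _ _ fun μ _ => by
        simp only [if_true]
        exact two_mul_pr_randScalar _ _ _ _
  have := le_abs_self (bdheProb P L B n false - bdheProb P L B n true)
  rw [bdheAdv]
  linarith

end Guess

end DBE

/-! ### Combination of the bounds -/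

noncomputable section
namespace DBE

section Bound

open Val

open scoped ENNReal

variable {P : PairingSystem}

theorem pr_exists_le {α ι : Type} (p : PMF α) (s : Finset ι) (A : ι → α → Prop) :
    pr p (fun a => ∃ i ∈ s, A i a) ≤ ∑ i ∈ s, pr p (A i) := by
  have : {a | ∃ i ∈ s, A i a} = ⋃ i ∈ s, {a | A i a} := by ext; simp
  rw [pr, this]
  exact MeasureTheory.measure_biUnion_finset_le s _

/-- By `game_ev` every hit satisfies `Cons` for some `k < L` and some `b`. A union bound compares
the sum over these pairs with a random guess: a factor `2 L` for the index and `2` for the bit. -/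
theorem pr_ev_le {n : ℕ} (L : ℕ) (A : Prog) :
    pr ((thetaDist P n L).bind fun y => (PMF.uniformOfFintype Bool).bind fun μ =>
      (y.real L μ).game L A) (fun s => s.env.ev ≠ none) ≤
    4 * (L : ℝ≥0∞) * pr (guessDist P n L A) fun s => s.env.rec₂ ≠ nil := by
  rw [guessDist]
  refine pr_bind_le_mul _ fun y hy => ?_
  -- The secret `a` does not occur in the real game and is drawn idly, to match `guessDist`.
  rw [← PMF.bind_const (P.grp y.d).randScalar ((PMF.uniformOfFintype Bool).bind _)]
  refine pr_bind_le_mul _ fun a _ => ?_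
  have hgh := (thetaDist_gh hy).2
  set G : ℕ → Bool → ℝ≥0∞ := fun k b => pr ((PMF.uniformOfFintype Bool).bind fun μ =>
    (y.sim₂ L a k b μ).game L A) fun s => s.env.rec₂ ≠ nil with hG
  have h₁ : pr ((PMF.uniformOfFintype Bool).bind fun μ => (y.real L μ).game L A)
      (fun s => s.env.ev ≠ none) ≤ ∑ k ∈ Finset.range L, (G k false + G k true) := by
    refine le_trans (pr_mono _ (B := fun s => ∃ k ∈ Finset.range L,
      Cons k false s.env.ev ∨ Cons k true s.env.ev) fun s hs he => ?_) ?_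
    · obtain ⟨μ, -, hs⟩ := (PMF.mem_support_bind_iff _ _ _).mp hs
      obtain ⟨k, hk, b, hb⟩ := game_ev L hgh μ A s hs he
      refine ⟨k, Finset.mem_range.mpr hk, ?_⟩
      cases b
      · exact Or.inl hb
      · exact Or.inr hb
    · refine (pr_exists_le _ _ _).trans (Finset.sum_le_sum fun k _ => (pr_or_le _ _ _).trans ?_)
      exact add_le_add (pr_bind_mono _ fun μ _ => game_sim₂ L y a k false μ A)
        (pr_bind_mono _ fun μ _ => game_sim₂ L y a k true μ A)
  refine h₁.trans ?_
  rw [pr_bind, ← ENNReal.tsum_mul_left]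
  -- The random index may be `L` or larger; those terms are dropped.
  refine le_trans ?_ (ENNReal.sum_le_tsum (Finset.range L))
  refine Finset.sum_le_sum fun k hk => ?_
  have h₂ : 1 ≤ 2 * (L : ℝ≥0∞) * randIdx L k := by
    refine (randIndex_ge (Finset.mem_range.mp hk)).trans ?_
    rw [← pr_singleton (randIdx L), randIdx, pr_map]
    gcongr
    exact pr_mono _ fun v _ hv => by rw [hv, len_ofNat]
  rw [hG, ← two_mul_pr_flip fun b => (PMF.uniformOfFintype Bool).bind fun μ =>
    (y.sim₂ L a k b μ).game L A]
  calc _ = 1 * (2 * pr ((PMF.uniformOfFintype Bool).bind fun b =>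
        (PMF.uniformOfFintype Bool).bind fun μ => (y.sim₂ L a k b μ).game L A)
        fun s => s.env.rec₂ ≠ nil) := (one_mul _).symm
    _ ≤ (2 * (L : ℝ≥0∞) * randIdx L k) * (2 * pr ((PMF.uniformOfFintype Bool).bind fun b =>
        (PMF.uniformOfFintype Bool).bind fun μ => (y.sim₂ L a k b μ).game L A)
        fun s => s.env.rec₂ ≠ nil) := by gcongr
    _ = _ := by ring

/-- The experiment with coin `μ` and all random choices made in advance. -/
def realDist (P : PairingSystem) (n L : ℕ) (A : Prog) (μ : Bool) : PMF (Config Full) :=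
  (thetaDist P n L).bind fun y => (y.real L μ).game L A

/-- The experiment in the first simulation. -/
def simDist (P : PairingSystem) (n L : ℕ) (A : Prog) (μ : Bool) : PMF (Config Full) :=
  (thetaDist P n L).bind fun y => (y.sim₁ L μ).game L A

theorem ssExperiment_true (L : ℕ → ℕ) (A : Prog) (n : ℕ) :
    2 * (ssExperiment P L A n true).toReal =
      (pr (realDist P n (L n) A false) fun s => (s.mem 0).toBool = false).toReal +
      (1 - (pr (realDist P n (L n) A true) fun s => (s.mem 0).toBool = false).toReal) := by
  have h : ssExperiment P L A n = (PMF.uniformOfFintype Bool).bind fun μ =>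
      (realDist P n (L n) A μ).map fun s => (s.mem 0).toBool == μ := by
    show (PMF.uniformOfFintype Bool).bind _ = _
    congr 1
    funext μ
    have := congrArg (PMF.map fun m => (m 0).toBool == μ)
      (run_challenger (P := P) (n := n) (L n) μ A)
    rw [PMF.map_comp] at this
    refine Eq.trans ?_ (this.trans ?_)
    · rfl
    · rw [← PMF.map_bind, PMF.map_comp]
      rfl
  rw [← pr_toReal_add_pr_not (realDist P n (L n) A true) fun s => (s.mem 0).toBool = false,
    add_sub_cancel_left, ← ENNReal.toReal_add (pr_ne_top _ _) (pr_ne_top _ _),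
    ← ENNReal.toReal_ofNat 2, ← ENNReal.toReal_mul, ← pr_singleton, h, two_mul_pr_flip, pr_map,
    pr_map]
  simp

theorem abs_sub_sim_le (n L : ℕ) (A : Prog) (μ : Bool) :
    |(pr (realDist P n L A μ) fun s => (s.mem 0).toBool = false).toReal -
      (pr (simDist P n L A μ) fun s => (s.mem 0).toBool = false).toReal| ≤
      (pr (realDist P n L A μ) fun s => s.env.bad).toReal := by
  have key : ∀ B : Val → Prop, (pr (realDist P n L A μ) fun s => B (s.mem 0)).toReal ≤
      (pr (simDist P n L A μ) fun s => B (s.mem 0)).toReal +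
      (pr (realDist P n L A μ) fun s => s.env.bad).toReal := by
    intro B
    rw [← ENNReal.toReal_add (pr_ne_top _ _) (pr_ne_top _ _)]
    refine ENNReal.toReal_mono (ENNReal.add_ne_top.mpr ⟨pr_ne_top _ _, pr_ne_top _ _⟩) ?_
    refine pr_bind_le_add _ fun y _ => ?_
    refine (pr_mono _ (B := fun s => (B (s.mem 0) ∧ ¬ s.env.bad) ∨ s.env.bad) fun s _ hs => ?_).trans
      ((pr_or_le _ _ (fun s => s.env.bad)).trans (add_le_add_left ((game_sim₁ L y μ A).pr_le ?_) _))
    · by_cases h : s.env.bad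
      · exact Or.inr h
      · exact Or.inl ⟨hs, h⟩
    · rintro s t (h | h) ⟨h₁, h₂⟩
      · rwa [← h]
      · exact (h₂ h).elim
  have h₁ := key fun v => v.toBool = false
  -- `bad` is measured in the real game only, so the reverse inequality comes from the complementary
  -- event.
  have h₂ := key fun v => ¬ v.toBool = false
  have h₃ := pr_toReal_add_pr_not (realDist P n L A μ) fun s => (s.mem 0).toBool = false
  have h₄ := pr_toReal_add_pr_not (simDist P n L A μ) fun s => (s.mem 0).toBool = false
  rw [abs_le]
  constructor <;> linarith

/-- The advantage is half the difference of the probabilities of guess `0` under the two coins.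
Passing to the simulation costs the probability of `bad` for each coin, and half the sum of these is
the probability for a random coin, bounded by collisions plus hits. A factor `1/2` at the first
summand is given away. -/
theorem ssAdv_le {L : ℕ → ℕ} {q : Polynomial ℕ} (hq : ∀ n, L n ≤ q.eval n) {A : Prog}
    (hA : PPT P L A) : ∃ B₁ B₂ B₃ : Prog, PPT P L B₁ ∧ PPT P L B₂ ∧ PPT P L B₃ ∧
      ∀ n, ssAdv P L A n ≤
        bdheAdv P L B₁ n + crAdv P L B₂ n + ((8 * q).eval n : ℕ) * bdheAdv P L B₃ n := by
  obtain ⟨B₁, hB₁, h₁⟩ := bdheProb_sim₁ hq hA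
  obtain ⟨B₂, hB₂, h₂⟩ := crAdv_ge hq hA
  obtain ⟨B₃, hB₃, h₃⟩ := bdheAdv_guess hq hA
  refine ⟨B₁, B₂, B₃, hB₁, hB₂, hB₃, fun n => ?_⟩
  have h₂ := h₂ n
  have h₃ := h₃ n
  have hs := ssExperiment_true (P := P) L A n
  have hb₀ := abs_le.mp (abs_sub_sim_le (P := P) n (L n) A false)
  have hb₁ := abs_le.mp (abs_sub_sim_le (P := P) n (L n) A true)
  have hB : bdheAdv P L B₁ n =
      |(pr (simDist P n (L n) A false) fun s => (s.mem 0).toBool = false).toReal -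
      (pr (simDist P n (L n) A true) fun s => (s.mem 0).toBool = false).toReal| := by
    rw [bdheAdv, h₁, h₁]
    rfl
  have hbad : (pr (realDist P n (L n) A false) fun s => s.env.bad).toReal +
      (pr (realDist P n (L n) A true) fun s => s.env.bad).toReal ≤ 2 *
      ((pr ((thetaDist P n (L n)).bind fun y => (PMF.uniformOfFintype Bool).bind fun μ =>
        (y.real (L n) μ).game (L n) A) fun s => s.env.rec₁ ≠ nil).toReal +
      (pr ((thetaDist P n (L n)).bind fun y => (PMF.uniformOfFintype Bool).bind fun μ =>
        (y.real (L n) μ).game (L n) A) fun s => s.env.ev ≠ none).toReal) := by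
    rw [← ENNReal.toReal_add (pr_ne_top _ _) (pr_ne_top _ _),
      ← ENNReal.toReal_add (pr_ne_top _ _) (pr_ne_top _ _), ← two_mul_pr_flip, ENNReal.toReal_mul,
      ENNReal.toReal_ofNat]
    refine mul_le_mul_of_nonneg_left (ENNReal.toReal_mono
      (ENNReal.add_ne_top.mpr ⟨pr_ne_top _ _, pr_ne_top _ _⟩) ?_) (by norm_num)
    have : ((PMF.uniformOfFintype Bool).bind fun μ => realDist P n (L n) A μ) =
        (thetaDist P n (L n)).bind fun y => (PMF.uniformOfFintype Bool).bind fun μ =>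
          (y.real (L n) μ).game (L n) A := PMF.bind_comm _ _ _
    refine le_trans (le_of_eq ?_) (pr_or_le _ _ _)
    rw [← this]
    rfl
  have hev : (pr ((thetaDist P n (L n)).bind fun y => (PMF.uniformOfFintype Bool).bind fun μ =>
        (y.real (L n) μ).game (L n) A) fun s => s.env.ev ≠ none).toReal ≤
      4 * (L n : ℝ) * (pr (guessDist P n (L n) A) fun s => s.env.rec₂ ≠ nil).toReal := by
    have := ENNReal.toReal_mono (ENNReal.mul_ne_top (by simp [ENNReal.mul_eq_top])
      (pr_ne_top _ _)) (pr_ev_le (P := P) (n := n) (L n) A)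
    simpa using this
  have h₄ : 4 * (L n : ℝ) * (pr (guessDist P n (L n) A) fun s => s.env.rec₂ ≠ nil).toReal ≤
      4 * (L n : ℝ) * (2 * bdheAdv P L B₃ n) :=
    mul_le_mul_of_nonneg_left h₃ (by positivity)
  -- `4 L` from guessing and `2` from the final test; `q` bounds `L`.
  have h₅ : 8 * (L n : ℝ) * bdheAdv P L B₃ n ≤ ((8 * q).eval n : ℕ) * bdheAdv P L B₃ n := by
    refine mul_le_mul_of_nonneg_right ?_ (abs_nonneg _)
    have : 8 * L n ≤ (8 * q).eval n := by
      rw [Polynomial.eval_mul, Polynomial.eval_ofNat]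
      exact Nat.mul_le_mul_left 8 (hq n)
    exact_mod_cast this
  have h₆ := le_abs_self ((pr (simDist P n (L n) A false) fun s => (s.mem 0).toBool = false).toReal -
      (pr (simDist P n (L n) A true) fun s => (s.mem 0).toBool = false).toReal)
  have h₇ := neg_abs_le ((pr (simDist P n (L n) A false) fun s => (s.mem 0).toBool = false).toReal -
      (pr (simDist P n (L n) A true) fun s => (s.mem 0).toBool = false).toReal)
  rw [← hB] at h₆ h₇
  have h₈ : 0 ≤ bdheAdv P L B₁ n := abs_nonneg _
  rw [ssAdv, abs_le]
  constructor <;> linarith [hb₀.1, hb₀.2, hb₁.1, hb₁.2]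

theorem Negligible.of_le {f₁ f₂ f₃ f : ℕ → ℝ} {q : Polynomial ℕ} (h₁ : Negligible f₁)
    (h₂ : Negligible f₂) (h₃ : Negligible f₃) (hf : ∀ n, 0 ≤ f n)
    (h : ∀ n, f n ≤ f₁ n + f₂ n + (q.eval n : ℕ) * f₃ n) : Negligible f := by
  have h₄ := h₃.polynomial_mul (q.map (Nat.castRingHom ℝ))
  refine ((h₁.add h₂).add h₄).trans_abs_le fun n => ?_
  rw [abs_of_nonneg (hf n)]
  refine (h n).trans (le_trans (le_of_eq ?_) (le_abs_self _))
  simp [Polynomial.eval_natCast_map]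

end Bound

end DBE

end

theorem mainTheorem1 (P : DBE.PairingSystem) (L : ℕ → ℕ)
    (hL : ∃ q : Polynomial ℕ, ∀ n, L n ≤ q.eval n) :
    (DBE.BDHEAssumption P L → DBE.CollisionResistant P L → DBE.SSCCASecure P L) ∧
    ∀ A : DBE.Prog, DBE.PPT P L A →
      ∃ B₁ B₂ B₃ : DBE.Prog, DBE.PPT P L B₁ ∧ DBE.PPT P L B₂ ∧ DBE.PPT P L B₃ ∧
        ∃ q : Polynomial ℕ, ∀ n : ℕ,
          DBE.ssAdv P L A n ≤
            DBE.bdheAdv P L B₁ n + DBE.crAdv P L B₂ n + ((q.eval n : ℕ) : ℝ) * DBE.bdheAdv P L B₃ n := by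
  obtain ⟨q, hq⟩ := hL
  refine ⟨fun h₁ h₂ A hA => ?_, fun A hA => ?_⟩
  · obtain ⟨B₁, B₂, B₃, hB₁, hB₂, hB₃, h⟩ := DBE.ssAdv_le hq hA
    exact DBE.Negligible.of_le (h₁ B₁ hB₁) (h₂ B₂ hB₂) (h₁ B₃ hB₃) (fun n => abs_nonneg _) h
  · obtain ⟨B₁, B₂, B₃, hB₁, hB₂, hB₃, h⟩ := DBE.ssAdv_le hq hA
    exact ⟨B₁, B₂, B₃, hB₁, hB₂, hB₃, 8 * q, h⟩
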